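/- **General dynamical clustering.** *Model.* Let $\Delta>1$, $\lambda>0$, $\beta\ge\frac12(1-\frac1\Delta)$ and $\Theta_0=1-\frac1\Delta$. Let $\omega=(\omega_i)_{i\in\mathbb Z}$ be real random variables whose joint distribution is ergodic with respect to translations of $\mathbb Z$ (in particular they are identically distributed), with single-site distribution $\mu$ satisfying $\{0,1\}\subset\operatorname{supp}\mu\subset[0,1]$ and $\mu(\{0\})=0$. For $L\in\mathbb N$ let, on $\mathcal H^{(L)}=\bigotimes_{i\in[-L,L]\cap\mathbb Z}\mathbb C^2$, $$H=H^{(L)}_\omega=\sum_{i=-L}^{L-1}h_{i,i+1}+\lambda\sum_{i=-L}^{L}\omega_i\mathcal N_i+\beta(\mathcal N_{-L}+\mathcal N_L),$$ $$h_{i,i+1}=\tfrac14\left(1-\sigma^z_i\sigma^z_{i+1}\right)-\tfrac1{4\Delta}\left(\sigma^x_i\sigma^x_{i+1}+\sigma^y_i\sigma^y_{i+1}\right),\qquad \mathcal N_i=\tfrac12(1-\sigma_i^z).$$ This is a *disordered XXZ spin chain*; it is a *random XXZ spin chain* if moreover the $\omega_i$ are independent. *Property DL.* The chain satisfies Property DL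 with $\Theta_1>\Theta_0$ if there are constants $C<\infty$ and $m>0$ such that, with $I=[\Theta_0,\Theta_1]$, for all $L\in\mathbb N$ and all $i,j\in[-L,L]$, $$\mathbb E\Big(\sup_{g}\big\|\mathcal N_i\,g(H^{(L)})\,\mathcal N_j\big\|_1\Big)\le Ce^{-m|i-j|},$$ where $\|\cdot\|_1$ is the trace norm and the supremum is over all Borel functions $g:\mathbb R\to\mathbb C$ with $|g|\le\chi_I$. *Notation.* For a Borel set $B\subset\mathbb R$ put $P_B=\chi_B(H^{(L)})$, $P_0=P_{\{0\}}$, $X_B=P_BXP_B$, $H_B=P_BH$, $\tau^B_t(X)=e^{itH_B}Xe^{-itH_B}$ and $R_B(X,Y)=P_BX(1-P_B)YP_B$. A local observable $X$ on $[-L,L]$ comes with a support, a nonempty integer interval $\mathcal S_X=[s_X,r_X]\subset[-L,L]$: it is an operator on $\bigotimes_{j\in\mathcal S_X}\mathbb C^2$, regarded as an operator on $\mathcal H^{(L)}$ that acts as the identity on the other spins. Further, $|\mathcal S_X|$ is the number of sites of $\mathcal S_X$, $\operatorname{dist}(X,Y)$ is the distance between $\mathcal S_X$ and $\mathcal S_Y$,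 and $\|\cdot\|$ is the operator norm. *Theorem.* Let $H$ be a disordered XXZ spin chain satisfying Property DL with $\Theta_1$. Let $K=[\Theta_0,\Theta_2]$ with $\Theta_0<\Theta_2<\min\{2\Theta_0,\Theta_1\}$, and let $\alpha\in(0,1)$. Then there exist $\tilde m>0$ and $C<\infty$ such that for all $L\in\mathbb N$ and all local observables $X,Y$ on $[-L,L]$, $$\mathbb E\Big(\sup_{t\in\mathbb R}\big\|R_K(\tau^K_t(X),Y)-\big(\tau^K_t(X)P_0Y+\tau^K_t(Y)P_0X\big)_K\big\|\Big)\le C\big(1+\ln\min\{|\mathcal S_X|,|\mathcal S_Y|\}\big)\|X\|\|Y\|e^{-\tilde m(\operatorname{dist}(X,Y))^\alpha}\tag{1}$$ and $$\mathbb E\Big(\sup_{t\in\mathbb R}\big\|\big([[\tau^K_t(X),Y]]\big)_K\big\|\Big)\le C\big(1+\ln\min\{|\mathcal S_X|,|\mathcal S_Y|\}\big)\|X\|\|Y\|e^{-\tilde m(\operatorname{dist}(X,Y))^\alpha},\tag{2}$$ where $$[[\tau^K_t(X),Y]]=[\tau^K_t(X),Y]-\big(\tau^K_t(X)P_0Y+\tau^K_t(Y)P_0X\big)+\big(YP_0\tau^K_t(X)+XP_0\tau^K_t(Y)\big).$$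 Moreover, if $H$ is a random XXZ spin chain (satisfying the same hypotheses), neither estimate holds without the counterterms: there are no $\tilde m>0$ and $C<\infty$ such that (1), with $R_K(\tau^K_t(X),Y)$ alone inside the norm, holds for all $L$, $X$, $Y$; and there are no $\tilde m>0$ and $C<\infty$ such that (2), with $([\tau^K_t(X),Y])_K$ alone inside the norm, holds for all $L$, $X$, $Y$. -/

import Mathlib

open MeasureTheory ProbabilityTheory
open scoped ENNReal Matrix Matrix.Norms.L2Operator

noncomputable section

namespace XXZ

/-- The sites of the chain of half-length `L`: the integers in `[-L, L]`. -/
abbrev Site (L : ℕ) : Type := {i : ℤ // i ∈ Finset.Icc (-(L : ℤ)) (L : ℤ)}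

/-- Spin configurations; the value `0` is spin up `e₊`, the value `1` is spin down `e₋`. They index
the standard orthonormal basis of `⨂_{i ∈ [-L, L]} ℂ²`. -/
abbrev Config (L : ℕ) : Type := Site L → Fin 2

/-- Operators on `⨂_{i ∈ [-L, L]} ℂ²`, as matrices in the basis of spin configurations. The norm
`‖·‖` on them is the operator norm of the Hilbert space. -/
abbrev Op (L : ℕ) : Type := Matrix (Config L) (Config L) ℂ

/-! ### Spin operators -/

/-- The Pauli matrix `σˣ`. -/
def pauliX : Matrix (Fin 2) (Fin 2) ℂ := !![0, 1; 1, 0]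

/-- The Pauli matrix `σʸ`. -/
def pauliY : Matrix (Fin 2) (Fin 2) ℂ := !![0, -Complex.I; Complex.I, 0]

/-- The Pauli matrix `σᶻ`. -/
def pauliZ : Matrix (Fin 2) (Fin 2) ℂ := !![1, 0; 0, -1]

/-- The one-site operator `A` acting on the spin at site `i`, and as the identity elsewhere. -/
def siteOp {L : ℕ} (i : Site L) (A : Matrix (Fin 2) (Fin 2) ℂ) : Op L :=
  Matrix.of fun σ τ => if ∀ k, k ≠ i → σ k = τ k then A (σ i) (τ i) else 0

/-- The local number operator `𝒩ᵢ = (1 - σᵢᶻ) / 2`. -/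
def numOp {L : ℕ} (i : Site L) : Op L := (1 / 2 : ℂ) • (1 - siteOp i pauliZ)

/-- The bond Hamiltonian
`h_{i,j} = (1/4) (1 - σᵢᶻ σⱼᶻ) - (1/(4Δ)) (σᵢˣ σⱼˣ + σᵢʸ σⱼʸ)`. -/
def bond {L : ℕ} (Δ : ℝ) (i j : Site L) : Op L :=
  (1 / 4 : ℂ) • (1 - siteOp i pauliZ * siteOp j pauliZ)
    - (1 / (4 * (Δ : ℂ))) •
      (siteOp i pauliX * siteOp j pauliX + siteOp i pauliY * siteOp j pauliY)

/-- The left end `-L` of the chain. -/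
def leftEnd (L : ℕ) : Site L := ⟨-(L : ℤ), by simp⟩

/-- The right end `L` of the chain. -/
def rightEnd (L : ℕ) : Site L := ⟨(L : ℤ), by simp⟩

/-- The finite volume Hamiltonian
`H^{(L)} = ∑_{i=-L}^{L-1} h_{i,i+1} + lam ∑_i ωᵢ 𝒩ᵢ + β (𝒩_{-L} + 𝒩_L)`. -/
def hamiltonian (Δ lam β : ℝ) (L : ℕ) (ω : ℤ → ℝ) : Op L :=
  (∑ i : Site L, ∑ j : Site L, if (j : ℤ) = (i : ℤ) + 1 then bond Δ i j else 0)
    + (lam : ℂ) • (∑ i : Site L, (ω (i : ℤ) : ℂ) • numOp i)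
    + (β : ℂ) • (numOp (leftEnd L) + numOp (rightEnd L))

/-! ### The Hamiltonian is self-adjoint (so that its functional calculus is meaningful) -/

theorem siteOp_isHermitian {L : ℕ} (i : Site L) {A : Matrix (Fin 2) (Fin 2) ℂ}
    (hA : A.IsHermitian) : (siteOp i A).IsHermitian := by
  ext σ τ
  simp only [siteOp, Matrix.conjTranspose_apply, Matrix.of_apply]
  by_cases h : ∀ k, k ≠ i → σ k = τ k
  · have h' : ∀ k, k ≠ i → τ k = σ k := fun k hk => (h k hk).symm
    rw [if_pos h, if_pos h', hA.apply]
  · have h' : ¬ ∀ k, k ≠ i → τ k = σ k := fun g => h fun k hk => (g k hk).symm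
    rw [if_neg h, if_neg h', star_zero]

theorem siteOp_mul_apply {L : ℕ} {i j : Site L} (hij : i ≠ j) (A B : Matrix (Fin 2) (Fin 2) ℂ)
    (σ τ : Config L) :
    (siteOp i A * siteOp j B) σ τ =
      if ∀ k, k ≠ i → k ≠ j → σ k = τ k then A (σ i) (τ i) * B (σ j) (τ j) else 0 := by
  rw [Matrix.mul_apply, Finset.sum_eq_single (Function.update σ i (τ i))]
  · simp only [siteOp, Matrix.of_apply]
    have h1 : ∀ k, k ≠ i → σ k = Function.update σ i (τ i) k := by
      intro k hk; simp [hk]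
    rw [if_pos h1]
    have h2 : (∀ k, k ≠ j → Function.update σ i (τ i) k = τ k) ↔
        ∀ k, k ≠ i → k ≠ j → σ k = τ k := by
      constructor
      · intro h k hi hj
        simpa [hi] using h k hj
      · intro h k hj
        by_cases hi : k = i
        · subst hi; simp
        · simpa [hi] using h k hi hj
    by_cases h : ∀ k, k ≠ i → k ≠ j → σ k = τ k
    · rw [if_pos h, if_pos (h2.2 h)]
      simp [Function.update_of_ne hij.symm]
    · rw [if_neg h, if_neg (fun g => h (h2.1 g)), mul_zero]
  · intro ρ _ hρ
    simp only [siteOp, Matrix.of_apply]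
    by_cases h1 : ∀ k, k ≠ i → σ k = ρ k
    · by_cases h2 : ∀ k, k ≠ j → ρ k = τ k
      · exfalso
        apply hρ
        funext k
        by_cases hi : k = i
        · subst hi; simpa using h2 k hij
        · simpa [hi] using (h1 k hi).symm
      · rw [if_neg h2, mul_zero]
    · rw [if_neg h1, zero_mul]
  · intro h; exact absurd (Finset.mem_univ _) h

theorem siteOp_comm {L : ℕ} {i j : Site L} (hij : i ≠ j) (A B : Matrix (Fin 2) (Fin 2) ℂ) :
    siteOp i A * siteOp j B = siteOp j B * siteOp i A := by
  ext σ τ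
  rw [siteOp_mul_apply hij, siteOp_mul_apply hij.symm]
  have : (∀ k, k ≠ i → k ≠ j → σ k = τ k) ↔ ∀ k, k ≠ j → k ≠ i → σ k = τ k :=
    ⟨fun h k a b => h k b a, fun h k a b => h k b a⟩
  simp only [this, mul_comm]

theorem siteOp_mul_isHermitian {L : ℕ} {i j : Site L} (hij : i ≠ j)
    {A B : Matrix (Fin 2) (Fin 2) ℂ} (hA : A.IsHermitian) (hB : B.IsHermitian) :
    (siteOp i A * siteOp j B).IsHermitian := by
  rw [Matrix.IsHermitian, Matrix.conjTranspose_mul, (siteOp_isHermitian i hA).eq,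
    (siteOp_isHermitian j hB).eq, siteOp_comm hij]

theorem pauliX_isHermitian : pauliX.IsHermitian := by
  ext i j; fin_cases i <;> fin_cases j <;> simp [pauliX]

theorem pauliY_isHermitian : pauliY.IsHermitian := by
  ext i j; fin_cases i <;> fin_cases j <;> simp [pauliY]

theorem pauliZ_isHermitian : pauliZ.IsHermitian := by
  ext i j; fin_cases i <;> fin_cases j <;> simp [pauliZ]

theorem isHermitian_real_smul {L : ℕ} {A : Op L} (hA : A.IsHermitian) {c : ℂ}
    (hc : star c = c) : (c • A).IsHermitian := by
  rw [Matrix.IsHermitian, Matrix.conjTranspose_smul, hA.eq, hc]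

theorem numOp_isHermitian {L : ℕ} (i : Site L) : (numOp i).IsHermitian :=
  isHermitian_real_smul (Matrix.isHermitian_one.sub (siteOp_isHermitian i pauliZ_isHermitian))
    (by simp)

theorem bond_isHermitian {L : ℕ} (Δ : ℝ) {i j : Site L} (hij : i ≠ j) :
    (bond Δ i j).IsHermitian :=
  (isHermitian_real_smul (Matrix.isHermitian_one.sub
      (siteOp_mul_isHermitian hij pauliZ_isHermitian pauliZ_isHermitian)) (by simp)).sub
    (isHermitian_real_smul ((siteOp_mul_isHermitian hij pauliX_isHermitian pauliX_isHermitian).add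
      (siteOp_mul_isHermitian hij pauliY_isHermitian pauliY_isHermitian)) (by simp))

theorem isHermitian_sum {L : ℕ} {ι : Type} (s : Finset ι) (f : ι → Op L)
    (hf : ∀ i ∈ s, (f i).IsHermitian) : (∑ i ∈ s, f i).IsHermitian := by
  rw [Matrix.IsHermitian, Matrix.conjTranspose_sum]
  exact Finset.sum_congr rfl fun i hi => hf i hi

theorem hamiltonian_isHermitian (Δ lam β : ℝ) (L : ℕ) (ω : ℤ → ℝ) :
    (hamiltonian Δ lam β L ω).IsHermitian := by
  refine (Matrix.IsHermitian.add ?_ ?_).add ?_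
  · refine isHermitian_sum _ _ fun i _ => isHermitian_sum _ _ fun j _ => ?_
    split_ifs with h
    · refine bond_isHermitian Δ ?_
      rintro rfl
      omega
    · exact Matrix.isHermitian_zero
  · exact isHermitian_real_smul (isHermitian_sum _ _ fun i _ =>
      isHermitian_real_smul (numOp_isHermitian i) (by simp)) (by simp)
  · exact isHermitian_real_smul ((numOp_isHermitian _).add (numOp_isHermitian _)) (by simp)

/-! ### Functional calculus, trace norm, energy windows

In the definitions below `H` is a Hermitian matrix. -/

/-- The spectral projection `P_B = χ_B(H)`. -/
def specProj {L : ℕ} (H : Op L) (B : Set ℝ) : Op L := cfc (B.indicator (fun _ => (1 : ℝ))) H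

/-- `g(H)` for a complex valued function `g` on the line, namely `(Re g)(H) + i (Im g)(H)`. -/
def funCalc {L : ℕ} (g : ℝ → ℂ) (H : Op L) : Op L :=
  cfc (fun x => (g x).re) H + Complex.I • cfc (fun x => (g x).im) H

/-- The trace norm `‖A‖₁ = tr √(A* A)`. -/
def traceNorm {L : ℕ} (A : Op L) : ℝ := (Matrix.trace (cfc Real.sqrt (Aᴴ * A))).re

/-- The set `G_I` of Borel functions `g : ℝ → ℂ` with `|g| ≤ χ_I`. -/
def G (I : Set ℝ) : Set (ℝ → ℂ) :=
  {g | Measurable g ∧ ∀ x, ‖g x‖ ≤ I.indicator (fun _ => (1 : ℝ)) x}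

/-- The restriction `X_B = P_B X P_B` of `X` to the energy window `B`. -/
def window {L : ℕ} (H : Op L) (B : Set ℝ) (X : Op L) : Op L := specProj H B * X * specProj H B

/-- The truncated time evolution `τ_t^B(X) = e^{itH_B} X e^{-itH_B}`, where `H_B = P_B H`. -/
def evol {L : ℕ} (H : Op L) (B : Set ℝ) (t : ℝ) (X : Op L) : Op L :=
  NormedSpace.exp ((Complex.I * t) • (specProj H B * H)) * X *
    NormedSpace.exp ((-(Complex.I * t)) • (specProj H B * H))

/-- The correlator operator `R_B(X, Y) = P_B X (1 - P_B) Y P_B`. -/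
def corr {L : ℕ} (H : Op L) (B : Set ℝ) (X Y : Op L) : Op L :=
  specProj H B * X * (1 - specProj H B) * Y * specProj H B

/-- The spectral projection `P₀ = χ_{\{0\}}(H)` on the ground state energy. -/
def groundProj {L : ℕ} (H : Op L) : Op L := specProj H {0}

/-- The counterterms `(τ_t^B(X) P₀ Y + τ_t^B(Y) P₀ X)_B`. -/
def counterterm {L : ℕ} (H : Op L) (B : Set ℝ) (t : ℝ) (X Y : Op L) : Op L :=
  window H B (evol H B t X * groundProj H * Y + evol H B t Y * groundProj H * X)

/-- The commutator `[X, Y]`. -/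
def comm {L : ℕ} (X Y : Op L) : Op L := X * Y - Y * X

/-- The corrected commutator `[[τ_t^B(X), Y]]`. -/
def correctedComm {L : ℕ} (H : Op L) (B : Set ℝ) (t : ℝ) (X Y : Op L) : Op L :=
  comm (evol H B t X) Y
    - (evol H B t X * groundProj H * Y + evol H B t Y * groundProj H * X)
    + (Y * groundProj H * evol H B t X + X * groundProj H * evol H B t Y)

/-! ### Local observables -/

/-- A local observable on `[-L, L]` with a specified support `[s, r]`, a nonempty subinterval:
an operator `core` on `⨂_{j ∈ [s, r]} ℂ²`. -/
structure LocalObservable (L : ℕ) where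
  s : ℤ
  r : ℤ
  left_le : -(L : ℤ) ≤ s
  nonempty : s ≤ r
  le_right : r ≤ (L : ℤ)
  core : Matrix ({j : ℤ // j ∈ Finset.Icc s r} → Fin 2) ({j : ℤ // j ∈ Finset.Icc s r} → Fin 2) ℂ

namespace LocalObservable

variable {L : ℕ}

/-- The support `[s, r]`. -/
def supp (X : LocalObservable L) : Finset ℤ := Finset.Icc X.s X.r

theorem supp_subset (X : LocalObservable L) {j : ℤ} (hj : j ∈ Finset.Icc X.s X.r) :
    j ∈ Finset.Icc (-(L : ℤ)) (L : ℤ) := by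
  have h1 := X.left_le
  have h2 := X.le_right
  rw [Finset.mem_Icc] at hj ⊢
  omega

/-- The part of a configuration inside the support. -/
def restrict (X : LocalObservable L) (σ : Config L) : {j : ℤ // j ∈ Finset.Icc X.s X.r} → Fin 2 :=
  fun j => σ ⟨j.1, X.supp_subset j.2⟩

/-- The local observable as an operator on the whole chain, acting as the identity on the spins
outside the support. -/
def op (X : LocalObservable L) : Op L :=
  Matrix.of fun σ τ =>
    if ∀ k : Site L, (k : ℤ) ∉ X.supp → σ k = τ k then X.core (X.restrict σ) (X.restrict τ) else 0

/-- The distance between the supports of two local observables. -/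
def dist (X Y : LocalObservable L) : ℝ :=
  ⨅ p : {i : ℤ // i ∈ X.supp} × {j : ℤ // j ∈ Y.supp}, |((p.1 : ℤ) : ℝ) - ((p.2 : ℤ) : ℝ)|

end LocalObservable

/-! ### The disordered chain -/

/-- The translation of a disorder configuration by one site. -/
def shift (ω : ℤ → ℝ) : ℤ → ℝ := fun i => ω (i + 1)

/-- The data of a disordered XXZ spin chain in the Ising phase. The random variables `(ωᵢ)` are the
coordinates on the sample space `ℤ → ℝ`, with joint distribution `law`. -/
structure DisorderedChain where
  /-- The anisotropy. -/
  Δ : ℝ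
  one_lt_Δ : 1 < Δ
  /-- The disorder strength. -/
  lam : ℝ
  lam_pos : 0 < lam
  /-- The strength of the boundary term. -/
  β : ℝ
  le_β : 1 / 2 * (1 - 1 / Δ) ≤ β
  /-- The joint distribution of the random field. -/
  law : Measure (ℤ → ℝ)
  isProbabilityMeasure : IsProbabilityMeasure law
  /-- Ergodicity with respect to translations (this contains stationarity, hence the `ωᵢ` are
  identically distributed). -/
  ergodic : Ergodic shift law
  subset_support : {0, 1} ⊆ (law.map fun ω => ω 0).support
  support_subset : (law.map fun ω => ω 0).support ⊆ Set.Icc 0 1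
  apply_zero : (law.map fun ω => ω 0) {0} = 0

namespace DisorderedChain

/-- A random XXZ spin chain: the `ωᵢ` are independent. -/
def IsRandom (M : DisorderedChain) : Prop :=
  iIndepFun (fun (i : ℤ) (ω : ℤ → ℝ) => ω i) M.law

/-- The Hamiltonian `H_ω^{(L)}`. -/
def H (M : DisorderedChain) (L : ℕ) (ω : ℤ → ℝ) : Op L := hamiltonian M.Δ M.lam M.β L ω

/-- `Θ₀ = 1 - 1/Δ`. -/
def Θ₀ (M : DisorderedChain) : ℝ := 1 - 1 / M.Δ

/-- The expectation of a nonnegative quantity. -/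
def expect (M : DisorderedChain) (F : (ℤ → ℝ) → ℝ≥0∞) : ℝ≥0∞ := ∫⁻ ω, F ω ∂M.law

/-- Property DL (droplet localization) in the interval `[Θ₀, Θ₁]`. -/
def PropertyDL (M : DisorderedChain) (Θ₁ : ℝ) : Prop :=
  M.Θ₀ < Θ₁ ∧ ∃ C m : ℝ, 0 < m ∧ ∀ (L : ℕ) (i j : Site L),
    M.expect (fun ω => ⨆ g ∈ G (Set.Icc M.Θ₀ Θ₁),
        ENNReal.ofReal (traceNorm (numOp i * funCalc g (M.H L ω) * numOp j)))
      ≤ ENNReal.ofReal (C * Real.exp (-m * |((i : ℤ) : ℝ) - ((j : ℤ) : ℝ)|))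

end DisorderedChain

/-- The estimate
`C (1 + ln min(|S_X|, |S_Y|)) ‖X‖ ‖Y‖ e^{-m dist(X, Y)^α}`. -/
def clusterBound {L : ℕ} (C m α : ℝ) (X Y : LocalObservable L) : ℝ :=
  C * (1 + Real.log (min (X.supp.card : ℝ) (Y.supp.card : ℝ))) * ‖X.op‖ * ‖Y.op‖ *
    Real.exp (-m * X.dist Y ^ α)

end XXZ

end

/-! The all-up vector spans the kernel of `H` and the rest of the spectrum lies in `[Θ₀, ∞)`: a
configuration with a down spin (a particle) has at least two domain walls, and the boundary term
pays for those at the ends of the chain. Hence the window projection `P` annihilates the vacuum.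
Property DL, applied to the functions `e^{itx} χ_K(x)`, makes `occ A * P e^{itH} * occ A'` small for
distant half-lines `A`, `A'`, uniformly in time. By the C*-identity it also makes `P` small on
states with particles in both half-lines (`norm_specProj_mul_occ_mul_occ_sq_le`).

Let `X` lie to the left of `Y`, both shifted to have zero vacuum expectation. Neither observable can
then act in an empty neighbourhood without creating a particle. So `P X Y P` splits into terms with
a far apart pair of particles before or after, which are small, and two exchange terms, in which one
observable removes a particle and the other creates one (`Separated.mul_eq`). The intermediate state
of an exchange is the vacuum up to another far apart pair, so the exchanges are the counterterms `X
P₀ Y` and `Y P₀ X`. The products `P X Q Y P` with `Q` inside the window are small by localization of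
`Q`. This gives `Separated.norm_clusterDefect_le`.

The truncated propagator is the identity off the window. In (1) time therefore enters only through a
unitary factor (`corr_sub_counterterm`); in (2) there are further terms with `Q = P e^{±itH}`
(`window_correctedComm`), controlled by the supremum over functions in Property DL. Cutting the gap
between the supports into thirds yields exponential decay in the distance, which is stronger than
the stretched exponential claimed.

For the converse, decay without counterterms would force the counterterms themselves to decay. If
`X` creates a particle at `k` and `Y` annihilates one at `k'`, a matrix element of the counterterm
is the product of the diagonal entries of `P` at the two one-particle states. In a random chain, two
stretches of fixed length with little disorder occur with a probability bounded below independently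
of their distance, and a variational argument gives each a total weight of at least `1 / 2`
(`half_le_sum_specProj`). In the commutator the two pairs of counterterms cancel at time zero, so a
time is chosen at which the phases keep them apart (`weight_mul_weight_le_comm`). -/

/-! ### Complex functions of a Hermitian matrix -/

namespace Matrix.IsHermitian

variable {n : Type*} [Fintype n] [DecidableEq n] {A : Matrix n n ℂ}

/-- The matrix `f(A)` for a Hermitian matrix `A` and a complex function `f`. -/
noncomputable def specFun (hA : A.IsHermitian) (f : ℝ → ℂ) : Matrix n n ℂ :=
  Unitary.conjStarAlgAut ℂ _ hA.eigenvectorUnitary (diagonal (f ∘ hA.eigenvalues))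

theorem specFun_mul (hA : A.IsHermitian) (f g : ℝ → ℂ) :
    hA.specFun f * hA.specFun g = hA.specFun (fun x => f x * g x) := by
  rw [specFun, specFun, ← map_mul, diagonal_mul_diagonal]
  rfl

theorem specFun_add (hA : A.IsHermitian) (f g : ℝ → ℂ) :
    hA.specFun f + hA.specFun g = hA.specFun (fun x => f x + g x) := by
  rw [specFun, specFun, ← map_add, diagonal_add]
  rfl

theorem specFun_smul (hA : A.IsHermitian) (c : ℂ) (f : ℝ → ℂ) :
    c • hA.specFun f = hA.specFun (fun x => c * f x) := by
  rw [specFun, ← map_smul, ← diagonal_smul]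
  rfl

theorem specFun_one (hA : A.IsHermitian) : hA.specFun (fun _ => 1) = 1 := by
  rw [specFun, show (fun _ : ℝ => (1 : ℂ)) ∘ hA.eigenvalues = fun _ => 1 from rfl, diagonal_one,
    map_one]

theorem specFun_ofReal (hA : A.IsHermitian) : hA.specFun (fun x => (x : ℂ)) = A :=
  hA.spectral_theorem.symm

theorem specFun_conjTranspose (hA : A.IsHermitian) (f : ℝ → ℂ) :
    (hA.specFun f)ᴴ = hA.specFun (fun x => star (f x)) := by
  rw [← star_eq_conjTranspose, specFun, ← map_star, star_eq_conjTranspose,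
    diagonal_conjTranspose]
  rfl

theorem cfc_eq_specFun (hA : A.IsHermitian) (f : ℝ → ℝ) :
    _root_.cfc f A = hA.specFun (fun x => (f x : ℂ)) :=
  hA.cfc_eq f

theorem norm_specFun (hA : A.IsHermitian) (f : ℝ → ℂ) :
    ‖hA.specFun f‖ = ‖f ∘ hA.eigenvalues‖ := by
  rw [specFun, Unitary.conjStarAlgAut_apply, ← Unitary.coe_star, CStarRing.norm_mul_coe_unitary,
    CStarRing.norm_coe_unitary_mul, l2_opNorm_diagonal]

theorem norm_specFun_le (hA : A.IsHermitian) {f : ℝ → ℂ} {c : ℝ} (hc : 0 ≤ c)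
    (hf : ∀ x, ‖f x‖ ≤ c) : ‖hA.specFun f‖ ≤ c := by
  rw [norm_specFun]
  exact (pi_norm_le_iff_of_nonneg hc).2 fun i => hf _

/-- The exponential commutes with unitary conjugation. Propagators thereby become functions of `A`,
and identities between them and spectral projections reduce to scalar identities. -/
theorem exp_specFun (hA : A.IsHermitian) (f : ℝ → ℂ) :
    NormedSpace.exp (hA.specFun f) = hA.specFun (fun x => Complex.exp (f x)) := by
  have hU : (hA.eigenvectorUnitary : Matrix n n ℂ)⁻¹ = star (hA.eigenvectorUnitary : Matrix n n ℂ) :=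
    Matrix.inv_eq_right_inv (Unitary.mul_star_self_of_mem hA.eigenvectorUnitary.2)
  have hu : IsUnit (hA.eigenvectorUnitary : Matrix n n ℂ) :=
    ⟨Unitary.toUnits hA.eigenvectorUnitary, rfl⟩
  simp only [specFun, Unitary.conjStarAlgAut_apply]
  rw [← hU, exp_conj _ _ hu, exp_diagonal]
  congr 3
  ext i
  simp [Pi.coe_exp, Complex.exp_eq_exp_ℂ]

/-- The quadratic form of `f(A)` is a weighted sum of the values of `f` at the eigenvalues. -/
theorem exists_weights (hA : A.IsHermitian) (v : n → ℂ) :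
    ∃ w : n → ℝ, (∀ k, 0 ≤ w k) ∧
      ∀ f : ℝ → ℂ, star v ⬝ᵥ hA.specFun f *ᵥ v = ∑ k, f (hA.eigenvalues k) * w k := by
  set U : Matrix n n ℂ := ↑hA.eigenvectorUnitary with hU
  -- The weights are the squared moduli of the coordinates of `v` in the eigenbasis.
  refine ⟨fun k => Complex.normSq ((star U *ᵥ v) k), fun k => Complex.normSq_nonneg _, fun f => ?_⟩
  have h : hA.specFun f = U * diagonal (f ∘ hA.eigenvalues) * star U := by
    rw [specFun, Unitary.conjStarAlgAut_apply]
  rw [h, ← mulVec_mulVec, ← mulVec_mulVec, dotProduct_mulVec, dotProduct]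
  refine Finset.sum_congr rfl fun k _ => ?_
  have h2 : (star v ᵥ* U) k = star ((star U *ᵥ v) k) := by
    rw [← Pi.star_apply, star_mulVec, star_eq_conjTranspose, conjTranspose_conjTranspose]
  rw [h2, mulVec_diagonal, Complex.normSq_eq_conj_mul_self]
  simp only [Function.comp_apply, Complex.star_def]
  ring

end Matrix.IsHermitian

namespace Matrix

variable {n : Type*} [Fintype n] [DecidableEq n]

theorem norm_apply_le_l2_opNorm (A : Matrix n n ℂ) (i j : n) : ‖A i j‖ ≤ ‖A‖ := by
  have h := A.l2_opNorm_mulVec (EuclideanSpace.single j 1)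
  rw [PiLp.norm_single, norm_one, mul_one] at h
  refine le_trans ?_ h
  have h2 := PiLp.norm_apply_le ((EuclideanSpace.equiv n ℂ).symm <|
    A *ᵥ (EuclideanSpace.single j (1 : ℂ)).ofLp) i
  simpa using h2

end Matrix

/-! ### Clustering for projections in a normed ring -/

namespace XXZ

/-- The algebraic relations between an energy projection `P`, the ground state projection `P₀`, two
observables `X`, `Y`, and number-type projections: `a`, `b` detect particles near the supports of
`X`, `Y`; `c`, `e` detect particles away from the supports of `X`, `Y`; and `c'`, `e'` detect
particles in the complementary regions. -/
structure Separated {R : Type*} [NormedRing R] (P P₀ X Y a b c c' e e' : R) : Prop where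
  P_mul_P : P * P = P
  P₀_mul_P : P₀ * P = 0
  P_mul_P₀ : P * P₀ = 0
  norm_P : ‖P‖ ≤ 1
  norm_a : ‖a‖ ≤ 1
  norm_b : ‖b‖ ≤ 1
  norm_c' : ‖c'‖ ≤ 1
  norm_e' : ‖e'‖ ≤ 1
  norm_one_sub_a : ‖1 - a‖ ≤ 1
  norm_one_sub_b : ‖1 - b‖ ≤ 1
  norm_one_sub_c : ‖1 - c‖ ≤ 1
  norm_one_sub_c' : ‖1 - c'‖ ≤ 1
  norm_one_sub_e : ‖1 - e‖ ≤ 1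
  norm_one_sub_e' : ‖1 - e'‖ ≤ 1
  commute_XY : Commute X Y
  commute_Xb : Commute X b
  commute_Xc : Commute X c
  commute_Ya : Commute Y a
  commute_Ye : Commute Y e
  commute_ab : Commute a b
  commute_ac : Commute a c
  commute_ae : Commute a e
  commute_bc : Commute b c
  commute_be : Commute b e
  commute_ce : Commute c e
  vac_X : (1 - a) * X * (1 - a) = 0
  vac_Y : (1 - b) * Y * (1 - b) = 0
  vac_ce : (1 - c) * (1 - e) = P₀
  vac_c : (1 - c) * (1 - c') = P₀
  vac_e : (1 - e') * (1 - e) = P₀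
  le_a : (1 - a) * (1 - c') = 1 - c'
  le_b : (1 - e') * (1 - b) = 1 - e'
  a_mul_P₀ : a * P₀ = 0
  P₀_mul_a : P₀ * a = 0
  b_mul_P₀ : b * P₀ = 0
  P₀_mul_b : P₀ * b = 0

/-- The time-independent part `P X (1 - P) Y P - P X P₀ Y P - P Y P₀ X P` of the corrected
correlator. -/
def clusterDefect {R : Type*} [Ring R] (P P₀ X Y : R) : R :=
  P * X * (1 - P) * Y * P - P * X * P₀ * Y * P - P * Y * P₀ * X * P

namespace Separated

variable {R : Type*} [NormedRing R] {P P₀ X Y a b c c' e e' : R}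

/-- On the range of `1 - c'` the surroundings of `X` are empty, so `X` must create a particle there,
which gives the factor `a`. As `P` excludes the vacuum, there is also a particle in the
complementary region; its projection `c` commutes past `X`. Together they put `a * c` next to `P`.
-/
theorem norm_window_left_le (h : Separated P P₀ X Y a b c c' e e') :
    ‖P * X * (1 - c') * P‖ ≤ ‖P * (a * c)‖ * ‖X‖ := by
  have h1 : X * (1 - c') = a * X * (1 - c') := by
    have := h.vac_X
    rw [← h.le_a]
    calc X * ((1 - a) * (1 - c')) = (1 - a) * X * (1 - a) * (1 - c')
          + a * X * ((1 - a) * (1 - c')) := by noncomm_ring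
      _ = _ := by rw [this, zero_mul, zero_add]
  have h2 : (1 - c') * P = c * (1 - c') * P := by
    have : (1 - c) * (1 - c') * P = 0 := by rw [h.vac_c, h.P₀_mul_P]
    calc (1 - c') * P = (1 - c) * (1 - c') * P + c * (1 - c') * P := by noncomm_ring
      _ = _ := by rw [this, zero_add]
  have h3 : P * X * (1 - c') * P = P * (a * c) * X * ((1 - c') * P) := by
    calc P * X * (1 - c') * P = P * (X * (1 - c')) * P := by noncomm_ring
      _ = P * a * X * ((1 - c') * P) := by rw [h1]; noncomm_ring
      _ = P * a * X * (c * (1 - c') * P) := by rw [← h2]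
      _ = P * a * (X * c) * ((1 - c') * P) := by noncomm_ring
      _ = _ := by rw [h.commute_Xc.eq]; noncomm_ring
  rw [h3]
  have h4 : ‖(1 - c') * P‖ ≤ 1 * 1 := norm_mul_le_of_le h.norm_one_sub_c' h.norm_P
  have h5 := norm_mul_le_of_le (norm_mul_le (P * (a * c)) X) h4
  simpa using h5

/-- The mirror image: `Y` must annihilate a particle, which gives `b`, and the particle demanded by
`P` on the left gives `e`, which commutes past `Y`. -/
theorem norm_window_right_le (h : Separated P P₀ X Y a b c c' e e') :
    ‖P * (1 - e') * Y * P‖ ≤ ‖Y‖ * ‖e * b * P‖ := by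
  have h1 : (1 - e') * Y = (1 - e') * Y * b := by
    have := h.vac_Y
    rw [← h.le_b]
    calc (1 - e') * (1 - b) * Y = (1 - e') * ((1 - b) * Y * (1 - b))
          + (1 - e') * (1 - b) * Y * b := by noncomm_ring
      _ = _ := by rw [this, mul_zero, zero_add]
  have h2 : P * (1 - e') = P * (1 - e') * e := by
    have : P * ((1 - e') * (1 - e)) = 0 := by rw [h.vac_e, h.P_mul_P₀]
    calc P * (1 - e') = P * ((1 - e') * (1 - e)) + P * (1 - e') * e := by noncomm_ring
      _ = _ := by rw [this, zero_add]
  have h3 : P * (1 - e') * Y * P = P * (1 - e') * (Y * (e * b * P)) := by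
    calc P * (1 - e') * Y * P = P * ((1 - e') * Y) * P := by noncomm_ring
      _ = (P * (1 - e')) * Y * b * P := by rw [h1]; noncomm_ring
      _ = (P * (1 - e') * e) * Y * b * P := by rw [← h2]
      _ = P * (1 - e') * (e * Y) * b * P := by noncomm_ring
      _ = _ := by rw [← h.commute_Ye.eq]; noncomm_ring
  rw [h3]
  have h4 : ‖P * (1 - e')‖ ≤ 1 * 1 := norm_mul_le_of_le h.norm_P h.norm_one_sub_e'
  have h5 := norm_mul_le_of_le h4 (norm_mul_le Y (e * b * P))
  simpa using h5

/-- Products of two observables restricted to the energy window are small. -/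
theorem norm_window_mul_window_le (h : Separated P P₀ X Y a b c c' e e') {Q : R} (hPQ : P * Q = Q)
    (hQP : Q * P = Q) (hQ : ‖Q‖ ≤ 1) :
    ‖P * X * Q * Y * P‖ ≤ ‖X‖ * ‖Y‖ * (‖P * (a * c)‖ + ‖e * b * P‖ + ‖c' * Q * e'‖) := by
  -- Insert `1 = (1 - c') + c'` to the left of `Q` and `1 = (1 - e') + e'` to its right. What
  -- survives is the kernel of `Q` between two half-lines.
  have h1 : P * X * Q * Y * P = (P * X * (1 - c') * P) * (Q * Y * P)
      + (P * X) * c' * Q * (P * (1 - e') * Y * P) + (P * X) * (c' * Q * e') * (Y * P) := by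
    have e1 : P * X * (1 - c') * P * (Q * Y * P) = P * X * (1 - c') * (P * Q) * Y * P := by
      noncomm_ring
    have e2 : (P * X) * c' * Q * (P * (1 - e') * Y * P) = P * X * c' * (Q * P) * (1 - e') * Y * P := by
      noncomm_ring
    rw [e1, e2, hPQ, hQP]
    noncomm_ring
  have hPX : ‖P * X‖ ≤ 1 * ‖X‖ := norm_mul_le_of_le h.norm_P le_rfl
  have hYP : ‖Y * P‖ ≤ ‖Y‖ * 1 := norm_mul_le_of_le le_rfl h.norm_P
  have hQYP : ‖Q * Y * P‖ ≤ 1 * ‖Y‖ * 1 :=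
    norm_mul_le_of_le (norm_mul_le_of_le hQ le_rfl) h.norm_P
  have t1 := norm_mul_le_of_le h.norm_window_left_le hQYP
  have t2 := norm_mul_le_of_le (norm_mul_le_of_le (norm_mul_le_of_le hPX h.norm_c') hQ)
    h.norm_window_right_le
  have t3 := norm_mul_le_of_le (norm_mul_le_of_le hPX (le_refl ‖c' * Q * e'‖)) hYP
  rw [h1]
  refine (norm_add₃_le).trans ?_
  linarith

/-- Block decomposition of `X Y` with respect to `a` and `b`. Since `X` has no `(1 - a, 1 - a)`
block and `Y` no `(1 - b, 1 - b)` block, the only blocks without `a * b` on either side go from `(1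
- a) b` to `a (1 - b)` or back. These are the first two terms, the exchanges. -/
theorem mul_eq (h : Separated P P₀ X Y a b c c' e e') :
    X * Y = a * X * ((1 - a) * (1 - b)) * Y * b + b * Y * ((1 - b) * (1 - a)) * X * a
      + a * b * (X * Y) + ((1 - a) * (1 - b) + a * (1 - b)) * (X * Y) * (a * b)
      + b * (1 - a) * (Y * X) * (a * b) := by
  have hx : a * (X * a) = a * X + X * a - X := by
    have := h.vac_X
    have e : (1 - a) * X * (1 - a) = X - X * a - a * X + a * (X * a) := by noncomm_ring
    rw [e] at this
    rw [← sub_eq_zero, ← this]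
    abel
  have hy : b * (Y * b) = b * Y + Y * b - Y := by
    have := h.vac_Y
    have e : (1 - b) * Y * (1 - b) = Y - Y * b - b * Y + b * (Y * b) := by noncomm_ring
    rw [e] at this
    rw [← sub_eq_zero, ← this]
    abel
  have hx' : ∀ z, a * (X * (a * z)) = a * (X * z) + X * (a * z) - X * z := fun z => by
    have := congrArg (· * z) hx
    simpa [add_mul, sub_mul, mul_assoc] using this
  -- These rules move the letters `a`, `X` to the left of `b`, `Y`; after that `hx`, `hy` and `hx'`
  -- eliminate the words `a X a` and `b Y b`.
  have ba := h.commute_ab.symm.eq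
  have bX := h.commute_Xb.symm.eq
  have Ya := h.commute_Ya.eq
  have YX := h.commute_XY.symm.eq
  have ba' : ∀ z, b * (a * z) = a * (b * z) := h.commute_ab.symm.left_comm
  have bX' : ∀ z, b * (X * z) = X * (b * z) := h.commute_Xb.symm.left_comm
  have Ya' : ∀ z, Y * (a * z) = a * (Y * z) := h.commute_Ya.left_comm
  have YX' : ∀ z, Y * (X * z) = X * (Y * z) := h.commute_XY.symm.left_comm
  simp only [mul_sub, sub_mul, mul_add, add_mul, mul_one, one_mul, mul_assoc, ba, bX, Ya, YX, ba',
    bX', Ya', YX', hx, hy, hx']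
  abel

/-- An exchange passes through a state empty near both supports. Replacing that state by the vacuum
is the counterterm, and the two terms on the right are the error: an extra particle in the
intermediate state commutes past `Y` or past `X` and forms a separated pair next to `P`. -/
theorem hop_sub (h : Separated P P₀ X Y a b c c' e e') :
    P * (a * X * ((1 - a) * (1 - b)) * Y * b) * P - P * X * P₀ * Y * P =
      P * a * X * ((1 - a) * (1 - b)) * Y * (e * b * P)
        + P * (a * c) * X * ((1 - a) * (1 - b) * (1 - e)) * (Y * b * P) := by
  have h1 : X * P₀ = a * X * P₀ := by
    have e1 : (1 - a) * X * P₀ = 0 := by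
      calc (1 - a) * X * P₀ = (1 - a) * X * (1 - a) * P₀ + (1 - a) * X * (a * P₀) := by noncomm_ring
        _ = 0 := by rw [h.vac_X, h.a_mul_P₀]; simp
    rw [← sub_eq_zero, ← e1]
    noncomm_ring
  have h2 : P₀ * Y = P₀ * Y * b := by
    have e1 : P₀ * Y * (1 - b) = 0 := by
      calc P₀ * Y * (1 - b) = P₀ * ((1 - b) * Y * (1 - b)) + (P₀ * b) * Y * (1 - b) := by
            noncomm_ring
        _ = 0 := by rw [h.vac_Y, h.P₀_mul_b]; simp
    rw [← sub_eq_zero, ← e1]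
    noncomm_ring
  have h3 : P * X * P₀ * Y * P = P * (a * X * P₀ * Y * b) * P := by
    calc P * X * P₀ * Y * P = P * (X * P₀) * Y * P := by noncomm_ring
      _ = P * a * X * (P₀ * Y) * P := by rw [h1]; noncomm_ring
      _ = _ := by rw [h2]; noncomm_ring
  have h4 : P₀ = (1 - a) * (1 - b) * P₀ := by
    have : (1 - a) * (1 - b) * P₀ = P₀ - a * P₀ - (b * P₀) + a * (b * P₀) := by noncomm_ring
    rw [this, h.a_mul_P₀, h.b_mul_P₀]
    simp
  -- A non-vacuum state either is detected by `e`, or is missed by `e` and then detected by `c`.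
  have h5 : (1 - a) * (1 - b) - P₀ =
      (1 - a) * (1 - b) * e + (1 - a) * (1 - b) * (1 - e) * c := by
    conv_lhs => rw [h4, ← h.vac_ce, (((Commute.one_left _).sub_left
      ((Commute.one_right _).sub_right h.commute_ce)).eq : (1 - c) * (1 - e) = (1 - e) * (1 - c))]
    noncomm_ring
  have h6 : (1 - a) * (1 - b) * (1 - e) * c = c * ((1 - a) * (1 - b) * (1 - e)) := by
    have ha : Commute (1 - a) c := (Commute.one_left _).sub_left h.commute_ac
    have hb : Commute (1 - b) c := (Commute.one_left _).sub_left h.commute_bc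
    have he : Commute (1 - e) c := (Commute.one_left _).sub_left h.commute_ce.symm
    exact ((ha.mul_left hb).mul_left he).eq
  have h7 : P * (a * X * ((1 - a) * (1 - b)) * Y * b) * P - P * X * P₀ * Y * P =
      P * a * X * ((1 - a) * (1 - b) - P₀) * (Y * b * P) := by
    rw [h3]
    noncomm_ring
  rw [h7, h5, h6]
  have h8 : P * a * X * ((1 - a) * (1 - b) * e + c * ((1 - a) * (1 - b) * (1 - e))) * (Y * b * P) =
      P * a * X * ((1 - a) * (1 - b)) * (e * Y) * b * P
        + P * a * (X * c) * ((1 - a) * (1 - b) * (1 - e)) * (Y * b * P) := by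
    noncomm_ring
  rw [h8, ← h.commute_Ye.eq, h.commute_Xc.eq]
  noncomm_ring

theorem norm_hop_sub_le (h : Separated P P₀ X Y a b c c' e e') :
    ‖P * (a * X * ((1 - a) * (1 - b)) * Y * b) * P - P * X * P₀ * Y * P‖ ≤
      ‖X‖ * ‖Y‖ * (‖P * (a * c)‖ + ‖e * b * P‖) := by
  rw [h.hop_sub]
  have hv := norm_mul_le_of_le h.norm_one_sub_a h.norm_one_sub_b
  have t1 := norm_mul_le_of_le (norm_mul_le_of_le (norm_mul_le_of_le (norm_mul_le_of_le
    (norm_mul_le_of_le h.norm_P h.norm_a) (le_refl ‖X‖)) hv) (le_refl ‖Y‖)) (le_refl ‖e * b * P‖)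
  have t2 := norm_mul_le_of_le (norm_mul_le_of_le (norm_mul_le_of_le (le_refl ‖P * (a * c)‖)
    (le_refl ‖X‖)) (norm_mul_le_of_le hv h.norm_one_sub_e))
    (norm_mul_le_of_le (norm_mul_le_of_le (le_refl ‖Y‖) h.norm_b) h.norm_P)
  refine (norm_add_le _ _).trans ?_
  linarith

/-- Reflection of the chain. The additional commutations are needed because `vac_c`, `vac_e`, `le_a`
and `le_b` fix an order of their factors. -/
theorem swap (h : Separated P P₀ X Y a b c c' e e') (hc : Commute c c') (he : Commute e e')
    (ha : Commute a c') (hb : Commute b e') : Separated P P₀ Y X b a e e' c c' where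
  P_mul_P := h.P_mul_P
  P₀_mul_P := h.P₀_mul_P
  P_mul_P₀ := h.P_mul_P₀
  norm_P := h.norm_P
  norm_a := h.norm_b
  norm_b := h.norm_a
  norm_c' := h.norm_e'
  norm_e' := h.norm_c'
  norm_one_sub_a := h.norm_one_sub_b
  norm_one_sub_b := h.norm_one_sub_a
  norm_one_sub_c := h.norm_one_sub_e
  norm_one_sub_c' := h.norm_one_sub_e'
  norm_one_sub_e := h.norm_one_sub_c
  norm_one_sub_e' := h.norm_one_sub_c'
  commute_XY := h.commute_XY.symm
  commute_Xb := h.commute_Ya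
  commute_Xc := h.commute_Ye
  commute_Ya := h.commute_Xb
  commute_Ye := h.commute_Xc
  commute_ab := h.commute_ab.symm
  commute_ac := h.commute_be
  commute_ae := h.commute_bc
  commute_bc := h.commute_ae
  commute_be := h.commute_ac
  commute_ce := h.commute_ce.symm
  vac_X := h.vac_Y
  vac_Y := h.vac_X
  vac_ce := by
    rw [← h.vac_ce]
    exact ((Commute.one_left _).sub_left ((Commute.one_right _).sub_right h.commute_ce.symm)).eq
  vac_c := by
    rw [← h.vac_e]
    exact ((Commute.one_left _).sub_left ((Commute.one_right _).sub_right he)).eq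
  vac_e := by
    rw [← h.vac_c]
    exact ((Commute.one_left _).sub_left ((Commute.one_right _).sub_right hc.symm)).eq
  le_a := by
    conv_rhs => rw [← h.le_b]
    exact ((Commute.one_left _).sub_left ((Commute.one_right _).sub_right hb)).eq
  le_b := by
    conv_rhs => rw [← h.le_a]
    exact ((Commute.one_left _).sub_left ((Commute.one_right _).sub_right ha.symm)).eq
  a_mul_P₀ := h.b_mul_P₀
  P₀_mul_a := h.P₀_mul_b
  b_mul_P₀ := h.a_mul_P₀
  P₀_mul_b := h.P₀_mul_a

/-- Write `P X (1 - P) Y P` as `P X Y P - P X P Y P`. In the first product the exchanges cancel the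
counterterms up to errors and the other blocks contain `a * b`; the second is a product within the
window, taken with `Q = P`. -/
theorem norm_clusterDefect_le (h : Separated P P₀ X Y a b c c' e e')
    (h' : Separated P P₀ Y X b a e e' c c') :
    ‖clusterDefect P P₀ X Y‖ ≤ ‖X‖ * ‖Y‖ * (‖P * (a * b)‖ + 3 * ‖a * b * P‖
      + 2 * ‖P * (a * c)‖ + 2 * ‖e * b * P‖ + ‖P * (b * e)‖ + ‖c * a * P‖ + ‖c' * P * e'‖) := by
  have h1 : clusterDefect P P₀ X Y = P * (X * Y) * P - P * X * P₀ * Y * P - P * Y * P₀ * X * P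
      - P * X * P * Y * P := by
    rw [clusterDefect]
    noncomm_ring
  have h2 : clusterDefect P P₀ X Y =
      (P * (a * X * ((1 - a) * (1 - b)) * Y * b) * P - P * X * P₀ * Y * P)
      + (P * (b * Y * ((1 - b) * (1 - a)) * X * a) * P - P * Y * P₀ * X * P)
      + P * (a * b) * X * Y * P + P * (1 - a) * (1 - b) * X * Y * (a * b * P)
      + P * a * (1 - b) * X * Y * (a * b * P)
      + P * b * (1 - a) * Y * X * (a * b * P) + -(P * X * P * Y * P) := by
    rw [h1, h.mul_eq]
    noncomm_ring
  have t1 := h.norm_hop_sub_le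
  have t2 := h'.norm_hop_sub_le
  have t3 := norm_mul_le_of_le (norm_mul_le_of_le (norm_mul_le_of_le (le_refl ‖P * (a * b)‖)
    (le_refl ‖X‖)) (le_refl ‖Y‖)) h.norm_P
  have t4 := norm_mul_le_of_le (norm_mul_le_of_le (norm_mul_le_of_le (norm_mul_le_of_le
    (norm_mul_le_of_le h.norm_P h.norm_one_sub_a) h.norm_one_sub_b) (le_refl ‖X‖)) (le_refl ‖Y‖))
    (le_refl ‖a * b * P‖)
  have t5 := norm_mul_le_of_le (norm_mul_le_of_le (norm_mul_le_of_le (norm_mul_le_of_le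
    (norm_mul_le_of_le h.norm_P h.norm_a) h.norm_one_sub_b) (le_refl ‖X‖)) (le_refl ‖Y‖))
    (le_refl ‖a * b * P‖)
  have t6 := norm_mul_le_of_le (norm_mul_le_of_le (norm_mul_le_of_le (norm_mul_le_of_le
    (norm_mul_le_of_le h.norm_P h.norm_b) h.norm_one_sub_a) (le_refl ‖Y‖)) (le_refl ‖X‖))
    (le_refl ‖a * b * P‖)
  have t7 := h.norm_window_mul_window_le h.P_mul_P h.P_mul_P h.norm_P
  rw [← norm_neg] at t7
  rw [h2]
  refine (norm_add_le_of_le (norm_add_le_of_le (norm_add_le_of_le (norm_add_le_of_le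
    (norm_add_le_of_le (norm_add_le_of_le t1 t2) t3) t4) t5) t6) t7).trans ?_
  linarith

end Separated

end XXZ

/-! ### Diagonal projections and local observables -/

namespace XXZ

variable {L : ℕ}

open Classical in
/-- The projection onto the span of the configurations with a given property. -/
noncomputable def diagProj (p : Config L → Prop) : Op L :=
  Matrix.diagonal fun σ => if p σ then 1 else 0

theorem diagProj_mul (p q : Config L → Prop) :
    diagProj p * diagProj q = diagProj fun σ => p σ ∧ q σ := by
  classical
  rw [diagProj, diagProj, diagProj, Matrix.diagonal_mul_diagonal]
  congr 1
  ext σ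
  by_cases hp : p σ <;> by_cases hq : q σ <;> simp [hp, hq]

theorem one_sub_diagProj (p : Config L → Prop) : 1 - diagProj p = diagProj fun σ => ¬ p σ := by
  classical
  rw [diagProj, diagProj, ← Matrix.diagonal_one, Matrix.diagonal_sub]
  congr 1
  ext σ
  by_cases hp : p σ <;> simp [hp]

theorem diagProj_congr {p q : Config L → Prop} (h : ∀ σ, p σ ↔ q σ) : diagProj p = diagProj q := by
  rw [show p = q from funext fun σ => propext (h σ)]

theorem commute_diagProj (p q : Config L → Prop) : Commute (diagProj p) (diagProj q) := by
  rw [Commute, SemiconjBy, diagProj_mul, diagProj_mul]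
  exact diagProj_congr fun σ => and_comm

theorem norm_diagProj_le (p : Config L → Prop) : ‖diagProj p‖ ≤ 1 := by
  classical
  rw [diagProj, Matrix.l2_opNorm_diagonal, pi_norm_le_iff_of_nonneg zero_le_one]
  intro σ
  split_ifs <;> simp

theorem diagProj_conjTranspose (p : Config L → Prop) : (diagProj p)ᴴ = diagProj p := by
  classical
  rw [diagProj, Matrix.diagonal_conjTranspose]
  congr 1
  ext σ
  by_cases hp : p σ <;> simp [hp]

theorem diagProj_false {p : Config L → Prop} (h : ∀ σ, ¬ p σ) : diagProj p = 0 := by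
  simp [diagProj, h]

/-- The number projection of a set `A` of sites: some spin in `A` is down. -/
noncomputable def occ (L : ℕ) (A : Set ℤ) : Op L := diagProj fun σ => ∃ k : Site L, (k : ℤ) ∈ A ∧ σ k = 1

/-- The projection onto the all spins up configuration. -/
noncomputable def vac (L : ℕ) : Op L := diagProj fun σ => σ = 0

theorem one_sub_occ (A : Set ℤ) :
    1 - occ L A = diagProj fun σ => ∀ k : Site L, (k : ℤ) ∈ A → σ k = 0 := by
  rw [occ, one_sub_diagProj]
  refine diagProj_congr fun σ => ?_
  push Not
  refine forall₂_congr fun k _ => ?_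
  generalize σ k = x
  fin_cases x <;> simp

theorem norm_occ_le (A : Set ℤ) : ‖occ L A‖ ≤ 1 := norm_diagProj_le _

theorem norm_one_sub_occ_le (A : Set ℤ) : ‖1 - occ L A‖ ≤ 1 := by
  rw [one_sub_occ]
  exact norm_diagProj_le _

theorem commute_occ (A B : Set ℤ) : Commute (occ L A) (occ L B) := commute_diagProj _ _

theorem occ_conjTranspose (A : Set ℤ) : (occ L A)ᴴ = occ L A := diagProj_conjTranspose _

theorem one_sub_occ_mul_one_sub_occ {A B : Set ℤ} (h : A ∪ B = Set.univ) :
    (1 - occ L A) * (1 - occ L B) = vac L := by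
  rw [one_sub_occ, one_sub_occ, diagProj_mul, vac]
  refine diagProj_congr fun σ => ⟨fun hσ => funext fun k => ?_, fun hσ => by simp [hσ]⟩
  rcases (h ▸ Set.mem_univ (k : ℤ) : (k : ℤ) ∈ A ∪ B) with hk | hk
  exacts [hσ.1 k hk, hσ.2 k hk]

theorem one_sub_occ_mul_of_subset {A B : Set ℤ} (h : A ⊆ B) :
    (1 - occ L A) * (1 - occ L B) = 1 - occ L B := by
  rw [one_sub_occ, one_sub_occ, diagProj_mul]
  exact diagProj_congr fun σ => ⟨fun hσ => hσ.2, fun hσ => ⟨fun k hk => hσ k (h hk), hσ⟩⟩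

theorem occ_mul_vac (A : Set ℤ) : occ L A * vac L = 0 := by
  rw [occ, vac, diagProj_mul]
  refine diagProj_false ?_
  rintro σ ⟨⟨k, -, hk⟩, rfl⟩
  simp at hk

theorem vac_mul_occ (A : Set ℤ) : vac L * occ L A = 0 := by
  rw [occ, vac, (commute_diagProj _ _).eq]
  exact occ_mul_vac A

theorem numOp_eq_diagProj (i : Site L) : numOp i = diagProj fun σ => σ i = 1 := by
  ext σ τ
  have hz : siteOp i pauliZ σ τ = if σ = τ then (if σ i = 1 then -1 else 1) else 0 := by
    by_cases h : σ = τ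
    · subst h
      simp only [siteOp, Matrix.of_apply, pauliZ]
      generalize σ i = x
      fin_cases x <;> simp
    · simp only [siteOp, Matrix.of_apply, h, if_false]
      split_ifs with h1
      · have hi : σ i ≠ τ i := fun hi => h (funext fun k => by
          by_cases hk : k = i
          · rw [hk, hi]
          · exact h1 k hk)
        revert hi
        generalize σ i = x
        generalize τ i = y
        fin_cases x <;> fin_cases y <;> simp [pauliZ]
      · rfl
  simp only [numOp, Matrix.smul_apply, Matrix.sub_apply, hz, diagProj, Matrix.one_apply,
    Matrix.diagonal_apply, smul_eq_mul]
  by_cases h : σ = τ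
  · subst h
    by_cases h1 : σ i = 1
    · simp [h1]; norm_num
    · simp [h1]
  · simp [h]

theorem mul_diagProj_apply (A : Op L) (p : Config L → Prop) [DecidablePred p] (σ τ : Config L) :
    (A * diagProj p) σ τ = if p τ then A σ τ else 0 := by
  rw [diagProj, Matrix.mul_diagonal]
  by_cases h : p τ <;> simp [h]

theorem diagProj_mul_apply (A : Op L) (p : Config L → Prop) [DecidablePred p] (σ τ : Config L) :
    (diagProj p * A) σ τ = if p σ then A σ τ else 0 := by
  rw [diagProj, Matrix.diagonal_mul]
  by_cases h : p σ <;> simp [h]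

namespace LocalObservable

theorem op_apply (X : LocalObservable L) (σ τ : Config L) : X.op σ τ =
    if ∀ k : Site L, (k : ℤ) ∉ X.supp → σ k = τ k then
      X.core (X.restrict σ) (X.restrict τ) else 0 := rfl

theorem op_commute_occ (X : LocalObservable L) {A : Set ℤ} (hA : ∀ k ∈ A, k ∉ X.supp) :
    Commute X.op (occ L A) := by
  classical
  ext σ τ
  rw [occ, mul_diagProj_apply, diagProj_mul_apply, op_apply]
  by_cases h : ∀ k : Site L, (k : ℤ) ∉ X.supp → σ k = τ k
  · have : (∃ k : Site L, (k : ℤ) ∈ A ∧ τ k = 1) ↔ ∃ k : Site L, (k : ℤ) ∈ A ∧ σ k = 1 :=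
      exists_congr fun k => and_congr_right fun hk => by rw [h k (hA k hk)]
    simp only [this]
  · rw [if_neg h, ite_self, ite_self]

theorem op_mul_op_apply (X Y : LocalObservable L) (hXY : Disjoint X.supp Y.supp) (σ τ : Config L) :
    (X.op * Y.op) σ τ = if ∀ k : Site L, (k : ℤ) ∉ X.supp → (k : ℤ) ∉ Y.supp → σ k = τ k then
      X.core (X.restrict σ) (X.restrict τ) * Y.core (Y.restrict σ) (Y.restrict τ) else 0 := by
  -- The only intermediate configuration that contributes: `X` has already changed its own support
  -- and nothing else.
  set ρ : Config L := fun k => if (k : ℤ) ∈ X.supp then τ k else σ k with hρ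
  have hin : ∀ k : Site L, (k : ℤ) ∈ X.supp → ρ k = τ k := fun k hk => by simp [hρ, hk]
  have hout : ∀ k : Site L, (k : ℤ) ∉ X.supp → ρ k = σ k := fun k hk => by simp [hρ, hk]
  rw [Matrix.mul_apply, Finset.sum_eq_single ρ]
  · have h1 : ∀ k : Site L, (k : ℤ) ∉ X.supp → σ k = ρ k := fun k hk => (hout k hk).symm
    have h2 : (∀ k : Site L, (k : ℤ) ∉ Y.supp → ρ k = τ k) ↔
        ∀ k : Site L, (k : ℤ) ∉ X.supp → (k : ℤ) ∉ Y.supp → σ k = τ k := by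
      refine ⟨fun h k hX hY => (h1 k hX).trans (h k hY), fun h k hY => ?_⟩
      by_cases hX : (k : ℤ) ∈ X.supp
      · exact hin k hX
      · rw [hout k hX, h k hX hY]
    have h3 : X.restrict ρ = X.restrict τ := funext fun j => hin _ j.2
    have h4 : Y.restrict ρ = Y.restrict σ :=
      funext fun j => hout _ fun hj => Finset.disjoint_left.1 hXY hj j.2
    rw [op_apply, op_apply, if_pos h1, h3, h4]
    simp only [h2, mul_ite, mul_zero]
  · intro ρ' _ hne
    rw [op_apply, op_apply]
    by_cases h1 : ∀ k : Site L, (k : ℤ) ∉ X.supp → σ k = ρ' k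
    · by_cases h2 : ∀ k : Site L, (k : ℤ) ∉ Y.supp → ρ' k = τ k
      · refine absurd (funext fun k => ?_) hne
        by_cases hX : (k : ℤ) ∈ X.supp
        · rw [hin k hX, h2 k (Finset.disjoint_left.1 hXY hX)]
        · rw [hout k hX, h1 k hX]
      · rw [if_neg h2, mul_zero]
    · rw [if_neg h1, zero_mul]
  · exact fun h => absurd (Finset.mem_univ _) h

theorem op_commute_op (X Y : LocalObservable L) (hXY : Disjoint X.supp Y.supp) :
    Commute X.op Y.op := by
  ext σ τ
  rw [op_mul_op_apply X Y hXY, op_mul_op_apply Y X hXY.symm]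
  have : (∀ k : Site L, (k : ℤ) ∉ X.supp → (k : ℤ) ∉ Y.supp → σ k = τ k) ↔
      ∀ k : Site L, (k : ℤ) ∉ Y.supp → (k : ℤ) ∉ X.supp → σ k = τ k :=
    forall_congr' fun k => ⟨fun h a b => h b a, fun h a b => h b a⟩
  simp only [this, mul_comm]

/-- The local observable shifted by a multiple of the identity so that its vacuum expectation
vanishes. -/
noncomputable def centered (X : LocalObservable L) : Op L := X.op - X.op 0 0 • (1 : Op L)

theorem norm_centered_le (X : LocalObservable L) : ‖X.centered‖ ≤ 2 * ‖X.op‖ := by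
  refine (norm_sub_le _ _).trans ?_
  have h1 : ‖X.op 0 0 • (1 : Op L)‖ ≤ ‖X.op‖ * 1 :=
    (norm_smul_le _ _).trans (mul_le_mul (Matrix.norm_apply_le_l2_opNorm _ _ _)
      norm_one.le (norm_nonneg _) (norm_nonneg _))
  linarith

/-- Between configurations that are up on `A`, the observable acts as the scalar `X.op 0 0`, which
the centring subtracts. -/
theorem one_sub_occ_mul_centered_mul (X : LocalObservable L) {A : Set ℤ}
    (hA : ∀ k ∈ X.supp, k ∈ A) : (1 - occ L A) * X.centered * (1 - occ L A) = 0 := by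
  classical
  ext σ τ
  rw [one_sub_occ, mul_diagProj_apply, diagProj_mul_apply, Matrix.zero_apply]
  split_ifs with h1 h2
  · have r : ∀ ρ : Config L, (∀ k : Site L, (k : ℤ) ∈ A → ρ k = 0) → X.restrict ρ = X.restrict 0 :=
      fun ρ hρ => funext fun j => hρ _ (hA _ j.2)
    have e : (∀ k : Site L, (k : ℤ) ∉ X.supp → σ k = τ k) ↔ σ = τ := by
      refine ⟨fun h => funext fun k => ?_, fun h k _ => by rw [h]⟩
      by_cases hk : (k : ℤ) ∈ X.supp
      · rw [h1 k (hA k hk), h2 k (hA k hk)]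
      · exact h k hk
    rw [centered, Matrix.sub_apply, Matrix.smul_apply, op_apply, op_apply, r σ h2, r τ h1]
    simp only [e, Matrix.one_apply]
    by_cases hστ : σ = τ <;> simp [hστ]
  · rfl
  · rfl

theorem centered_commute_occ (X : LocalObservable L) {A : Set ℤ} (hA : ∀ k ∈ A, k ∉ X.supp) :
    Commute X.centered (occ L A) :=
  (X.op_commute_occ hA).sub_left ((Commute.one_left _).smul_left _)

theorem centered_commute_centered (X Y : LocalObservable L) (hXY : Disjoint X.supp Y.supp) :
    Commute X.centered Y.centered :=
  ((X.op_commute_op Y hXY).sub_left ((Commute.one_left _).smul_left _)).sub_right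
    ((((Commute.one_right _).smul_right _)).sub_left
      (((Commute.one_left _).smul_left _).smul_right _))

end LocalObservable

end XXZ

/-! ### Spectral projections and truncated time evolution -/

namespace XXZ

variable {L : ℕ} {H : Op L}

theorem specProj_eq (hH : H.IsHermitian) (B : Set ℝ) :
    specProj H B = hH.specFun (B.indicator fun _ => 1) := by
  rw [specProj, hH.cfc_eq_specFun]
  congr 1
  ext x
  by_cases hx : x ∈ B <;> simp [hx]

theorem funCalc_eq (hH : H.IsHermitian) (g : ℝ → ℂ) : funCalc g H = hH.specFun g := by
  rw [funCalc, hH.cfc_eq_specFun, hH.cfc_eq_specFun, hH.specFun_smul, hH.specFun_add]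
  congr 1
  ext x
  rw [mul_comm, Complex.re_add_im]

theorem specProj_mul_specProj (hH : H.IsHermitian) (A B : Set ℝ) :
    specProj H A * specProj H B = specProj H (A ∩ B) := by
  rw [specProj_eq hH, specProj_eq hH, specProj_eq hH, hH.specFun_mul]
  congr 1
  ext x
  by_cases hA : x ∈ A <;> by_cases hB : x ∈ B <;> simp [hA, hB]

theorem specProj_mul_self (hH : H.IsHermitian) (B : Set ℝ) :
    specProj H B * specProj H B = specProj H B := by
  rw [specProj_mul_specProj hH, Set.inter_self]

theorem specProj_mul_eq_zero (hH : H.IsHermitian) {A B : Set ℝ} (h : Disjoint A B) :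
    specProj H A * specProj H B = 0 := by
  rw [specProj_mul_specProj hH, h.inter_eq]
  simp [specProj]

theorem norm_specProj_le (hH : H.IsHermitian) (B : Set ℝ) : ‖specProj H B‖ ≤ 1 := by
  rw [specProj_eq hH]
  refine hH.norm_specFun_le zero_le_one fun x => ?_
  by_cases hx : x ∈ B <;> simp [hx]

theorem specProj_conjTranspose (hH : H.IsHermitian) (B : Set ℝ) :
    (specProj H B)ᴴ = specProj H B := by
  rw [specProj_eq hH, hH.specFun_conjTranspose]
  congr 1
  ext x
  by_cases hx : x ∈ B <;> simp [hx]

/-- The truncated propagator `e^{itH_B}`. -/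
noncomputable def propagator (H : Op L) (B : Set ℝ) (t : ℝ) : Op L :=
  NormedSpace.exp ((Complex.I * t) • (specProj H B * H))

theorem propagator_eq (hH : H.IsHermitian) (B : Set ℝ) (t : ℝ) : propagator H B t =
    hH.specFun fun x => Complex.exp (Complex.I * t * (B.indicator (fun _ => 1) x * x)) := by
  have h : specProj H B * H = hH.specFun fun x => B.indicator (fun _ => 1) x * x := by
    rw [← hH.specFun_mul, hH.specFun_ofReal, specProj_eq hH]
  rw [propagator, h, hH.specFun_smul, hH.exp_specFun]

theorem evol_eq (H : Op L) (B : Set ℝ) (t : ℝ) (X : Op L) :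
    evol H B t X = propagator H B t * X * propagator H B (-t) := by
  simp [evol, propagator]

theorem propagator_mul_neg (hH : H.IsHermitian) (B : Set ℝ) (t : ℝ) :
    propagator H B t * propagator H B (-t) = 1 := by
  rw [propagator_eq hH, propagator_eq hH, hH.specFun_mul, ← hH.specFun_one]
  congr 1
  ext x
  rw [← Complex.exp_add]
  push_cast
  ring_nf
  exact Complex.exp_zero

theorem norm_propagator_le (hH : H.IsHermitian) (B : Set ℝ) (t : ℝ) : ‖propagator H B t‖ ≤ 1 := by
  rw [propagator_eq hH]
  refine hH.norm_specFun_le zero_le_one fun x => le_of_eq ?_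
  by_cases hx : x ∈ B
  · rw [Set.indicator_of_mem hx, one_mul, mul_assoc, ← Complex.ofReal_mul,
      Complex.norm_exp_I_mul_ofReal]
  · simp [hx]

/-- The energy-restricted propagator `P_B e^{itH_B}`. -/
noncomputable def windowProp (H : Op L) (B : Set ℝ) (t : ℝ) : Op L := specProj H B * propagator H B t

/-- The function whose value at `H` is `P_B e^{itH_B}`. -/
noncomputable def windowPhase (B : Set ℝ) (t : ℝ) : ℝ → ℂ :=
  B.indicator fun x => Complex.exp (Complex.I * t * x)

theorem windowProp_eq (hH : H.IsHermitian) (B : Set ℝ) (t : ℝ) :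
    windowProp H B t = hH.specFun (windowPhase B t) := by
  rw [windowProp, specProj_eq hH, propagator_eq hH, hH.specFun_mul]
  congr 1
  ext x
  by_cases hx : x ∈ B <;> simp [windowPhase, hx]

theorem norm_windowPhase_le (B : Set ℝ) (t x : ℝ) :
    ‖windowPhase B t x‖ ≤ B.indicator (fun _ => 1) x := by
  by_cases hx : x ∈ B
  · rw [windowPhase, Set.indicator_of_mem hx, Set.indicator_of_mem hx, mul_assoc,
      ← Complex.ofReal_mul, Complex.norm_exp_I_mul_ofReal]
  · simp [windowPhase, hx]

theorem windowPhase_mem_G {B B' : Set ℝ} (hB : MeasurableSet B) (h : B ⊆ B') (t : ℝ) :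
    windowPhase B t ∈ G B' := by
  refine ⟨Measurable.indicator (by fun_prop) hB, fun x => (norm_windowPhase_le B t x).trans ?_⟩
  exact Set.indicator_le_indicator_of_subset h (fun _ => zero_le_one) x

theorem windowProp_zero (H : Op L) (B : Set ℝ) : windowProp H B 0 = specProj H B := by
  simp [windowProp, propagator, NormedSpace.exp_zero]

theorem windowProp_conjTranspose (hH : H.IsHermitian) (B : Set ℝ) (t : ℝ) :
    (windowProp H B t)ᴴ = windowProp H B (-t) := by
  rw [windowProp_eq hH, windowProp_eq hH, hH.specFun_conjTranspose]
  congr 1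
  ext x
  by_cases hx : x ∈ B
  · simp only [windowPhase, Set.indicator_of_mem hx, Complex.star_def, ← Complex.exp_conj]
    simp
  · simp [windowPhase, hx]

theorem commute_specProj_propagator (hH : H.IsHermitian) (B B' : Set ℝ) (t : ℝ) :
    Commute (specProj H B) (propagator H B' t) := by
  rw [Commute, SemiconjBy, specProj_eq hH, propagator_eq hH, hH.specFun_mul, hH.specFun_mul]
  simp only [mul_comm]

theorem specProj_mul_windowProp (hH : H.IsHermitian) (B : Set ℝ) (t : ℝ) :
    specProj H B * windowProp H B t = windowProp H B t := by
  rw [windowProp, ← mul_assoc, specProj_mul_self hH]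

theorem windowProp_mul_specProj (hH : H.IsHermitian) (B : Set ℝ) (t : ℝ) :
    windowProp H B t * specProj H B = windowProp H B t := by
  rw [windowProp, mul_assoc, ← (commute_specProj_propagator hH B B t).eq, ← mul_assoc,
    specProj_mul_self hH]

theorem norm_windowProp_le (hH : H.IsHermitian) (B : Set ℝ) (t : ℝ) : ‖windowProp H B t‖ ≤ 1 := by
  have := norm_mul_le_of_le (norm_specProj_le hH B) (norm_propagator_le hH B t)
  simpa [windowProp] using this

/-- The truncated Hamiltonian vanishes on spectral subspaces outside its window, so nothing evolves
there. This is what removes time from the correlators. -/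
theorem propagator_mul_specProj_of_disjoint (hH : H.IsHermitian) {B A : Set ℝ} (h : Disjoint B A)
    (t : ℝ) : propagator H B t * specProj H A = specProj H A := by
  rw [specProj_eq hH, propagator_eq hH, hH.specFun_mul]
  congr 1
  ext x
  by_cases hx : x ∈ A
  · have : x ∉ B := fun hB => h.le_bot ⟨hB, hx⟩
    simp [this]
  · simp [hx]

theorem one_sub_specProj (hH : H.IsHermitian) (B : Set ℝ) : 1 - specProj H B = specProj H Bᶜ := by
  rw [sub_eq_iff_eq_add, specProj_eq hH, specProj_eq hH, hH.specFun_add, ← hH.specFun_one]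
  congr 1
  ext x
  by_cases hx : x ∈ B <;> simp [hx]

open scoped ComplexOrder in
-- The largest singular value is at most the sum of all of them.
theorem norm_le_traceNorm (A : Op L) : ‖A‖ ≤ traceNorm A := by
  have hps : (Aᴴ * A).PosSemidef := Matrix.posSemidef_conjTranspose_mul_self A
  have hh := hps.isHermitian
  have htr : traceNorm A = ∑ i, √(hh.eigenvalues i) := by
    rw [traceNorm, hh.cfc_eq_specFun, Matrix.IsHermitian.specFun, Unitary.conjStarAlgAut_apply,
      Matrix.trace_mul_comm, ← mul_assoc, Unitary.star_mul_self_of_mem hh.eigenvectorUnitary.2,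
      one_mul, Matrix.trace_diagonal, Complex.re_sum]
    rfl
  have hnn : 0 ≤ traceNorm A := htr ▸ Finset.sum_nonneg fun i _ => Real.sqrt_nonneg _
  have hsq : ‖A‖ * ‖A‖ ≤ traceNorm A * traceNorm A := by
    have hn := hh.norm_specFun fun x => (x : ℂ)
    rw [hh.specFun_ofReal] at hn
    rw [← Matrix.l2_opNorm_conjTranspose_mul_self, hn]
    refine (pi_norm_le_iff_of_nonneg (mul_self_nonneg _)).2 fun i => ?_
    have h1 : √(hh.eigenvalues i) ≤ traceNorm A := by
      rw [htr]
      exact Finset.single_le_sum (f := fun j => √(hh.eigenvalues j))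
        (fun j _ => Real.sqrt_nonneg _) (Finset.mem_univ i)
    have h2 : ‖((fun x : ℝ => (x : ℂ)) ∘ hh.eigenvalues) i‖ = hh.eigenvalues i := by
      simp [abs_of_nonneg (hps.eigenvalues_nonneg i)]
    rw [h2, ← Real.mul_self_sqrt (hps.eigenvalues_nonneg i)]
    exact mul_self_le_mul_self (Real.sqrt_nonneg _) h1
  exact (mul_self_le_mul_self_iff (norm_nonneg _) hnn).2 hsq

/-! ### Removing the time evolution from the correlators -/

/-- In every term `e^{-itH_B}` stands before `1 - P` or `P₀`, where it acts as the identity, and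
`e^{itH_B}` commutes with `P` and comes out on the left. The estimate at time `t` is thus the
estimate at time zero. -/
theorem corr_sub_counterterm (hH : H.IsHermitian) {B : Set ℝ} (h0 : (0 : ℝ) ∉ B) (t : ℝ)
    (X Y : Op L) : corr H B (evol H B t X) Y - counterterm H B t X Y =
      propagator H B t * clusterDefect (specProj H B) (groundProj H) X Y := by
  have hd : Disjoint B {0} := Set.disjoint_singleton_right.2 h0
  have hc := (commute_specProj_propagator hH B B t).eq
  have h1 : propagator H B (-t) * (1 - specProj H B) = 1 - specProj H B := by
    rw [one_sub_specProj hH]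
    exact propagator_mul_specProj_of_disjoint hH disjoint_compl_right _
  have h2 : propagator H B (-t) * groundProj H = groundProj H :=
    propagator_mul_specProj_of_disjoint hH hd _
  simp only [corr, counterterm, window, evol_eq, clusterDefect]
  set P := specProj H B
  set U := propagator H B t
  set V := propagator H B (-t)
  set P₀ := groundProj H
  calc P * (U * X * V) * (1 - P) * Y * P - P * (U * X * V * P₀ * Y + U * Y * V * P₀ * X) * P
      = (P * U) * X * (V * (1 - P)) * Y * P
        - (P * U) * (X * (V * P₀) * Y + Y * (V * P₀) * X) * P := by noncomm_ring
    _ = _ := by rw [h1, h2, hc]; noncomm_ring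

/-- The commutator of two observables restricted to the energy window. -/
noncomputable def windowComm (H : Op L) (B : Set ℝ) (t : ℝ) (X Y : Op L) : Op L :=
  propagator H B t * (specProj H B * X * windowProp H B (-t) * Y * specProj H B)
    - (specProj H B * Y * windowProp H B t * X * specProj H B) * propagator H B (-t)

/-- Off the window the propagators inside the commutator are trivial and leave the two defects, one
for each order of the observables. Only the part within the window, collected in `windowComm`,
retains a genuine time dependence. -/
theorem window_correctedComm (hH : H.IsHermitian) {B : Set ℝ} (h0 : (0 : ℝ) ∉ B) (t : ℝ)
    (X Y : Op L) : window H B (correctedComm H B t X Y) =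
      propagator H B t * clusterDefect (specProj H B) (groundProj H) X Y
      - clusterDefect (specProj H B) (groundProj H) Y X * propagator H B (-t)
      + windowComm H B t X Y := by
  have hd : Disjoint B {0} := Set.disjoint_singleton_right.2 h0
  have hcU := (commute_specProj_propagator hH B B t).eq
  have hcV := (commute_specProj_propagator hH B B (-t)).eq
  have h1 : propagator H B (-t) * (1 - specProj H B) = 1 - specProj H B := by
    rw [one_sub_specProj hH]
    exact propagator_mul_specProj_of_disjoint hH disjoint_compl_right _
  have h1' : (1 - specProj H B) * propagator H B t = 1 - specProj H B := by
    rw [one_sub_specProj hH, (commute_specProj_propagator hH _ _ _).eq]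
    exact propagator_mul_specProj_of_disjoint hH disjoint_compl_right _
  have h2 : propagator H B (-t) * groundProj H = groundProj H :=
    propagator_mul_specProj_of_disjoint hH hd _
  have h2' : groundProj H * propagator H B t = groundProj H := by
    rw [groundProj, (commute_specProj_propagator hH _ _ _).eq]
    exact propagator_mul_specProj_of_disjoint hH hd _
  simp only [correctedComm, comm, window, windowComm, windowProp, evol_eq, clusterDefect]
  set P := specProj H B
  set U := propagator H B t
  set V := propagator H B (-t)
  set P₀ := groundProj H
  -- Split each inner propagator into its trivial part off the window and its part in the window.
  have e1 : V = (1 - P) + P * V := by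
    calc V = V * (1 - P) + V * P := by noncomm_ring
      _ = _ := by rw [h1, hcV]
  have e2 : U = (1 - P) + P * U := by
    calc U = (1 - P) * U + P * U := by noncomm_ring
      _ = _ := by rw [h1']
  have a1 : P * (U * X * V * Y) * P =
      U * (P * X * (1 - P) * Y * P) + U * (P * X * (P * V) * Y * P) := by
    calc P * (U * X * V * Y) * P = (P * U) * X * V * Y * P := by noncomm_ring
      _ = (P * U) * X * ((1 - P) + P * V) * Y * P := by rw [← e1]
      _ = _ := by rw [hcU]; noncomm_ring
  have a2 : P * (Y * (U * X * V)) * P =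
      P * Y * (1 - P) * X * P * V + P * Y * (P * U) * X * P * V := by
    calc P * (Y * (U * X * V)) * P = P * Y * U * X * (V * P) := by noncomm_ring
      _ = P * Y * ((1 - P) + P * U) * X * (V * P) := by rw [← e2]
      _ = _ := by rw [← hcV]; noncomm_ring
  have a3 : P * (U * X * V * P₀ * Y + U * Y * V * P₀ * X) * P =
      U * (P * X * P₀ * Y * P) + U * (P * Y * P₀ * X * P) := by
    calc P * (U * X * V * P₀ * Y + U * Y * V * P₀ * X) * P
        = (P * U) * X * (V * P₀) * Y * P + (P * U) * Y * (V * P₀) * X * P := by noncomm_ring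
      _ = _ := by rw [h2, hcU]; noncomm_ring
  have a4 : P * (Y * P₀ * (U * X * V) + X * P₀ * (U * Y * V)) * P =
      P * Y * P₀ * X * P * V + P * X * P₀ * Y * P * V := by
    calc P * (Y * P₀ * (U * X * V) + X * P₀ * (U * Y * V)) * P
        = P * Y * (P₀ * U) * X * (V * P) + P * X * (P₀ * U) * Y * (V * P) := by noncomm_ring
      _ = _ := by rw [h2', ← hcV]; noncomm_ring
  calc P * (U * X * V * Y - Y * (U * X * V) - (U * X * V * P₀ * Y + U * Y * V * P₀ * X)
        + (Y * P₀ * (U * X * V) + X * P₀ * (U * Y * V))) * P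
      = P * (U * X * V * Y) * P - P * (Y * (U * X * V)) * P
        - P * (U * X * V * P₀ * Y + U * Y * V * P₀ * X) * P
        + P * (Y * P₀ * (U * X * V) + X * P₀ * (U * Y * V)) * P := by noncomm_ring
    _ = _ := by rw [a1, a2, a3, a4]; noncomm_ring

/-- A scalar in place of `X` or `Y` brings `P` next to `1 - P` or `P₀`, and the product vanishes.
Hence observables may be centred. -/
theorem clusterDefect_sub_smul_one {P P₀ : Op L} (hP : P * P = P) (h1 : P * P₀ = 0)
    (h2 : P₀ * P = 0) (X Y : Op L) (x y : ℂ) :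
    clusterDefect P P₀ (X - x • 1) (Y - y • 1) = clusterDefect P P₀ X Y := by
  simp only [clusterDefect, mul_sub, sub_mul, mul_one, mul_assoc, smul_mul_assoc,
    mul_smul_comm, h1, h2, hP, smul_zero, mul_zero, sub_zero]
  simp only [smul_sub]
  abel

/-- A scalar in place of one observable gives the same contribution in both orders, once the
propagators cancel. -/
theorem windowComm_sub_smul_one (hH : H.IsHermitian) (B : Set ℝ) (t : ℝ) (X Y : Op L) (x y : ℂ) :
    windowComm H B t (X - x • 1) (Y - y • 1) = windowComm H B t X Y := by
  have hP := specProj_mul_self hH B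
  have hcU := (commute_specProj_propagator hH B B t).eq
  have hcV := (commute_specProj_propagator hH B B (-t)).eq
  have hUV := propagator_mul_neg hH B t
  simp only [windowComm, windowProp]
  set P := specProj H B
  set U := propagator H B t
  set V := propagator H B (-t)
  have hP' : ∀ z, P * (P * z) = P * z := fun z => by rw [← mul_assoc, hP]
  have hcU' : ∀ z, U * (P * z) = P * (U * z) := fun z => by rw [← mul_assoc, ← hcU, mul_assoc]
  have hUV' : ∀ z, U * (V * z) = z := fun z => by rw [← mul_assoc, hUV, one_mul]
  simp only [mul_sub, sub_mul, mul_one, mul_assoc, smul_mul_assoc, mul_smul_comm, hP',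
    ← hcU, hcU', ← hcV, hUV, hUV']
  simp only [smul_sub, smul_comm y x P]
  abel

end XXZ

/-! ### The Hamiltonian: ground state, spectral gap, one-particle matrix elements -/

namespace XXZ

variable {L : ℕ}

/-- Exchange of the spins at two sites. -/
def swapConfig (i j : Site L) : Config L ≃ Config L := (Equiv.swap i j).arrowCongr (Equiv.refl _)

theorem swapConfig_apply (i j : Site L) (σ : Config L) (k : Site L) :
    swapConfig i j σ k = σ (Equiv.swap i j k) := by
  simp [swapConfig, Equiv.arrowCongr]

/-- `σˣσˣ + σʸσʸ` annihilates parallel pairs of spins and exchanges antiparallel ones with amplitude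
`2`, whence the coefficient `1 / (2Δ)`. -/
theorem bond_apply (Δ : ℝ) {i j : Site L} (hij : i ≠ j) (σ τ : Config L) :
    bond Δ i j σ τ = if σ i ≠ σ j then (1 / 2 : ℂ) * (if σ = τ then 1 else 0)
      - (1 / (2 * Δ) : ℂ) * (if swapConfig i j σ = τ then 1 else 0) else 0 := by
  have e1 : σ = τ ↔ (∀ k, k ≠ i → k ≠ j → σ k = τ k) ∧ σ i = τ i ∧ σ j = τ j := by
    refine ⟨fun h => by simp [h], fun ⟨h, hi, hj⟩ => funext fun k => ?_⟩
    by_cases hki : k = i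
    · rw [hki, hi]
    · by_cases hkj : k = j
      · rw [hkj, hj]
      · exact h k hki hkj
  have e2 : swapConfig i j σ = τ ↔
      (∀ k, k ≠ i → k ≠ j → σ k = τ k) ∧ σ j = τ i ∧ σ i = τ j := by
    refine ⟨?_, fun ⟨h, hi, hj⟩ => funext fun k => ?_⟩
    · rintro rfl
      refine ⟨fun k hi hj => ?_, ?_, ?_⟩
      · rw [swapConfig_apply, Equiv.swap_apply_of_ne_of_ne hi hj]
      · rw [swapConfig_apply, Equiv.swap_apply_left]
      · rw [swapConfig_apply, Equiv.swap_apply_right]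
    · rw [swapConfig_apply]
      by_cases hki : k = i
      · rw [hki, Equiv.swap_apply_left, hi]
      · by_cases hkj : k = j
        · rw [hkj, Equiv.swap_apply_right, hj]
        · rw [Equiv.swap_apply_of_ne_of_ne hki hkj, h k hki hkj]
  simp only [bond, Matrix.sub_apply, Matrix.smul_apply, Matrix.add_apply, siteOp_mul_apply hij,
    Matrix.one_apply, smul_eq_mul, e1, e2]
  by_cases h : ∀ k, k ≠ i → k ≠ j → σ k = τ k
  · simp only [eq_true h, true_and]
    generalize σ i = a
    generalize σ j = b
    generalize τ i = c
    generalize τ j = d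
    fin_cases a <;> fin_cases b <;> fin_cases c <;> fin_cases d <;>
      simp [pauliX, pauliY, pauliZ] <;> ring
  · simp only [eq_false h, false_and, if_false, mul_zero, sub_self, ite_self, add_zero]

theorem bond_mulVec (Δ : ℝ) {i j : Site L} (hij : i ≠ j) (v : Config L → ℂ) (σ : Config L) :
    (bond Δ i j *ᵥ v) σ = if σ i ≠ σ j then
      (1 / 2 : ℂ) * v σ - (1 / (2 * Δ) : ℂ) * v (swapConfig i j σ) else 0 := by
  simp only [Matrix.mulVec, dotProduct, bond_apply Δ hij]
  split_ifs with h
  · simp [sub_mul, Finset.sum_sub_distrib, mul_assoc]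
  · simp

/-- The exchange term is bounded by the arithmetic-geometric mean inequality, and exchanging the two
spins permutes the configurations with `σ i ≠ σ j`. Each domain wall therefore costs at least half
of `Θ₀`. -/
theorem le_re_bond (Δ : ℝ) (hΔ : 0 < Δ) {i j : Site L} (hij : i ≠ j) (v : Config L → ℂ) :
    ∑ σ, (if σ i ≠ σ j then 1 / 2 * (1 - 1 / Δ) * ‖v σ‖ ^ 2 else 0) ≤
      (star v ⬝ᵥ bond Δ i j *ᵥ v).re := by
  have hsym : ∑ σ : Config L, (if σ i ≠ σ j then ‖v (swapConfig i j σ)‖ ^ 2 else 0) =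
      ∑ σ : Config L, (if σ i ≠ σ j then ‖v σ‖ ^ 2 else 0) := by
    refine Fintype.sum_equiv (swapConfig i j) _ _ fun σ => ?_
    simp only [swapConfig_apply, Equiv.swap_apply_left, Equiv.swap_apply_right, ne_comm]
  have hpt : ∀ σ : Config L, (if σ i ≠ σ j then 1 / 2 * ‖v σ‖ ^ 2
      - 1 / (4 * Δ) * (‖v σ‖ ^ 2 + ‖v (swapConfig i j σ)‖ ^ 2) else 0) ≤
      (star (v σ) * (bond Δ i j *ᵥ v) σ).re := by
    intro σ
    rw [bond_mulVec Δ hij]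
    split_ifs with h
    · have h1 : (star (v σ) * v σ).re = ‖v σ‖ ^ 2 := by
        rw [Complex.star_def, Complex.conj_mul', ← Complex.ofReal_pow, Complex.ofReal_re]
      have h2 : (star (v σ) * v (swapConfig i j σ)).re ≤
          (‖v σ‖ ^ 2 + ‖v (swapConfig i j σ)‖ ^ 2) / 2 := by
        refine (Complex.re_le_norm _).trans ?_
        rw [norm_mul, norm_star]
        nlinarith [sq_nonneg (‖v σ‖ - ‖v (swapConfig i j σ)‖)]
      have h3 : (star (v σ) * ((1 / 2 : ℂ) * v σ - (1 / (2 * Δ) : ℂ) * v (swapConfig i j σ))).re =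
          1 / 2 * (star (v σ) * v σ).re
            - 1 / (2 * Δ) * (star (v σ) * v (swapConfig i j σ)).re := by
        rw [← Complex.re_ofReal_mul, ← Complex.re_ofReal_mul, ← Complex.sub_re]
        congr 1
        push_cast
        ring
      rw [h3, h1]
      have h4 : 1 / (2 * Δ) * (star (v σ) * v (swapConfig i j σ)).re ≤
          1 / (2 * Δ) * ((‖v σ‖ ^ 2 + ‖v (swapConfig i j σ)‖ ^ 2) / 2) :=
        mul_le_mul_of_nonneg_left h2 (by positivity)
      have h5 : 1 / (2 * Δ) * ((‖v σ‖ ^ 2 + ‖v (swapConfig i j σ)‖ ^ 2) / 2) =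
          1 / (4 * Δ) * (‖v σ‖ ^ 2 + ‖v (swapConfig i j σ)‖ ^ 2) := by
        field_simp
        ring
      linarith
    · simp
  have hsum := Finset.sum_le_sum fun σ (_ : σ ∈ Finset.univ) => hpt σ
  rw [dotProduct, Complex.re_sum]
  refine le_trans (le_of_eq ?_) hsum
  have e : ∀ σ : Config L, (if σ i ≠ σ j then 1 / 2 * ‖v σ‖ ^ 2
      - 1 / (4 * Δ) * (‖v σ‖ ^ 2 + ‖v (swapConfig i j σ)‖ ^ 2) else 0) =
      (1 / 2 - 1 / (4 * Δ)) * (if σ i ≠ σ j then ‖v σ‖ ^ 2 else 0)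
        - 1 / (4 * Δ) * (if σ i ≠ σ j then ‖v (swapConfig i j σ)‖ ^ 2 else 0) := by
    intro σ
    split_ifs <;> ring
  simp only [e, Finset.sum_sub_distrib, ← Finset.mul_sum, hsym]
  have e' : ∀ σ : Config L, (if σ i ≠ σ j then 1 / 2 * (1 - 1 / Δ) * ‖v σ‖ ^ 2 else 0) =
      1 / 2 * (1 - 1 / Δ) * (if σ i ≠ σ j then ‖v σ‖ ^ 2 else 0) := by
    intro σ
    split_ifs <;> ring
  simp only [e', ← Finset.mul_sum]
  field_simp
  ring

theorem numOp_mulVec (i : Site L) (v : Config L → ℂ) (σ : Config L) :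
    (numOp i *ᵥ v) σ = if σ i = 1 then v σ else 0 := by
  rw [numOp_eq_diagProj, diagProj, Matrix.mulVec_diagonal]
  split_ifs <;> simp

theorem re_numOp (i : Site L) (v : Config L → ℂ) :
    (star v ⬝ᵥ numOp i *ᵥ v).re = ∑ σ, if σ i = 1 then ‖v σ‖ ^ 2 else 0 := by
  rw [dotProduct, Complex.re_sum]
  refine Finset.sum_congr rfl fun σ _ => ?_
  rw [numOp_mulVec, Pi.star_apply]
  split_ifs with h
  · rw [Complex.star_def, Complex.conj_mul', ← Complex.ofReal_pow, Complex.ofReal_re]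
  · simp

theorem fin_two_eq_one_of_ne_zero {x : Fin 2} (h : x ≠ 0) : x = 1 := by
  fin_cases x <;> simp_all

/-- Left of a down spin there is either a domain wall or a down spin at the left end. -/
theorem exists_left_wall (σ : Config L) : ∀ (n : ℕ) (k : Site L), (k : ℤ) = -(L : ℤ) + n → σ k = 1 →
    σ (leftEnd L) = 1 ∨ ∃ i j : Site L, (j : ℤ) = (i : ℤ) + 1 ∧ σ i = 0 ∧ σ j = 1 := by
  intro n
  induction n with
  | zero =>
    intro k hk h
    left
    rwa [show leftEnd L = k from Subtype.ext (by simp [leftEnd, hk])]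
  | succ n ih =>
    intro k hk h
    have hkm := Finset.mem_Icc.1 k.2
    let k' : Site L := ⟨(k : ℤ) - 1, Finset.mem_Icc.2 ⟨by push_cast at hk; omega, by omega⟩⟩
    by_cases h' : σ k' = 0
    · exact Or.inr ⟨k', k, by simp [k'], h', h⟩
    · exact ih k' (by simp only [k']; push_cast at hk; omega) (fin_two_eq_one_of_ne_zero h')

/-- Right of a down spin there is either a domain wall or a down spin at the right end. -/
theorem exists_right_wall (σ : Config L) : ∀ (n : ℕ) (k : Site L), (k : ℤ) = (L : ℤ) - n → σ k = 1 →
    σ (rightEnd L) = 1 ∨ ∃ i j : Site L, (j : ℤ) = (i : ℤ) + 1 ∧ σ i = 1 ∧ σ j = 0 := by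
  intro n
  induction n with
  | zero =>
    intro k hk h
    left
    rwa [show rightEnd L = k from Subtype.ext (by simp [rightEnd, hk])]
  | succ n ih =>
    intro k hk h
    have hkm := Finset.mem_Icc.1 k.2
    let k' : Site L := ⟨(k : ℤ) + 1, Finset.mem_Icc.2 ⟨by omega, by push_cast at hk; omega⟩⟩
    by_cases h' : σ k' = 0
    · exact Or.inr ⟨k, k', by simp [k'], h, h'⟩
    · exact ih k' (by simp only [k']; push_cast at hk; omega) (fin_two_eq_one_of_ne_zero h')

theorem one_le_sum_sum {ι : Type*} [Fintype ι] {f : ι → ι → ℝ} (hf : ∀ i j, 0 ≤ f i j) {i j : ι}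
    (h : 1 ≤ f i j) : 1 ≤ ∑ i, ∑ j, f i j :=
  h.trans ((Finset.single_le_sum (fun j _ => hf i j) (Finset.mem_univ j)).trans
    (Finset.single_le_sum (f := fun i => ∑ j, f i j)
      (fun i _ => Finset.sum_nonneg fun j _ => hf i j) (Finset.mem_univ i)))

/-- A configuration with a down spin has at least two domain walls, counting the ends. -/
theorem two_le_walls {σ : Config L} (hσ : σ ≠ 0) :
    2 ≤ (∑ i : Site L, ∑ j : Site L, if (j : ℤ) = (i : ℤ) + 1 then
        (if σ i ≠ σ j then (1 : ℝ) else 0) else 0)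
      + ((if σ (leftEnd L) = 1 then 1 else 0) + (if σ (rightEnd L) = 1 then 1 else 0)) := by
  obtain ⟨k, hk⟩ := Function.ne_iff.1 hσ
  have hk1 := fin_two_eq_one_of_ne_zero hk
  have hkm := Finset.mem_Icc.1 k.2
  set u : Site L → Site L → ℝ := fun i j =>
    if (j : ℤ) = (i : ℤ) + 1 ∧ σ i = 0 ∧ σ j = 1 then 1 else 0
  set d : Site L → Site L → ℝ := fun i j =>
    if (j : ℤ) = (i : ℤ) + 1 ∧ σ i = 1 ∧ σ j = 0 then 1 else 0
  have hu : ∀ i j, 0 ≤ u i j := fun i j => by simp only [u]; split_ifs <;> simp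
  have hd : ∀ i j, 0 ≤ d i j := fun i j => by simp only [d]; split_ifs <;> simp
  have hud : ∀ i j : Site L, (if (j : ℤ) = (i : ℤ) + 1 then
      (if σ i ≠ σ j then (1 : ℝ) else 0) else 0) = u i j + d i j := by
    intro i j
    simp only [u, d]
    by_cases h : (j : ℤ) = (i : ℤ) + 1
    · simp only [h, if_true, true_and]
      generalize σ i = a
      generalize σ j = b
      fin_cases a <;> fin_cases b <;> simp
    · simp [h]
  simp only [hud, Finset.sum_add_distrib]
  have h1 : 1 ≤ (∑ i, ∑ j, u i j) + (if σ (leftEnd L) = 1 then 1 else 0) := by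
    rcases exists_left_wall σ ((k : ℤ) + L).toNat k (by omega) hk1 with h | ⟨i, j, h⟩
    · have := Finset.sum_nonneg fun i (_ : i ∈ Finset.univ) =>
        Finset.sum_nonneg fun j (_ : j ∈ Finset.univ) => hu i j
      rw [if_pos h]
      linarith
    · have := one_le_sum_sum hu (i := i) (j := j) (by simp [u, h])
      split_ifs <;> linarith
  have h2 : 1 ≤ (∑ i, ∑ j, d i j) + (if σ (rightEnd L) = 1 then 1 else 0) := by
    rcases exists_right_wall σ ((L : ℤ) - k).toNat k (by omega) hk1 with h | ⟨i, j, h⟩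
    · have := Finset.sum_nonneg fun i (_ : i ∈ Finset.univ) =>
        Finset.sum_nonneg fun j (_ : j ∈ Finset.univ) => hd i j
      rw [if_pos h]
      linarith
    · have := one_le_sum_sum hd (i := i) (j := j) (by simp [d, h])
      split_ifs <;> linarith
  linarith

theorem re_hamiltonian (Δ lam β : ℝ) (ω : ℤ → ℝ) (v : Config L → ℂ) :
    (star v ⬝ᵥ hamiltonian Δ lam β L ω *ᵥ v).re =
      (∑ i : Site L, ∑ j : Site L, if (j : ℤ) = (i : ℤ) + 1 then
        (star v ⬝ᵥ bond Δ i j *ᵥ v).re else 0)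
      + lam * (∑ i : Site L, ω i * (star v ⬝ᵥ numOp i *ᵥ v).re)
      + β * ((star v ⬝ᵥ numOp (leftEnd L) *ᵥ v).re + (star v ⬝ᵥ numOp (rightEnd L) *ᵥ v).re) := by
  have e : ∀ i j : Site L, (star v ⬝ᵥ (if (j : ℤ) = (i : ℤ) + 1 then bond Δ i j else 0) *ᵥ v).re =
      if (j : ℤ) = (i : ℤ) + 1 then (star v ⬝ᵥ bond Δ i j *ᵥ v).re else 0 := by
    intro i j
    split_ifs <;> simp
  simp only [hamiltonian, Matrix.add_mulVec, Matrix.smul_mulVec, Matrix.sum_mulVec,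
    dotProduct_add, dotProduct_smul, dotProduct_sum, Complex.add_re, smul_eq_mul,
    Complex.re_ofReal_mul, Complex.re_sum, e]

/-- The Hamiltonian has a spectral gap above the all spins up state. -/
theorem gap_le_re_hamiltonian {Δ lam β : ℝ} (hΔ : 1 < Δ) (hlam : 0 < lam)
    (hβ : 1 / 2 * (1 - 1 / Δ) ≤ β) {ω : ℤ → ℝ} (hω : ∀ i, 0 ≤ ω i) (v : Config L → ℂ) :
    (1 - 1 / Δ) * ∑ σ, (if σ = 0 then 0 else ‖v σ‖ ^ 2) ≤
      (star v ⬝ᵥ hamiltonian Δ lam β L ω *ᵥ v).re := by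
  have hθ : 0 ≤ 1 - 1 / Δ := by
    rw [sub_nonneg, div_le_one (by linarith)]
    exact hΔ.le
  rw [re_hamiltonian]
  have h1 : 0 ≤ lam * (∑ i : Site L, ω i * (star v ⬝ᵥ numOp i *ᵥ v).re) := by
    refine mul_nonneg hlam.le (Finset.sum_nonneg fun i _ => mul_nonneg (hω i) ?_)
    rw [re_numOp]
    exact Finset.sum_nonneg fun σ _ => by split_ifs <;> positivity
  have h2 : ∑ i : Site L, ∑ j : Site L, (if (j : ℤ) = (i : ℤ) + 1 then
      ∑ σ, (if σ i ≠ σ j then 1 / 2 * (1 - 1 / Δ) * ‖v σ‖ ^ 2 else 0) else 0) ≤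
      ∑ i : Site L, ∑ j : Site L, if (j : ℤ) = (i : ℤ) + 1 then
        (star v ⬝ᵥ bond Δ i j *ᵥ v).re else 0 := by
    refine Finset.sum_le_sum fun i _ => Finset.sum_le_sum fun j _ => ?_
    split_ifs with h
    · refine le_re_bond Δ (by linarith) ?_ v
      rintro rfl
      omega
    · rfl
  have h3 : 1 / 2 * (1 - 1 / Δ) * ((star v ⬝ᵥ numOp (leftEnd L) *ᵥ v).re
      + (star v ⬝ᵥ numOp (rightEnd L) *ᵥ v).re) ≤
      β * ((star v ⬝ᵥ numOp (leftEnd L) *ᵥ v).re + (star v ⬝ᵥ numOp (rightEnd L) *ᵥ v).re) := by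
    refine mul_le_mul_of_nonneg_right hβ (add_nonneg ?_ ?_) <;>
    · rw [re_numOp]
      exact Finset.sum_nonneg fun σ _ => by split_ifs <;> positivity
  -- Exchanging the sums makes the coefficient of `‖v σ‖ ^ 2` half of `Θ₀` times the number of
  -- domain walls of `σ`, the ends included.
  have h4 : ∑ i : Site L, ∑ j : Site L, (if (j : ℤ) = (i : ℤ) + 1 then
      ∑ σ, (if σ i ≠ σ j then 1 / 2 * (1 - 1 / Δ) * ‖v σ‖ ^ 2 else 0) else 0)
      + 1 / 2 * (1 - 1 / Δ) * ((star v ⬝ᵥ numOp (leftEnd L) *ᵥ v).re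
        + (star v ⬝ᵥ numOp (rightEnd L) *ᵥ v).re) =
      ∑ σ : Config L, 1 / 2 * (1 - 1 / Δ) * ‖v σ‖ ^ 2 *
        ((∑ i : Site L, ∑ j : Site L, if (j : ℤ) = (i : ℤ) + 1 then
          (if σ i ≠ σ j then (1 : ℝ) else 0) else 0)
        + ((if σ (leftEnd L) = 1 then 1 else 0) + (if σ (rightEnd L) = 1 then 1 else 0))) := by
    have e : ∀ i j : Site L, (if (j : ℤ) = (i : ℤ) + 1 then
        ∑ σ : Config L, (if σ i ≠ σ j then 1 / 2 * (1 - 1 / Δ) * ‖v σ‖ ^ 2 else 0) else 0) =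
        ∑ σ : Config L, 1 / 2 * (1 - 1 / Δ) * ‖v σ‖ ^ 2 * (if (j : ℤ) = (i : ℤ) + 1 then
          (if σ i ≠ σ j then (1 : ℝ) else 0) else 0) := by
      intro i j
      split_ifs
      · refine Finset.sum_congr rfl fun σ _ => ?_
        split_ifs <;> simp
      · simp
    simp only [e]
    simp_rw [Finset.sum_comm (s := (Finset.univ : Finset (Site L))) (t := (Finset.univ : Finset (Config L)))]
    rw [re_numOp, re_numOp, ← Finset.sum_add_distrib, Finset.mul_sum, ← Finset.sum_add_distrib]
    refine Finset.sum_congr rfl fun σ _ => ?_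
    simp only [← Finset.mul_sum]
    rw [mul_add]
    split_ifs <;> ring
  have h5 : (1 - 1 / Δ) * ∑ σ : Config L, (if σ = 0 then 0 else ‖v σ‖ ^ 2) ≤
      ∑ σ : Config L, 1 / 2 * (1 - 1 / Δ) * ‖v σ‖ ^ 2 *
        ((∑ i : Site L, ∑ j : Site L, if (j : ℤ) = (i : ℤ) + 1 then
          (if σ i ≠ σ j then (1 : ℝ) else 0) else 0)
        + ((if σ (leftEnd L) = 1 then 1 else 0) + (if σ (rightEnd L) = 1 then 1 else 0))) := by
    rw [Finset.mul_sum]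
    refine Finset.sum_le_sum fun σ _ => ?_
    by_cases hσ : σ = 0
    · rw [if_pos hσ, mul_zero]
      refine mul_nonneg (by positivity) (add_nonneg (Finset.sum_nonneg fun i _ =>
        Finset.sum_nonneg fun j _ => ?_) (add_nonneg ?_ ?_)) <;> split_ifs <;> norm_num
    · rw [if_neg hσ]
      calc (1 - 1 / Δ) * ‖v σ‖ ^ 2 = 1 / 2 * (1 - 1 / Δ) * ‖v σ‖ ^ 2 * 2 := by ring
        _ ≤ _ := mul_le_mul_of_nonneg_left (two_le_walls hσ) (by positivity)
  linarith

theorem hamiltonian_apply_vac (Δ lam β : ℝ) (ω : ℤ → ℝ) (σ : Config L) :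
    hamiltonian Δ lam β L ω σ 0 = 0 := by
  have hn : ∀ i : Site L, numOp i σ 0 = 0 := by
    intro i
    rw [numOp_eq_diagProj, diagProj, Matrix.diagonal_apply]
    by_cases h : σ = 0
    · subst h
      simp
    · simp [h]
  have hb : ∀ i j : Site L, (if (j : ℤ) = (i : ℤ) + 1 then bond Δ i j else 0 : Op L) σ 0 = 0 := by
    intro i j
    split_ifs with h
    · have hij : i ≠ j := by
        rintro rfl
        omega
      rw [bond_apply Δ hij]
      split_ifs with h1 h2 h3 h3
      · simp [h2] at h1
      · simp [h2] at h1
      · have h4 : ∀ k, σ (Equiv.swap i j k) = 0 := fun k => by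
          rw [← swapConfig_apply i j σ, h3]
          rfl
        have hi := h4 i
        have hj := h4 j
        rw [Equiv.swap_apply_left] at hi
        rw [Equiv.swap_apply_right] at hj
        exact absurd (hj.trans hi.symm) h1
      · simp
      · rfl
    · rfl
  simp [hamiltonian, Matrix.add_apply, Matrix.sum_apply, hn, hb]

end XXZ

namespace XXZ

variable {L : ℕ}

theorem hamiltonian_mul_vac (Δ lam β : ℝ) (ω : ℤ → ℝ) : hamiltonian Δ lam β L ω * vac L = 0 := by
  classical
  ext σ τ
  rw [vac, mul_diagProj_apply]
  split_ifs with h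
  · rw [h, hamiltonian_apply_vac, Matrix.zero_apply]
  · rfl

theorem re_star_dotProduct_self (v : Config L → ℂ) : (star v ⬝ᵥ v).re = ∑ σ, ‖v σ‖ ^ 2 := by
  rw [dotProduct, Complex.re_sum]
  refine Finset.sum_congr rfl fun σ _ => ?_
  rw [Pi.star_apply, Complex.star_def, Complex.conj_mul', ← Complex.ofReal_pow, Complex.ofReal_re]

/-- The spectrum is contained in `{0} ∪ [Θ₀, ∞)`. -/
theorem eigenvalue_eq_zero_or_le {Δ lam β : ℝ} (hΔ : 1 < Δ) (hlam : 0 < lam)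
    (hβ : 1 / 2 * (1 - 1 / Δ) ≤ β) {ω : ℤ → ℝ} (hω : ∀ i, 0 ≤ ω i) (k : Config L) :
    (hamiltonian_isHermitian Δ lam β L ω).eigenvalues k = 0 ∨
      1 - 1 / Δ ≤ (hamiltonian_isHermitian Δ lam β L ω).eigenvalues k := by
  set hH := hamiltonian_isHermitian Δ lam β L ω
  set H := hamiltonian Δ lam β L ω
  set E := hH.eigenvalues k
  set v : Config L → ℂ := ⇑(hH.eigenvectorBasis k) with hv
  have hHv : H *ᵥ v = E • v := hH.mulVec_eigenvectorBasis k
  have hnorm : ∑ σ, ‖v σ‖ ^ 2 = 1 := by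
    have := (hH.eigenvectorBasis).orthonormal.1 k
    rw [EuclideanSpace.norm_eq, Real.sqrt_eq_one] at this
    exact this
  by_cases hE : E = 0
  · exact Or.inl hE
  · right
    -- The vacuum row of `H` is zero, so an eigenvector with nonzero eigenvalue has no vacuum
    -- component.
    have h0 : v 0 = 0 := by
      have h1 : (H *ᵥ v) 0 = 0 := by
        rw [Matrix.mulVec, dotProduct]
        refine Finset.sum_eq_zero fun σ _ => ?_
        have : H 0 σ = star (H σ 0) := (hH.apply 0 σ).symm
        rw [this, show H σ 0 = 0 from hamiltonian_apply_vac Δ lam β ω σ, star_zero, zero_mul]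
      rw [hHv, Pi.smul_apply, smul_eq_zero] at h1
      exact h1.resolve_left hE
    have h2 : (star v ⬝ᵥ H *ᵥ v).re = E := by
      rw [hHv, dotProduct_smul, Complex.smul_re, re_star_dotProduct_self, hnorm, smul_eq_mul,
        mul_one]
    have h3 : ∑ σ, (if σ = 0 then 0 else ‖v σ‖ ^ 2) = ∑ σ, ‖v σ‖ ^ 2 := by
      refine Finset.sum_congr rfl fun σ _ => ?_
      split_ifs with h
      · simp [h, h0]
      · rfl
    have h4 := gap_le_re_hamiltonian hΔ hlam hβ hω v
    rwa [h3, hnorm, mul_one, h2] at h4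

/-- The ground state projection is the projection onto the all spins up configuration. -/
theorem groundProj_hamiltonian {Δ lam β : ℝ} (hΔ : 1 < Δ) (hlam : 0 < lam)
    (hβ : 1 / 2 * (1 - 1 / Δ) ≤ β) {ω : ℤ → ℝ} (hω : ∀ i, 0 ≤ ω i) :
    groundProj (hamiltonian Δ lam β L ω) = vac L := by
  classical
  set hH := hamiltonian_isHermitian Δ lam β L ω
  set H := hamiltonian Δ lam β L ω with hHdef
  have hθ : 0 < 1 - 1 / Δ := by
    rw [sub_pos, div_lt_one (by linarith)]
    exact hΔ
  set P₀ := groundProj H with hP₀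
  have hstar : P₀ᴴ = P₀ := specProj_conjTranspose hH _
  have h1 : P₀ * vac L = vac L := by
    -- Since `0⁻¹ = 0`, the function `x⁻¹ * x` is the indicator of the complement of `{0}`; hence `1
    -- - P₀` ends in a factor `H`, which kills the vacuum.
    have e : 1 - P₀ = (hH.specFun fun x => (x : ℂ)⁻¹) * H := by
      have e' : (hH.specFun fun x => (x : ℂ)⁻¹) * H =
          (hH.specFun fun x => (x : ℂ)⁻¹) * hH.specFun fun x => (x : ℂ) := by
        rw [hH.specFun_ofReal]
      rw [e', hH.specFun_mul, hP₀, groundProj, one_sub_specProj hH, specProj_eq hH]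
      congr 1
      ext x
      by_cases hx : x = 0
      · simp [hx]
      · rw [Set.indicator_of_mem (by simpa using hx), inv_mul_cancel₀ (by simpa using hx)]
    have : (1 - P₀) * vac L = 0 := by rw [e, mul_assoc, hamiltonian_mul_vac, mul_zero]
    rw [sub_mul, one_mul, sub_eq_zero] at this
    exact this.symm
  have h2 : vac L * P₀ = vac L := by
    have := congrArg Matrix.conjTranspose h1
    rwa [Matrix.conjTranspose_mul, hstar, vac, diagProj_conjTranspose] at this
  have h3 : vac L * P₀ = P₀ := by
    have hHP : H * P₀ = 0 := by
      have e' : H * P₀ = (hH.specFun fun x => (x : ℂ)) * P₀ := by rw [hH.specFun_ofReal]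
      rw [e', hP₀, groundProj, specProj_eq hH, hH.specFun_mul]
      have : (fun x : ℝ => (x : ℂ) * ({0} : Set ℝ).indicator (fun _ => (1 : ℂ)) x) = fun _ => 0 * 1 := by
        ext x
        by_cases hx : x = 0 <;> simp [hx]
      rw [this, ← hH.specFun_smul, zero_smul]
    ext σ τ
    rw [vac, diagProj_mul_apply]
    split_ifs with hσ
    · rfl
    -- A column of `P₀` lies in the kernel of `H`, and by the gap inequality such a vector has only
    -- a vacuum component.
    · set v : Config L → ℂ := P₀.col τ with hv
      have hHv : H *ᵥ v = 0 := by
        have : H *ᵥ v = (H * P₀).col τ := by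
          ext ρ
          simp [hv, Matrix.mulVec, Matrix.mul_apply, dotProduct]
        rw [this, hHP]
        rfl
      have h4 := gap_le_re_hamiltonian hΔ hlam hβ hω v
      rw [← hHdef, hHv, dotProduct_zero, Complex.zero_re] at h4
      have hnn : ∀ ρ : Config L, 0 ≤ if ρ = 0 then 0 else ‖v ρ‖ ^ 2 := fun ρ => by
        split_ifs <;> positivity
      have h5 : (∑ ρ : Config L, if ρ = 0 then 0 else ‖v ρ‖ ^ 2) = 0 :=
        le_antisymm (nonpos_of_mul_nonpos_right h4 hθ) (Finset.sum_nonneg fun ρ _ => hnn ρ)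
      have h6 := (Finset.sum_eq_zero_iff_of_nonneg fun ρ _ => hnn ρ).1 h5 σ (Finset.mem_univ _)
      rw [if_neg hσ] at h6
      have h7 : v σ = 0 := by simpa using h6
      exact h7.symm
  rw [← h3, h2]

/-- The configuration with a single down spin, at the site `k`. -/
def particle (k : Site L) : Config L := Pi.single k 1

theorem particle_apply (k i : Site L) : particle k i = if i = k then 1 else 0 :=
  Pi.single_apply k 1 i

theorem particle_injective : Function.Injective (particle (L := L)) := by
  intro k l h
  have h1 := congrFun h k
  rw [particle_apply, particle_apply, if_pos rfl] at h1
  by_contra hne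
  rw [if_neg hne] at h1
  exact one_ne_zero h1

theorem particle_ne_zero (k : Site L) : particle k ≠ 0 := by
  intro h
  have := congrFun h k
  simp [particle_apply] at this

theorem swapConfig_particle (i j k : Site L) :
    swapConfig i j (particle k) = particle (Equiv.swap i j k) := by
  ext l
  simp only [swapConfig_apply, particle_apply, Equiv.swap_apply_eq_iff]

theorem bond_particle (Δ : ℝ) {i j : Site L} (hij : i ≠ j) (k l : Site L) :
    bond Δ i j (particle k) (particle l) =
      (if k = i then (1 / 2 : ℂ) * (if k = l then 1 else 0) - (1 / (2 * Δ) : ℂ) *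
        (if l = j then 1 else 0) else 0)
      + (if k = j then (1 / 2 : ℂ) * (if k = l then 1 else 0) - (1 / (2 * Δ) : ℂ) *
        (if l = i then 1 else 0) else 0) := by
  rw [bond_apply Δ hij, swapConfig_particle]
  simp only [particle_injective.eq_iff, particle_apply]
  by_cases hi : k = i
  · subst hi
    simp [hij, Ne.symm hij, eq_comm]
  · by_cases hj : k = j
    · subst hj
      simp [hij, Ne.symm hij, eq_comm]
    · simp [hi, hj, Ne.symm hi, Ne.symm hj]

theorem numOp_particle (i k l : Site L) :
    numOp i (particle k) (particle l) = if k = l ∧ i = k then 1 else 0 := by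
  rw [numOp_eq_diagProj, diagProj, Matrix.diagonal_apply]
  simp only [particle_injective.eq_iff, particle_apply]
  by_cases h : k = l <;> by_cases h' : i = k <;> simp [h, h']

/-- A particle in the interior touches two bonds, each with diagonal entry `1 / 2`, and does not
feel the boundary term. On one particle `H` is thus a discrete Schrödinger operator. -/
theorem hamiltonian_particle (Δ lam β : ℝ) (ω : ℤ → ℝ) {k : Site L} (hk1 : -(L : ℤ) < k)
    (hk2 : (k : ℤ) < L) (l : Site L) :
    hamiltonian Δ lam β L ω (particle k) (particle l) =
      (if k = l then 1 + (lam : ℂ) * ω k else 0)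
        - (1 / (2 * Δ) : ℂ) * ((if (l : ℤ) = k + 1 then 1 else 0) + (if (k : ℤ) = l + 1 then 1 else 0)) := by
  have hb : ∀ i j : Site L, (if (j : ℤ) = (i : ℤ) + 1 then bond Δ i j else 0 : Op L)
      (particle k) (particle l) =
      (if k = i then (if (j : ℤ) = k + 1 then (1 / 2 : ℂ) * (if k = l then 1 else 0)
        - (1 / (2 * Δ) : ℂ) * (if l = j then 1 else 0) else 0) else 0)
      + (if k = j then (if (k : ℤ) = i + 1 then (1 / 2 : ℂ) * (if k = l then 1 else 0)
        - (1 / (2 * Δ) : ℂ) * (if l = i then 1 else 0) else 0) else 0) := by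
    intro i j
    by_cases h : (j : ℤ) = (i : ℤ) + 1
    · have hij : i ≠ j := by
        rintro rfl
        omega
      rw [if_pos h, bond_particle Δ hij]
      congr 1
      · by_cases hki : k = i
        · simp [hki, h]
        · simp [hki]
      · by_cases hkj : k = j
        · simp [hkj, h]
        · simp [hkj]
    · rw [if_neg h, Matrix.zero_apply]
      by_cases hki : k = i
      · subst hki
        by_cases hkj : k = j
        · subst hkj
          simp
        · simp [h, hkj]
      · by_cases hkj : k = j
        · subst hkj
          simp [h, hki]
        · simp [hki, hkj]
  let kp : Site L := ⟨(k : ℤ) + 1, Finset.mem_Icc.2 ⟨by omega, by omega⟩⟩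
  let km : Site L := ⟨(k : ℤ) - 1, Finset.mem_Icc.2 ⟨by omega, by omega⟩⟩
  have hkp : ∀ j : Site L, (j : ℤ) = k + 1 ↔ j = kp := fun j =>
    ⟨fun h => Subtype.ext h, fun h => by rw [h]⟩
  have hkm : ∀ j : Site L, (k : ℤ) = j + 1 ↔ j = km := fun j =>
    ⟨fun h => Subtype.ext (by simp only [km]; omega), fun h => by rw [h]; simp [km]⟩
  have hl : leftEnd L ≠ k := fun h => by
    rw [← h] at hk1
    simp [leftEnd] at hk1
  have hr : rightEnd L ≠ k := fun h => by
    rw [← h] at hk2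
    simp [rightEnd] at hk2
  have s1 : (∑ i : Site L, ∑ j : Site L, (if (j : ℤ) = (i : ℤ) + 1 then bond Δ i j else 0 : Op L)
      (particle k) (particle l)) =
      (if k = l then 1 else 0) - (1 / (2 * Δ) : ℂ) *
        ((if (l : ℤ) = k + 1 then 1 else 0) + (if (k : ℤ) = l + 1 then 1 else 0)) := by
    simp only [hb, Finset.sum_add_distrib]
    rw [Finset.sum_eq_single k, Finset.sum_eq_single kp]
    · simp only [if_true, hkp, hkm]
      rw [Finset.sum_eq_single km]
      · simp only [Finset.sum_ite_eq, Finset.mem_univ, if_true]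
        split_ifs <;> ring
      · intro i _ hi
        simp [hi]
      · simp
    · intro j _ hj
      simp [hkp, hj]
    · simp
    · intro i _ hi
      simp [Ne.symm hi]
    · simp
  have s2 : (∑ i : Site L, (ω i : ℂ) * numOp i (particle k) (particle l)) =
      if k = l then (ω k : ℂ) else 0 := by
    rw [Finset.sum_eq_single k]
    · rw [numOp_particle]
      by_cases h : k = l <;> simp [h]
    · intro i _ hi
      rw [numOp_particle, if_neg (fun h => hi h.2), mul_zero]
    · simp
  have s3 : numOp (leftEnd L) (particle k) (particle l) = 0 := by
    rw [numOp_particle, if_neg fun h => hl h.2]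
  have s4 : numOp (rightEnd L) (particle k) (particle l) = 0 := by
    rw [numOp_particle, if_neg fun h => hr h.2]
  simp only [hamiltonian, Matrix.add_apply, Matrix.sum_apply, Matrix.smul_apply, smul_eq_mul, s1,
    s2, s3, s4]
  by_cases h : k = l
  · rw [if_pos h, if_pos h, if_pos h]
    ring
  · rw [if_neg h, if_neg h, if_neg h]
    ring

end XXZ

/-! ### Quadratic forms, short-time phases and the weight of one-particle states in the window -/

namespace XXZ

variable {L : ℕ} {H : Op L}

theorem star_dotProduct_mulVec_sum_single {ι : Type*} [Fintype ι] (A : Op L) (g : ι → Config L) :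
    star (∑ m, (Pi.single (g m) 1 : Config L → ℂ)) ⬝ᵥ A *ᵥ (∑ m, (Pi.single (g m) 1 : Config L → ℂ)) =
      ∑ m, ∑ m', A (g m) (g m') := by
  have h : star (∑ m, (Pi.single (g m) 1 : Config L → ℂ)) = ∑ m, (Pi.single (g m) 1 : Config L → ℂ) := by
    rw [star_sum]
    refine Finset.sum_congr rfl fun m _ => ?_
    rw [← Pi.single_star, star_one]
  rw [h, Matrix.mulVec_sum, sum_dotProduct]
  refine Finset.sum_congr rfl fun m _ => ?_
  rw [dotProduct_sum]
  refine Finset.sum_congr rfl fun m' _ => ?_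
  rw [Matrix.mulVec_single_one, single_one_dotProduct]
  rfl

theorem exists_weights_apply (hH : H.IsHermitian) (σ : Config L) :
    ∃ w : Config L → ℝ, (∀ k, 0 ≤ w k) ∧
      ∀ f : ℝ → ℂ, hH.specFun f σ σ = ∑ k, f (hH.eigenvalues k) * w k := by
  obtain ⟨w, hw, h⟩ := hH.exists_weights (∑ _m : Unit, (Pi.single σ 1 : Config L → ℂ))
  refine ⟨w, hw, fun f => ?_⟩
  rw [← h f, star_dotProduct_mulVec_sum_single]
  simp

theorem specProj_apply_self_nonneg (hH : H.IsHermitian) (B : Set ℝ) (σ : Config L) :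
    0 ≤ (specProj H B σ σ).re ∧ specProj H B σ σ = ((specProj H B σ σ).re : ℂ) := by
  obtain ⟨w, hw, h⟩ := exists_weights_apply hH σ
  have e : specProj H B σ σ = ((∑ k, B.indicator (fun _ => (1 : ℝ)) (hH.eigenvalues k) * w k : ℝ) : ℂ) := by
    rw [specProj_eq hH, h]
    push_cast
    refine Finset.sum_congr rfl fun k _ => ?_
    by_cases hk : hH.eigenvalues k ∈ B <;> simp [hk]
  rw [e, Complex.ofReal_re]
  refine ⟨Finset.sum_nonneg fun k _ => mul_nonneg (Set.indicator_nonneg (fun _ _ => zero_le_one) _)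
    (hw k), rfl⟩

/-- Because `P = Pᴴ * P`, the entries of `P` are inner products of its columns, to which the
arithmetic-geometric mean inequality applies. -/
theorem re_specProj_apply_le (hH : H.IsHermitian) (B : Set ℝ) (σ τ : Config L) :
    (specProj H B σ τ).re ≤ ((specProj H B σ σ).re + (specProj H B τ τ).re) / 2 := by
  set P := specProj H B
  have hP : ∀ σ τ, P σ τ = ∑ ρ, star (P ρ σ) * P ρ τ := by
    intro σ τ
    have h : P = Pᴴ * P := by
      rw [specProj_conjTranspose hH, specProj_mul_self hH]
    conv_lhs => rw [h]
    rfl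
  have hd : ∀ σ, (P σ σ).re = ∑ ρ, ‖P ρ σ‖ ^ 2 := by
    intro σ
    rw [hP, Complex.re_sum]
    refine Finset.sum_congr rfl fun ρ _ => ?_
    rw [Complex.star_def, Complex.conj_mul', ← Complex.ofReal_pow, Complex.ofReal_re]
  rw [hd, hd, hP, Complex.re_sum, ← Finset.sum_add_distrib, Finset.sum_div]
  refine Finset.sum_le_sum fun ρ _ => (Complex.re_le_norm _).trans ?_
  rw [norm_mul, norm_star]
  nlinarith [sq_nonneg (‖P ρ σ‖ - ‖P ρ τ‖)]

/-- For short times the diagonal elements of the propagator lie in a sector. -/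
theorem windowProp_apply_self (hH : H.IsHermitian) {a b t : ℝ} (ht : 0 ≤ t) (ha : 0 ≤ a)
    (hb : t * b ≤ Real.pi / 2) (σ : Config L) :
    0 ≤ (windowProp H (Set.Icc a b) (-t) σ σ).re ∧
    (windowProp H (Set.Icc a b) (-t) σ σ).re ≤
      Real.cos (t * a) * (specProj H (Set.Icc a b) σ σ).re ∧
    (windowProp H (Set.Icc a b) (-t) σ σ).im ≤ 0 := by
  obtain ⟨w, hw, h⟩ := exists_weights_apply hH σ
  have hpi := Real.pi_pos
  rw [windowProp_eq hH, specProj_eq hH, h, h, Complex.re_sum, Complex.re_sum, Complex.im_sum]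
  have hre : ∀ x ∈ Set.Icc a b, (windowPhase (Set.Icc a b) (-t) x).re = Real.cos (t * x) ∧
      (windowPhase (Set.Icc a b) (-t) x).im = -Real.sin (t * x) := by
    intro x hx
    have : Complex.I * ((-t : ℝ) : ℂ) * x = ((-(t * x) : ℝ) : ℂ) * Complex.I := by
      push_cast
      ring
    rw [windowPhase, Set.indicator_of_mem hx, this, Complex.exp_ofReal_mul_I_re,
      Complex.exp_ofReal_mul_I_im, Real.cos_neg, Real.sin_neg]
    exact ⟨rfl, rfl⟩
  -- All angles lie in `[t a, π / 2]`, where the cosine is nonnegative and at most `cos (t a)` and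
  -- the sine is nonnegative.
  have hx : ∀ x ∈ Set.Icc a b, 0 ≤ t * x ∧ t * x ≤ Real.pi / 2 ∧ t * a ≤ t * x := fun x hx =>
    ⟨mul_nonneg ht (ha.trans hx.1), (mul_le_mul_of_nonneg_left hx.2 ht).trans hb,
      mul_le_mul_of_nonneg_left hx.1 ht⟩
  refine ⟨Finset.sum_nonneg fun k _ => ?_, ?_, Finset.sum_nonpos fun k _ => ?_⟩
  · by_cases hk : hH.eigenvalues k ∈ Set.Icc a b
    · rw [Complex.re_mul_ofReal, (hre _ hk).1]
      exact mul_nonneg (Real.cos_nonneg_of_neg_pi_div_two_le_of_le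
        (by linarith [(hx _ hk).1]) (hx _ hk).2.1) (hw k)
    · simp [windowPhase, hk]
  · rw [Finset.mul_sum]
    refine Finset.sum_le_sum fun k _ => ?_
    by_cases hk : hH.eigenvalues k ∈ Set.Icc a b
    · rw [Complex.re_mul_ofReal, (hre _ hk).1, Set.indicator_of_mem hk, one_mul, Complex.ofReal_re]
      exact mul_le_mul_of_nonneg_right (Real.cos_le_cos_of_nonneg_of_le_pi (mul_nonneg ht ha)
        (by linarith [(hx _ hk).2.1]) (hx _ hk).2.2) (hw k)
    · simp [windowPhase, hk]
  · by_cases hk : hH.eigenvalues k ∈ Set.Icc a b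
    · rw [Complex.im_mul_ofReal, (hre _ hk).2]
      exact mul_nonpos_of_nonpos_of_nonneg (neg_nonpos.2 (Real.sin_nonneg_of_nonneg_of_le_pi
        (hx _ hk).1 (by linarith [(hx _ hk).2.1]))) (hw k)
    · simp [windowPhase, hk]

/-- Counts the ordered neighbouring pairs in a stretch of `n + 1` sites, that is, the hopping energy
of the constant test vector in one direction. -/
theorem le_sum_adjacent (n : ℕ) :
    (n : ℝ) ≤ ∑ m : Fin (n + 1), ∑ m' : Fin (n + 1), if (m' : ℕ) = m + 1 then 1 else 0 := by
  rw [Fin.sum_univ_castSucc]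
  have h1 : ∀ m : Fin n, (1 : ℝ) ≤ ∑ m' : Fin (n + 1), if (m' : ℕ) = (m.castSucc : ℕ) + 1 then 1 else 0 := by
    intro m
    have := Finset.single_le_sum (f := fun m' : Fin (n + 1) =>
      if (m' : ℕ) = (m.castSucc : ℕ) + 1 then (1 : ℝ) else 0)
      (fun m' _ => by split_ifs <;> norm_num) (Finset.mem_univ m.succ)
    simpa using this
  have h2 := Finset.sum_le_sum fun m (_ : m ∈ Finset.univ) => h1 m
  have h3 : (0 : ℝ) ≤ ∑ m' : Fin (n + 1), if (m' : ℕ) = (Fin.last n : ℕ) + 1 then 1 else 0 :=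
    Finset.sum_nonneg fun m' _ => by split_ifs <;> norm_num
  simp only [Finset.sum_const, Finset.card_univ, Fintype.card_fin, nsmul_eq_mul, mul_one] at h2
  linarith

/-- A stretch of low disorder supports one-particle states in the energy window. -/
theorem half_le_sum_specProj {Δ lam β : ℝ} (hΔ : 1 < Δ) (hlam : 0 < lam)
    (hβ : 1 / 2 * (1 - 1 / Δ) ≤ β) {ω : ℤ → ℝ} (hω : ∀ i, 0 ≤ ω i) {Θ₂ ε : ℝ}
    (hΘ₂ : 1 - 1 / Δ < Θ₂) (hε : lam * ε ≤ (Θ₂ - (1 - 1 / Δ)) / 4) {n : ℕ}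
    (hn : 1 / Δ ≤ (n + 1) * ((Θ₂ - (1 - 1 / Δ)) / 4)) {p : ℤ} (f : Fin (n + 1) → Site L)
    (hf : ∀ m, (f m : ℤ) = p + m) (hp1 : -(L : ℤ) < p) (hp2 : p + n < L)
    (hωε : ∀ m, ω (f m) ≤ ε) :
    1 / 2 ≤ ∑ m, (specProj (hamiltonian Δ lam β L ω) (Set.Icc (1 - 1 / Δ) Θ₂)
      (particle (f m)) (particle (f m))).re := by
  set hH := hamiltonian_isHermitian Δ lam β L ω
  have hgap := eigenvalue_eq_zero_or_le (L := L) hΔ hlam hβ hω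
  have hground := groundProj_hamiltonian (L := L) hΔ hlam hβ hω
  have happly : ∀ m m', hamiltonian Δ lam β L ω (particle (f m)) (particle (f m')) =
      (((if m = m' then 1 + lam * ω (f m) else 0) - 1 / (2 * Δ) *
        ((if (m' : ℕ) = m + 1 then 1 else 0) + (if (m : ℕ) = m' + 1 then 1 else 0)) : ℝ) : ℂ) := by
    intro m m'
    have h1 := m.2
    have e1 : f m = f m' ↔ m = m' := by
      rw [Subtype.ext_iff, hf, hf, Fin.ext_iff]
      omega
    have e2 : ((f m' : ℤ) = f m + 1) ↔ ((m' : ℕ) = m + 1) := by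
      rw [hf, hf]
      omega
    have e3 : ((f m : ℤ) = f m' + 1) ↔ ((m : ℕ) = m' + 1) := by
      rw [hf, hf]
      omega
    rw [hamiltonian_particle Δ lam β ω (by rw [hf]; omega) (by rw [hf]; omega)]
    simp only [e1, e2, e3]
    push_cast
    split_ifs <;> simp
  -- The test vector is constant on the stretch, the unnormalized state of zero momentum; `w` is its
  -- spectral measure.
  obtain ⟨w, hw, hquad⟩ := hH.exists_weights (∑ m, (Pi.single (particle (f m)) 1 : Config L → ℂ))
  simp only [star_dotProduct_mulVec_sum_single] at hquad
  set E := hH.eigenvalues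
  set θ := 1 - 1 / Δ with hθ
  have hθ0 : 0 < θ := by
    rw [hθ, sub_pos, div_lt_one (by linarith)]
    exact hΔ
  set P := specProj (hamiltonian Δ lam β L ω) (Set.Icc θ Θ₂)
  have hfinj : ∀ m m', particle (f m) = particle (f m') ↔ m = m' := fun m m' => by
    rw [particle_injective.eq_iff, Subtype.ext_iff, hf, hf, Fin.ext_iff]
    omega
  have q1 : ∑ k, w k = n + 1 := by
    have := hquad fun _ => 1
    rw [hH.specFun_one] at this
    simp only [Matrix.one_apply, hfinj, Finset.sum_ite_eq, Finset.mem_univ, if_true, one_mul,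
      Finset.sum_const, Finset.card_univ, Fintype.card_fin, nsmul_eq_mul, mul_one] at this
    exact_mod_cast this.symm
  -- The diagonal gives at most `(n + 1) (1 + lam ε)` and the hopping `-n / Δ`. The excess `1 / Δ`
  -- over `(n + 1) (θ + lam ε)` is the price of the two ends of the stretch.
  have q2 : ∑ k, E k * w k ≤ (n + 1) * (θ + lam * ε) + 1 / Δ := by
    have h1 := hquad fun x => (x : ℂ)
    rw [hH.specFun_ofReal] at h1
    simp only [happly] at h1
    have h2 : ∑ k, E k * w k = ∑ m : Fin (n + 1), ∑ m' : Fin (n + 1),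
        ((if m = m' then 1 + lam * ω (f m) else 0) - 1 / (2 * Δ) *
        ((if (m' : ℕ) = m + 1 then 1 else 0) + (if (m : ℕ) = m' + 1 then 1 else 0))) := by
      exact_mod_cast h1.symm
    rw [h2]
    simp only [Finset.sum_sub_distrib, ← Finset.mul_sum, Finset.sum_add_distrib,
      Finset.sum_ite_eq, Finset.mem_univ, if_true, Finset.sum_const, Finset.card_univ,
      Fintype.card_fin, nsmul_eq_mul, mul_one]
    have a1 := le_sum_adjacent n
    have a2 : (n : ℝ) ≤ ∑ m : Fin (n + 1), ∑ m' : Fin (n + 1), if (m : ℕ) = m' + 1 then 1 else 0 := by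
      rw [Finset.sum_comm]
      exact a1
    have a3 : lam * ∑ m, ω (f m) ≤ (n + 1) * (lam * ε) := by
      have := Finset.sum_le_sum fun m (_ : m ∈ Finset.univ) => hωε m
      simp only [Finset.sum_const, Finset.card_univ, Fintype.card_fin, nsmul_eq_mul] at this
      push_cast at this
      calc _ ≤ lam * ((n + 1) * ε) := mul_le_mul_of_nonneg_left this hlam.le
        _ = _ := by ring
    have a4 := mul_le_mul_of_nonneg_left (add_le_add a1 a2)
      (show (0 : ℝ) ≤ 1 / (2 * Δ) by positivity)
    have a5 : 1 / (2 * Δ) * ((n : ℝ) + n) = (n + 1) * (1 / Δ) - 1 / Δ := by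
      field_simp
      ring
    push_cast
    rw [hθ]
    linarith
  -- The test vector is orthogonal to the vacuum, so its spectral measure does not charge `0`.
  have q3 : ∀ k, E k = 0 → w k = 0 := by
    have h1 := hquad (({0} : Set ℝ).indicator fun _ => 1)
    rw [← specProj_eq hH, show specProj (hamiltonian Δ lam β L ω) {0} = vac L from hground] at h1
    have h2 : ∀ m m', vac L (particle (f m)) (particle (f m')) = 0 := fun m m' => by
      rw [vac, diagProj, Matrix.diagonal_apply]
      simp [particle_ne_zero]
    simp only [h2, Finset.sum_const_zero] at h1
    have h3 : ∑ k, ({0} : Set ℝ).indicator (fun _ => (1 : ℝ)) (E k) * w k = 0 := by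
      have h4 : ((∑ k, ({0} : Set ℝ).indicator (fun _ => (1 : ℝ)) (E k) * w k : ℝ) : ℂ) = 0 := by
        rw [h1]
        push_cast
        refine Finset.sum_congr rfl fun k _ => ?_
        by_cases hk : E k = 0 <;> simp [hk, E]
      exact_mod_cast h4
    intro k hk
    have h5 := (Finset.sum_eq_zero_iff_of_nonneg fun k _ => mul_nonneg
      (Set.indicator_nonneg (fun _ _ => zero_le_one) _) (hw k)).1 h3 k (Finset.mem_univ k)
    simpa [hk] using h5
  have q4 : ∑ k, (Set.Icc θ Θ₂).indicator (fun _ => (1 : ℝ)) (E k) * w k =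
      ∑ m, ∑ m', (P (particle (f m)) (particle (f m'))).re := by
    have h1 := hquad ((Set.Icc θ Θ₂).indicator fun _ => 1)
    rw [← specProj_eq hH] at h1
    have h2 := congrArg Complex.re h1
    simp only [Complex.re_sum] at h2
    rw [h2]
    refine Finset.sum_congr rfl fun k _ => ?_
    by_cases hk : E k ∈ Set.Icc θ Θ₂ <;> simp [hk, E]
  have q5 : ∑ m, ∑ m', (P (particle (f m)) (particle (f m'))).re ≤
      (n + 1) * ∑ m, (P (particle (f m)) (particle (f m))).re := by
    have := Finset.sum_le_sum fun m (_ : m ∈ Finset.univ) =>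
      Finset.sum_le_sum fun m' (_ : m' ∈ Finset.univ) =>
        re_specProj_apply_le hH (Set.Icc θ Θ₂) (particle (f m)) (particle (f m'))
    refine this.trans (le_of_eq ?_)
    simp only [add_div, Finset.sum_add_distrib, Finset.sum_const, Finset.card_univ,
      Fintype.card_fin, nsmul_eq_mul, ← Finset.mul_sum, ← Finset.sum_div]
    push_cast
    ring
  -- Markov's inequality for the spectral measure: mass outside the window lies above `Θ₂` and costs
  -- at least `Θ₂ - θ` in energy. The two assumptions with quarters of `Θ₂ - θ` then leave at most
  -- half of the mass there.
  have q6 : (Θ₂ - θ) * (∑ k, w k - ∑ k, (Set.Icc θ Θ₂).indicator (fun _ => (1 : ℝ)) (E k) * w k) ≤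
      ∑ k, E k * w k - θ * ∑ k, w k := by
    rw [← Finset.sum_sub_distrib, Finset.mul_sum, Finset.mul_sum, ← Finset.sum_sub_distrib]
    refine Finset.sum_le_sum fun k _ => ?_
    rcases hgap k with h | h
    · rw [q3 k h]
      simp
    · by_cases hk : E k ∈ Set.Icc θ Θ₂
      · rw [Set.indicator_of_mem hk, one_mul, sub_self, mul_zero, ← sub_mul]
        exact mul_nonneg (sub_nonneg.2 h) (hw k)
      · rw [Set.indicator_of_notMem hk, zero_mul, sub_zero, ← sub_mul]
        have : Θ₂ < E k := by
          by_contra h'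
          exact hk ⟨h, not_lt.1 h'⟩
        exact mul_le_mul_of_nonneg_right (by linarith) (hw k)
  rw [q1, q4] at q6
  have hg : 0 < Θ₂ - θ := by linarith
  have hN : (0 : ℝ) < n + 1 := by positivity
  set S := ∑ m, (P (particle (f m)) (particle (f m))).re
  have q7 : (Θ₂ - θ) * ((n + 1) - (n + 1) * S) ≤ (n + 1) * ((Θ₂ - θ) / 2) := by
    have := mul_le_mul_of_nonneg_left q5 hg.le
    have h8 := mul_le_mul_of_nonneg_left hε hN.le
    nlinarith
  have q8 : ((Θ₂ - θ) * (n + 1)) * (1 - S) ≤ ((Θ₂ - θ) * (n + 1)) * (1 / 2) := by linarith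
  have q9 := le_of_mul_le_mul_left q8 (mul_pos hg hN)
  linarith

end XXZ

/-! ### Deterministic clustering estimates -/

namespace XXZ

variable {L : ℕ} {H : Op L}

/-- The points `x` and `y` cut the gap between the supports. The requirement `x < y` makes the
half-lines of `c` and `e` cover the chain, so that emptiness of both means vacuum. -/
theorem separated_centered (hH : H.IsHermitian) {B : Set ℝ} (h0 : (0 : ℝ) ∉ B)
    (hg : groundProj H = vac L) (X Y : LocalObservable L) {x y : ℤ} (hx : X.r ≤ x) (hxy : x < y)
    (hy : y ≤ Y.s) : Separated (specProj H B) (groundProj H) X.centered Y.centered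
      (occ L (Set.Iic X.r)) (occ L (Set.Ici Y.s)) (occ L (Set.Ici (x + 1))) (occ L (Set.Iic x))
      (occ L (Set.Iic (y - 1))) (occ L (Set.Ici y)) := by
  have hd : Disjoint B {0} := Set.disjoint_singleton_right.2 h0
  have hdisj : Disjoint X.supp Y.supp := by
    rw [Finset.disjoint_left]
    intro k hk hk'
    have h1 := Finset.mem_Icc.1 hk
    have h2 := Finset.mem_Icc.1 hk'
    omega
  refine
    { P_mul_P := specProj_mul_self hH B
      P₀_mul_P := specProj_mul_eq_zero hH hd.symm
      P_mul_P₀ := specProj_mul_eq_zero hH hd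
      norm_P := norm_specProj_le hH B
      norm_a := norm_occ_le _
      norm_b := norm_occ_le _
      norm_c' := norm_occ_le _
      norm_e' := norm_occ_le _
      norm_one_sub_a := norm_one_sub_occ_le _
      norm_one_sub_b := norm_one_sub_occ_le _
      norm_one_sub_c := norm_one_sub_occ_le _
      norm_one_sub_c' := norm_one_sub_occ_le _
      norm_one_sub_e := norm_one_sub_occ_le _
      norm_one_sub_e' := norm_one_sub_occ_le _
      commute_XY := X.centered_commute_centered Y hdisj
      commute_Xb := X.centered_commute_occ fun k hk hk' => ?_
      commute_Xc := X.centered_commute_occ fun k hk hk' => ?_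
      commute_Ya := Y.centered_commute_occ fun k hk hk' => ?_
      commute_Ye := Y.centered_commute_occ fun k hk hk' => ?_
      commute_ab := commute_occ _ _
      commute_ac := commute_occ _ _
      commute_ae := commute_occ _ _
      commute_bc := commute_occ _ _
      commute_be := commute_occ _ _
      commute_ce := commute_occ _ _
      vac_X := X.one_sub_occ_mul_centered_mul fun k hk => (Finset.mem_Icc.1 hk).2
      vac_Y := Y.one_sub_occ_mul_centered_mul fun k hk => (Finset.mem_Icc.1 hk).1
      vac_ce := ?_
      vac_c := ?_
      vac_e := ?_
      le_a := one_sub_occ_mul_of_subset (Set.Iic_subset_Iic.2 hx)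
      le_b := ?_
      a_mul_P₀ := hg ▸ occ_mul_vac _
      P₀_mul_a := hg ▸ vac_mul_occ _
      b_mul_P₀ := hg ▸ occ_mul_vac _
      P₀_mul_b := hg ▸ vac_mul_occ _ }
  · have h1 := Finset.mem_Icc.1 hk'
    rw [Set.mem_Ici] at hk
    omega
  · have h1 := Finset.mem_Icc.1 hk'
    rw [Set.mem_Ici] at hk
    omega
  · have h1 := Finset.mem_Icc.1 hk'
    rw [Set.mem_Iic] at hk
    omega
  · have h1 := Finset.mem_Icc.1 hk'
    rw [Set.mem_Iic] at hk
    omega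
  · rw [hg]
    refine one_sub_occ_mul_one_sub_occ (Set.eq_univ_of_forall fun k => ?_)
    rw [Set.mem_union, Set.mem_Ici, Set.mem_Iic]
    omega
  · rw [hg]
    refine one_sub_occ_mul_one_sub_occ (Set.eq_univ_of_forall fun k => ?_)
    rw [Set.mem_union, Set.mem_Ici, Set.mem_Iic]
    omega
  · rw [hg]
    refine one_sub_occ_mul_one_sub_occ (Set.eq_univ_of_forall fun k => ?_)
    rw [Set.mem_union, Set.mem_Ici, Set.mem_Iic]
    omega
  · conv_rhs => rw [← one_sub_occ_mul_of_subset (Set.Ici_subset_Ici.2 hy)]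
    exact ((Commute.one_left _).sub_left ((Commute.one_right _).sub_right (commute_occ _ _))).eq

theorem norm_occ_mul_occ_mul_specProj (hH : H.IsHermitian) (B : Set ℝ) (A A' : Set ℤ) :
    ‖occ L A * occ L A' * specProj H B‖ = ‖specProj H B * (occ L A * occ L A')‖ := by
  rw [← Matrix.l2_opNorm_conjTranspose, Matrix.conjTranspose_mul, Matrix.conjTranspose_mul,
    specProj_conjTranspose hH, occ_conjTranspose, occ_conjTranspose, (commute_occ A' A).eq]

/-- Taking adjoints reverses both the order of the half-lines and time; a bound for all times thus
covers both orders. -/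
theorem norm_occ_mul_windowProp_mul_occ (hH : H.IsHermitian) (B : Set ℝ) (A A' : Set ℤ) (t : ℝ) :
    ‖occ L A * windowProp H B t * occ L A'‖ = ‖occ L A' * windowProp H B (-t) * occ L A‖ := by
  rw [← Matrix.l2_opNorm_conjTranspose, Matrix.conjTranspose_mul, Matrix.conjTranspose_mul,
    windowProp_conjTranspose hH, occ_conjTranspose, occ_conjTranspose, mul_assoc]

/-- The weight of pairs of far apart particles in the energy window. -/
theorem norm_specProj_mul_occ_mul_occ_sq_le (hH : H.IsHermitian) (B : Set ℝ) (A A' : Set ℤ) :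
    ‖specProj H B * (occ L A * occ L A')‖ ^ 2 ≤ ‖occ L A * specProj H B * occ L A'‖ := by
  set P := specProj H B
  -- By the C*-identity the squared norm is the norm of `TᴴT`; there `P * P = P` leaves the kernel
  -- of `P` between the two sets.
  have h1 : (P * (occ L A * occ L A'))ᴴ * (P * (occ L A * occ L A')) =
      occ L A' * (occ L A * P * occ L A') * occ L A := by
    rw [Matrix.conjTranspose_mul, Matrix.conjTranspose_mul, specProj_conjTranspose hH,
      occ_conjTranspose, occ_conjTranspose, (commute_occ A A').eq]
    calc occ L A' * occ L A * P * (P * (occ L A' * occ L A))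
        = occ L A' * occ L A * (P * P) * (occ L A' * occ L A) := by noncomm_ring
      _ = _ := by rw [specProj_mul_self hH]; noncomm_ring
  rw [sq, ← Matrix.l2_opNorm_conjTranspose_mul_self, h1]
  have := norm_mul_le_of_le (norm_mul_le_of_le (norm_occ_le (L := L) A')
    (le_refl ‖occ L A * P * occ L A'‖)) (norm_occ_le (L := L) A)
  simpa using this

/-- The quantity controlling the clustering of observables supported in `(-∞, r]` and `[s, ∞)`. -/
noncomputable def clusterError (H : Op L) (B : Set ℝ) (r s x y : ℤ) (S : ℝ) : ℝ :=
  ‖specProj H B * (occ L (Set.Iic r) * occ L (Set.Ici s))‖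
    + ‖specProj H B * (occ L (Set.Iic r) * occ L (Set.Ici (x + 1)))‖
    + ‖specProj H B * (occ L (Set.Iic (y - 1)) * occ L (Set.Ici s))‖ + S

/-- By adjoints all the norms in the algebraic bound reduce to three pair weights and the
localization term `S`. Their total coefficients are `4`, `3`, `3` and `1`, whence the factor `4`. -/
theorem norm_clusterDefect_centered_le (hH : H.IsHermitian) {B : Set ℝ} (h0 : (0 : ℝ) ∉ B)
    (hg : groundProj H = vac L) (X Y : LocalObservable L) {x y : ℤ} (hx : X.r ≤ x) (hxy : x < y)
    (hy : y ≤ Y.s) {S : ℝ}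
    (hS : ∀ t, ‖occ L (Set.Iic x) * windowProp H B t * occ L (Set.Ici y)‖ ≤ S) :
    ‖clusterDefect (specProj H B) (groundProj H) X.centered Y.centered‖ ≤
        ‖X.centered‖ * ‖Y.centered‖ * (4 * clusterError H B X.r Y.s x y S) ∧
    ‖clusterDefect (specProj H B) (groundProj H) Y.centered X.centered‖ ≤
        ‖X.centered‖ * ‖Y.centered‖ * (4 * clusterError H B X.r Y.s x y S) ∧
    ∀ t, ‖specProj H B * X.centered * windowProp H B t * Y.centered * specProj H B‖ ≤
        ‖X.centered‖ * ‖Y.centered‖ * clusterError H B X.r Y.s x y S ∧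
      ‖specProj H B * Y.centered * windowProp H B t * X.centered * specProj H B‖ ≤
        ‖X.centered‖ * ‖Y.centered‖ * clusterError H B X.r Y.s x y S := by
  have hsep := separated_centered hH h0 hg X Y hx hxy hy
  have hsep' := hsep.swap (commute_occ _ _) (commute_occ _ _) (commute_occ _ _) (commute_occ _ _)
  have hS0 : ‖occ L (Set.Iic x) * specProj H B * occ L (Set.Ici y)‖ ≤ S := by
    simpa [windowProp_zero] using hS 0
  have hS0' : ‖occ L (Set.Ici y) * specProj H B * occ L (Set.Iic x)‖ ≤ S := by
    have := norm_occ_mul_windowProp_mul_occ hH B (Set.Ici y) (Set.Iic x) 0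
    rw [neg_zero, windowProp_zero] at this
    exact this.trans_le hS0
  have n1 := norm_occ_mul_occ_mul_specProj hH B (Set.Iic X.r) (Set.Ici Y.s)
  have n2 := norm_occ_mul_occ_mul_specProj hH B (Set.Iic X.r) (Set.Ici (x + 1))
  have n3 := norm_occ_mul_occ_mul_specProj hH B (Set.Iic (y - 1)) (Set.Ici Y.s)
  have c1 := (commute_occ (L := L) (Set.Ici Y.s) (Set.Iic X.r)).eq
  have c2 := (commute_occ (L := L) (Set.Ici (x + 1)) (Set.Iic X.r)).eq
  have c3 := (commute_occ (L := L) (Set.Ici Y.s) (Set.Iic (y - 1))).eq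
  have p1 := norm_nonneg (specProj H B * (occ L (Set.Iic X.r) * occ L (Set.Ici Y.s)))
  have p2 := norm_nonneg (specProj H B * (occ L (Set.Iic X.r) * occ L (Set.Ici (x + 1))))
  have p3 := norm_nonneg (specProj H B * (occ L (Set.Iic (y - 1)) * occ L (Set.Ici Y.s)))
  have p4 := (norm_nonneg _).trans hS0
  have hnn := mul_nonneg (norm_nonneg X.centered) (norm_nonneg Y.centered)
  refine ⟨?_, ?_, fun t => ⟨?_, ?_⟩⟩
  · refine (hsep.norm_clusterDefect_le hsep').trans (mul_le_mul_of_nonneg_left ?_ hnn)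
    rw [c2, c3, n1, n2, n3, clusterError]
    linarith
  · refine (hsep'.norm_clusterDefect_le hsep).trans ?_
    rw [mul_comm ‖Y.centered‖]
    refine mul_le_mul_of_nonneg_left ?_ hnn
    rw [c1, c2, c3, n1, n2, n3, clusterError]
    linarith
  · refine (hsep.norm_window_mul_window_le (specProj_mul_windowProp hH B t)
      (windowProp_mul_specProj hH B t) (norm_windowProp_le hH B t)).trans
      (mul_le_mul_of_nonneg_left ?_ hnn)
    have := hS t
    rw [n3, clusterError]
    linarith
  · refine (hsep'.norm_window_mul_window_le (specProj_mul_windowProp hH B t)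
      (windowProp_mul_specProj hH B t) (norm_windowProp_le hH B t)).trans ?_
    rw [mul_comm ‖Y.centered‖]
    refine mul_le_mul_of_nonneg_left ?_ hnn
    have := hS (-t)
    rw [c2, c3, n2, norm_occ_mul_windowProp_mul_occ hH, clusterError]
    linarith

theorem norm_corr_sub_counterterm_le (hH : H.IsHermitian) {B : Set ℝ} (h0 : (0 : ℝ) ∉ B) (t : ℝ)
    (X Y : Op L) : ‖corr H B (evol H B t X) Y - counterterm H B t X Y‖ ≤
      ‖clusterDefect (specProj H B) (groundProj H) X Y‖ := by
  rw [corr_sub_counterterm hH h0]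
  have := norm_mul_le_of_le (norm_propagator_le hH B t)
    (le_refl ‖clusterDefect (specProj H B) (groundProj H) X Y‖)
  simpa using this

theorem norm_window_correctedComm_le (hH : H.IsHermitian) {B : Set ℝ} (h0 : (0 : ℝ) ∉ B) (t : ℝ)
    (X Y : Op L) : ‖window H B (correctedComm H B t X Y)‖ ≤
      ‖clusterDefect (specProj H B) (groundProj H) X Y‖
        + ‖clusterDefect (specProj H B) (groundProj H) Y X‖ + ‖windowComm H B t X Y‖ := by
  rw [window_correctedComm hH h0]
  have h1 := norm_mul_le_of_le (norm_propagator_le hH B t)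
    (le_refl ‖clusterDefect (specProj H B) (groundProj H) X Y‖)
  have h2 := norm_mul_le_of_le (le_refl ‖clusterDefect (specProj H B) (groundProj H) Y X‖)
    (norm_propagator_le hH B (-t))
  refine (norm_add_le_of_le (norm_sub_le_of_le h1 h2) le_rfl).trans ?_
  linarith

theorem norm_windowComm_le (hH : H.IsHermitian) (B : Set ℝ) (t : ℝ) (X Y : Op L) :
    ‖windowComm H B t X Y‖ ≤ ‖specProj H B * X * windowProp H B (-t) * Y * specProj H B‖
      + ‖specProj H B * Y * windowProp H B t * X * specProj H B‖ := by
  rw [windowComm]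
  have h1 := norm_mul_le_of_le (norm_propagator_le hH B t)
    (le_refl ‖specProj H B * X * windowProp H B (-t) * Y * specProj H B‖)
  have h2 := norm_mul_le_of_le (le_refl ‖specProj H B * Y * windowProp H B t * X * specProj H B‖)
    (norm_propagator_le hH B (-t))
  refine (norm_sub_le_of_le h1 h2).trans ?_
  linarith

/-- Clustering for observables with separated supports, in either order. -/
theorem norm_cluster_le (hH : H.IsHermitian) {B : Set ℝ} (h0 : (0 : ℝ) ∉ B)
    (hg : groundProj H = vac L) (X Y : LocalObservable L) {x y : ℤ} (hx : X.r ≤ x) (hxy : x < y)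
    (hy : y ≤ Y.s) {S : ℝ}
    (hS : ∀ t, ‖occ L (Set.Iic x) * windowProp H B t * occ L (Set.Ici y)‖ ≤ S) (t : ℝ) :
    ‖corr H B (evol H B t X.op) Y.op - counterterm H B t X.op Y.op‖ ≤
      40 * ‖X.op‖ * ‖Y.op‖ * clusterError H B X.r Y.s x y S ∧
    ‖window H B (correctedComm H B t X.op Y.op)‖ ≤
      40 * ‖X.op‖ * ‖Y.op‖ * clusterError H B X.r Y.s x y S ∧
    ‖corr H B (evol H B t Y.op) X.op - counterterm H B t Y.op X.op‖ ≤
      40 * ‖X.op‖ * ‖Y.op‖ * clusterError H B X.r Y.s x y S ∧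
    ‖window H B (correctedComm H B t Y.op X.op)‖ ≤
      40 * ‖X.op‖ * ‖Y.op‖ * clusterError H B X.r Y.s x y S := by
  have hd : Disjoint B {0} := Set.disjoint_singleton_right.2 h0
  obtain ⟨b1, b2, b3⟩ := norm_clusterDefect_centered_le hH h0 hg X Y hx hxy hy hS
  have e1 : ∀ Z W : LocalObservable L,
      clusterDefect (specProj H B) (groundProj H) Z.centered W.centered =
      clusterDefect (specProj H B) (groundProj H) Z.op W.op := fun Z W =>
    clusterDefect_sub_smul_one (specProj_mul_self hH B) (specProj_mul_eq_zero hH hd)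
      (specProj_mul_eq_zero hH hd.symm) _ _ _ _
  have e2 : ∀ Z W : LocalObservable L,
      windowComm H B t Z.centered W.centered = windowComm H B t Z.op W.op := fun Z W =>
    windowComm_sub_smul_one hH B t _ _ _ _
  rw [e1] at b1 b2
  have hE : 0 ≤ clusterError H B X.r Y.s x y S := by
    have := (norm_nonneg _).trans (hS 0)
    exact add_nonneg (add_nonneg (add_nonneg (norm_nonneg _) (norm_nonneg _)) (norm_nonneg _)) this
  have hXY : ‖X.centered‖ * ‖Y.centered‖ ≤ 4 * ‖X.op‖ * ‖Y.op‖ :=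
    (mul_le_mul X.norm_centered_le Y.norm_centered_le (norm_nonneg _)
      (mul_nonneg zero_le_two (norm_nonneg _))).trans (by linarith)
  have hmul := mul_le_mul_of_nonneg_right hXY hE
  have w1 := norm_windowComm_le hH B t X.centered Y.centered
  have w2 := norm_windowComm_le hH B t Y.centered X.centered
  rw [e2] at w1 w2
  have t1 := b3 t
  have t2 := b3 (-t)
  have hpos : 0 ≤ ‖X.op‖ * ‖Y.op‖ * clusterError H B X.r Y.s x y S :=
    mul_nonneg (mul_nonneg (norm_nonneg _) (norm_nonneg _)) hE
  -- The constant is `40 = 4 * (4 + 4 + 1 + 1)`: centring costs `4`, each defect `4`, and each half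
  -- of `windowComm` `1`.
  refine ⟨(norm_corr_sub_counterterm_le hH h0 t _ _).trans ?_,
    (norm_window_correctedComm_le hH h0 t _ _).trans ?_,
    (norm_corr_sub_counterterm_le hH h0 t _ _).trans ?_,
    (norm_window_correctedComm_le hH h0 t _ _).trans ?_⟩
  · linarith
  · linarith [t1.2, t2.1]
  · linarith
  · linarith [t1.1, t2.2]

theorem norm_window_mul_le {P Q X Y : Op L} (hP : ‖P‖ ≤ 1) (hQ : ‖Q‖ ≤ 1) :
    ‖P * X * Q * Y * P‖ ≤ ‖X‖ * ‖Y‖ := by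
  have := norm_mul_le_of_le (norm_mul_le_of_le (norm_mul_le_of_le (norm_mul_le_of_le hP
    (le_refl ‖X‖)) hQ) (le_refl ‖Y‖)) hP
  simpa using this

/-- The bounds which hold without any assumption on the supports. -/
theorem norm_cluster_le_of_overlap (hH : H.IsHermitian) {B : Set ℝ} (h0 : (0 : ℝ) ∉ B)
    (X Y : Op L) (t : ℝ) :
    ‖corr H B (evol H B t X) Y - counterterm H B t X Y‖ ≤ 8 * ‖X‖ * ‖Y‖ ∧
    ‖window H B (correctedComm H B t X Y)‖ ≤ 8 * ‖X‖ * ‖Y‖ := by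
  have hP := norm_specProj_le hH B
  have hP' : ‖1 - specProj H B‖ ≤ 1 := by
    rw [one_sub_specProj hH]
    exact norm_specProj_le hH _
  have hP₀ : ‖groundProj H‖ ≤ 1 := norm_specProj_le hH _
  have hd : ∀ Z W : Op L, ‖clusterDefect (specProj H B) (groundProj H) Z W‖ ≤ 3 * (‖Z‖ * ‖W‖) := by
    intro Z W
    refine (norm_sub_le_of_le (norm_sub_le_of_le (norm_window_mul_le hP hP')
      (norm_window_mul_le hP hP₀)) (norm_window_mul_le hP hP₀)).trans ?_
    linarith
  have hw := (norm_windowComm_le hH B t X Y).trans (add_le_add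
    (norm_window_mul_le hP (norm_windowProp_le hH B (-t)))
    (norm_window_mul_le hP (norm_windowProp_le hH B t)))
  have hnn := mul_nonneg (norm_nonneg X) (norm_nonneg Y)
  refine ⟨(norm_corr_sub_counterterm_le hH h0 t _ _).trans ?_,
    (norm_window_correctedComm_le hH h0 t _ _).trans ?_⟩
  · linarith [hd X Y]
  · linarith [hd X Y, hd Y X]

end XXZ

/-! ### Measurability in the disorder -/

namespace XXZ

variable {L : ℕ}

theorem continuous_hamiltonian (Δ lam β : ℝ) (L : ℕ) :
    Continuous fun ω : ℤ → ℝ => hamiltonian Δ lam β L ω := by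
  unfold hamiltonian
  fun_prop

theorem continuous_cfc_of_isHermitian {Ω : Type*} [TopologicalSpace Ω] {A : Ω → Op L}
    (hA : Continuous A) (hh : ∀ ω, (A ω).IsHermitian) {f : ℝ → ℝ} (hf : Continuous f) :
    Continuous fun ω => cfc f (A ω) :=
  hA.cfc_of_mem_nhdsSet f Filter.univ_mem (fun ω => (hh ω).isSelfAdjoint) hf.continuousOn

/-- A matrix has finitely many eigenvalues, so pointwise convergence of the functions suffices. -/
theorem tendsto_cfc_of_isHermitian {A : Op L} (hA : A.IsHermitian) {f : ℕ → ℝ → ℝ} {g : ℝ → ℝ}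
    (h : ∀ x, Filter.Tendsto (fun n => f n x) Filter.atTop (nhds (g x))) :
    Filter.Tendsto (fun n => cfc (f n) A) Filter.atTop (nhds (cfc g A)) := by
  have hc : Continuous fun d : Config L → ℂ =>
      Unitary.conjStarAlgAut ℂ _ hA.eigenvectorUnitary (Matrix.diagonal d) := by
    simp only [Unitary.conjStarAlgAut_apply]
    exact (continuous_const.mul continuous_id.matrix_diagonal).mul continuous_const
  simp only [hA.cfc_eq_specFun, Matrix.IsHermitian.specFun]
  refine (hc.tendsto _).comp (tendsto_pi_nhds.2 fun k => ?_)
  exact (Complex.continuous_ofReal.tendsto _).comp (h _)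

/-- Continuous functions decreasing to the indicator function of `[a, b]`. -/
noncomputable def hat (a b : ℝ) (n : ℕ) (x : ℝ) : ℝ := max 0 (1 - n * (max (a - x) 0 + max (x - b) 0))

theorem tendsto_hat (a b x : ℝ) : Filter.Tendsto (fun n => hat a b n x) Filter.atTop
    (nhds ((Set.Icc a b).indicator (fun _ => 1) x)) := by
  by_cases hx : x ∈ Set.Icc a b
  · have h1 : max (a - x) 0 = 0 := max_eq_right (by linarith [hx.1])
    have h2 : max (x - b) 0 = 0 := max_eq_right (by linarith [hx.2])
    simp [hat, hx, h1, h2]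
  · rw [Set.indicator_of_notMem hx]
    have hpos : 0 < max (a - x) 0 + max (x - b) 0 := by
      by_contra h
      have h1 := le_max_right (a - x) 0
      have h2 := le_max_right (x - b) 0
      have h3 := le_max_left (a - x) 0
      have h4 := le_max_left (x - b) 0
      exact hx ⟨by linarith, by linarith⟩
    obtain ⟨N, hN⟩ := exists_nat_gt (1 / (max (a - x) 0 + max (x - b) 0))
    refine tendsto_const_nhds.congr' ?_
    filter_upwards [Filter.eventually_ge_atTop N] with n hn
    have h5 : 1 < (N : ℝ) * (max (a - x) 0 + max (x - b) 0) := by rwa [div_lt_iff₀ hpos] at hN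
    have h6 : (N : ℝ) * (max (a - x) 0 + max (x - b) 0) ≤ n * (max (a - x) 0 + max (x - b) 0) :=
      mul_le_mul_of_nonneg_right (by exact_mod_cast hn) hpos.le
    rw [hat, max_eq_left (by linarith)]

/-- Spectral projections are not continuous in `ω`, but they are pointwise limits of continuous
functions of the Hamiltonian. -/
theorem stronglyMeasurable_specProj {Δ lam β : ℝ} (L : ℕ) (a b : ℝ) :
    StronglyMeasurable fun ω : ℤ → ℝ => specProj (hamiltonian Δ lam β L ω) (Set.Icc a b) := by
  refine stronglyMeasurable_of_tendsto (f := fun n ω => cfc (hat a b n) (hamiltonian Δ lam β L ω))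
    Filter.atTop (fun n => ?_) ?_
  · refine Continuous.stronglyMeasurable (continuous_cfc_of_isHermitian
      (continuous_hamiltonian Δ lam β L) (fun ω => hamiltonian_isHermitian Δ lam β L ω) ?_)
    unfold hat
    fun_prop
  · exact tendsto_pi_nhds.2 fun ω =>
      tendsto_cfc_of_isHermitian (hamiltonian_isHermitian Δ lam β L ω) fun x => tendsto_hat a b x

theorem continuous_exp_op : Continuous (NormedSpace.exp : Op L → Op L) :=
  letI := NormedAlgebra.restrictScalars ℚ ℂ (Op L)
  NormedSpace.exp_continuous

theorem stronglyMeasurable_propagator {Δ lam β : ℝ} (L : ℕ) (a b t : ℝ) :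
    StronglyMeasurable fun ω : ℤ → ℝ => propagator (hamiltonian Δ lam β L ω) (Set.Icc a b) t :=
  continuous_exp_op.comp_stronglyMeasurable (StronglyMeasurable.const_smul
    ((stronglyMeasurable_specProj L a b).mul
      (continuous_hamiltonian Δ lam β L).stronglyMeasurable) (Complex.I * (t : ℂ)))

theorem stronglyMeasurable_windowProp {Δ lam β : ℝ} (L : ℕ) (a b t : ℝ) :
    StronglyMeasurable fun ω : ℤ → ℝ => windowProp (hamiltonian Δ lam β L ω) (Set.Icc a b) t :=
  (stronglyMeasurable_specProj L a b).mul (stronglyMeasurable_propagator L a b t)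

theorem continuous_windowProp (H : Op L) (B : Set ℝ) : Continuous fun t => windowProp H B t :=
  continuous_const.mul (continuous_exp_op.comp (by fun_prop))

/-! ### Summing the localization bounds -/

/-- Configurations with `p` are split into those with `q` and those with `r` but not `q`. This is
the induction step of a union bound over sites. -/
theorem norm_diagProj_mul_le {p q r : Config L → Prop} (h : ∀ σ, p σ → q σ ∨ r σ) (T : Op L) :
    ‖diagProj p * T‖ ≤ ‖diagProj q * T‖ + ‖diagProj r * T‖ := by
  classical
  have e : diagProj p = diagProj p * diagProj q + diagProj (fun σ => p σ ∧ ¬ q σ) * diagProj r := by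
    rw [diagProj_mul, diagProj_mul, diagProj, diagProj, diagProj, Matrix.diagonal_add]
    congr 1
    ext σ
    have := h σ
    by_cases hp : p σ <;> by_cases hq : q σ <;> by_cases hr : r σ <;> simp_all
  rw [e, add_mul, mul_assoc, mul_assoc]
  have h1 := norm_mul_le_of_le (norm_diagProj_le p) (le_refl ‖diagProj q * T‖)
  have h2 := norm_mul_le_of_le (norm_diagProj_le fun σ => p σ ∧ ¬ q σ) (le_refl ‖diagProj r * T‖)
  exact (norm_add_le_of_le h1 h2).trans (by linarith)

open Classical in
theorem norm_occ_mul_le (A : Set ℤ) (T : Op L) :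
    ‖occ L A * T‖ ≤ ∑ i : Site L, if (i : ℤ) ∈ A then ‖numOp i * T‖ else 0 := by
  have key : ∀ s : Finset (Site L), ‖diagProj (fun σ => ∃ k ∈ s, (k : ℤ) ∈ A ∧ σ k = 1) * T‖ ≤
      ∑ i ∈ s, if (i : ℤ) ∈ A then ‖numOp i * T‖ else 0 := by
    intro s
    induction s using Finset.induction_on with
    | empty => simp [diagProj]
    | insert i s hi ih =>
      rw [Finset.sum_insert hi]
      refine (norm_diagProj_mul_le (q := fun σ => (i : ℤ) ∈ A ∧ σ i = 1)
        (r := fun σ => ∃ k ∈ s, (k : ℤ) ∈ A ∧ σ k = 1) ?_ T).trans (add_le_add ?_ ih)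
      · rintro σ ⟨k, hk, h⟩
        rcases Finset.mem_insert.1 hk with rfl | hk
        · exact Or.inl h
        · exact Or.inr ⟨k, hk, h⟩
      · by_cases hA : (i : ℤ) ∈ A
        · simp [hA, numOp_eq_diagProj]
        · simp [hA, diagProj]
  simpa [occ] using key Finset.univ

open Classical in
theorem norm_mul_occ_le (A : Set ℤ) (T : Op L) :
    ‖T * occ L A‖ ≤ ∑ i : Site L, if (i : ℤ) ∈ A then ‖T * numOp i‖ else 0 := by
  rw [← Matrix.l2_opNorm_conjTranspose, Matrix.conjTranspose_mul, occ_conjTranspose]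
  refine (norm_occ_mul_le A Tᴴ).trans (le_of_eq ?_)
  refine Finset.sum_congr rfl fun i _ => ?_
  rw [← Matrix.l2_opNorm_conjTranspose (T * numOp i), Matrix.conjTranspose_mul,
    (numOp_isHermitian i).eq]

open Classical in
theorem norm_occ_mul_mul_occ_le (A A' : Set ℤ) (T : Op L) :
    ‖occ L A * T * occ L A'‖ ≤ ∑ i : Site L, ∑ j : Site L,
      if (i : ℤ) ∈ A ∧ (j : ℤ) ∈ A' then ‖numOp i * T * numOp j‖ else 0 := by
  rw [mul_assoc]
  refine (norm_occ_mul_le A _).trans (Finset.sum_le_sum fun i _ => ?_)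
  split_ifs with hi
  · rw [← mul_assoc]
    refine (norm_mul_occ_le A' _).trans (Finset.sum_le_sum fun j _ => ?_)
    simp [hi]
  · exact Finset.sum_nonneg fun j _ => by split_ifs <;> positivity

theorem enorm_occ_mul_mul_occ_le (x y : ℤ) (T : Op L) :
    ‖occ L (Set.Iic x) * T * occ L (Set.Ici y)‖ₑ ≤ ∑ i : Site L, ∑ j : Site L,
      if (i : ℤ) ≤ x ∧ y ≤ (j : ℤ) then ‖numOp i * T * numOp j‖ₑ else 0 := by
  have h := norm_occ_mul_mul_occ_le (Set.Iic x) (Set.Ici y) T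
  rw [← ofReal_norm]
  refine (ENNReal.ofReal_le_ofReal h).trans (le_of_eq ?_)
  rw [ENNReal.ofReal_sum_of_nonneg fun i _ => Finset.sum_nonneg fun j _ => by
    split_ifs <;> positivity]
  refine Finset.sum_congr rfl fun i _ => ?_
  rw [ENNReal.ofReal_sum_of_nonneg fun j _ => by split_ifs <;> positivity]
  refine Finset.sum_congr rfl fun j _ => ?_
  simp only [Set.mem_Iic, Set.mem_Ici]
  split_ifs
  · rw [ofReal_norm]
  · simp

/-- Injectivity of `g` makes the exponents distinct natural numbers, so the sum is part of a
geometric series; the bound does not depend on `L`. -/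
theorem sum_exp_le {m : ℝ} (hm : 0 < m) (g : Site L → ℤ) (hg : Function.Injective g) :
    (∑ i : Site L, if 0 ≤ g i then Real.exp (-m * g i) else 0) ≤ (1 - Real.exp (-m))⁻¹ := by
  have h1 : Real.exp (-m) < 1 := Real.exp_lt_one_iff.2 (by linarith)
  have hs := hasSum_geometric_of_lt_one (Real.exp_pos (-m)).le h1
  rw [← Finset.sum_filter]
  have e : ∑ i with 0 ≤ g i, Real.exp (-m * g i) =
      ∑ n ∈ (Finset.univ.filter fun i => 0 ≤ g i).image fun i => (g i).toNat, Real.exp (-m) ^ n := by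
    rw [Finset.sum_image]
    · refine Finset.sum_congr rfl fun i hi => ?_
      have hi' := (Finset.mem_filter.1 hi).2
      rw [← Real.exp_nat_mul]
      congr 1
      have : ((g i).toNat : ℝ) = g i := by
        exact_mod_cast Int.toNat_of_nonneg hi'
      rw [this]
      ring
    · intro i hi j hj h
      have hi' := (Finset.mem_filter.1 hi).2
      have hj' := (Finset.mem_filter.1 hj).2
      have h' : (g i).toNat = (g j).toNat := h
      exact hg (by omega)
  rw [e]
  exact sum_le_hasSum _ (fun n _ => by positivity) hs

/-- For `i ≤ x ≤ y ≤ j` the distance from `i` to `j` is `(x - i) + (j - y) + (y - x)`, and the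
double sum factorizes. -/
theorem sum_sum_exp_le {m : ℝ} (hm : 0 < m) {x y : ℤ} (hxy : x ≤ y) :
    (∑ i : Site L, ∑ j : Site L, if (i : ℤ) ≤ x ∧ y ≤ (j : ℤ) then
      Real.exp (-m * |((i : ℤ) : ℝ) - ((j : ℤ) : ℝ)|) else 0) ≤
      (1 - Real.exp (-m))⁻¹ * (1 - Real.exp (-m))⁻¹ * Real.exp (-m * ((y : ℝ) - x)) := by
  have hx := sum_exp_le hm (fun i : Site L => x - (i : ℤ)) fun i j h => Subtype.ext (by
    simp only at h; omega)
  have hy := sum_exp_le hm (fun j : Site L => (j : ℤ) - y) fun i j h => Subtype.ext (by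
    simp only at h; omega)
  have hnn : ∀ g : Site L → ℤ, 0 ≤ ∑ i : Site L, if 0 ≤ g i then Real.exp (-m * g i) else 0 :=
    fun g => Finset.sum_nonneg fun i _ => by split_ifs <;> positivity
  have hprod := mul_le_mul_of_nonneg_right (mul_le_mul hx hy (hnn _) ((hnn _).trans hx))
    (Real.exp_pos (-m * ((y : ℝ) - x))).le
  refine le_trans (le_of_eq ?_) hprod
  rw [Finset.sum_mul_sum, Finset.sum_mul]
  refine Finset.sum_congr rfl fun i _ => ?_
  rw [Finset.sum_mul]
  refine Finset.sum_congr rfl fun j _ => ?_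
  by_cases hi : (i : ℤ) ≤ x
  · by_cases hj : y ≤ (j : ℤ)
    · have h1 : ((i : ℤ) : ℝ) ≤ x := by exact_mod_cast hi
      have h2 : (y : ℝ) ≤ ((j : ℤ) : ℝ) := by exact_mod_cast hj
      have h3 : (x : ℝ) ≤ y := by exact_mod_cast hxy
      rw [if_pos ⟨hi, hj⟩, if_pos (by omega), if_pos (by omega), ← Real.exp_add, ← Real.exp_add,
        abs_of_nonpos (by linarith)]
      congr 1
      push_cast
      ring
    · rw [if_neg (fun h => hj h.2), if_neg (show ¬ 0 ≤ (j : ℤ) - y by omega), mul_zero, zero_mul]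
  · rw [if_neg (fun h => hi h.1), if_neg (show ¬ 0 ≤ x - (i : ℤ) by omega), zero_mul, zero_mul]

/-- Localization between two half-lines, uniformly in time. -/
theorem lintegral_iSup_enorm_occ_le {M : DisorderedChain} {C m Θ₁ Θ₂ : ℝ} (hC : 0 ≤ C)
    (hm : 0 < m) (hΘ : Θ₂ ≤ Θ₁)
    (hDL : ∀ (L : ℕ) (i j : Site L), M.expect (fun ω => ⨆ g ∈ G (Set.Icc M.Θ₀ Θ₁),
      ENNReal.ofReal (traceNorm (numOp i * funCalc g (M.H L ω) * numOp j)))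
      ≤ ENNReal.ofReal (C * Real.exp (-m * |((i : ℤ) : ℝ) - ((j : ℤ) : ℝ)|)))
    (L : ℕ) {x y : ℤ} (hxy : x ≤ y) :
    ∫⁻ ω, ⨆ q : ℚ, ‖occ L (Set.Iic x) * windowProp (M.H L ω) (Set.Icc M.Θ₀ Θ₂) q *
        occ L (Set.Ici y)‖ₑ ∂M.law ≤
      ENNReal.ofReal (C * ((1 - Real.exp (-m))⁻¹ * (1 - Real.exp (-m))⁻¹) *
        Real.exp (-m * ((y : ℝ) - x))) := by
  -- Rational times keep the supremum countable, hence measurable, so that integrals and finite sums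
  -- may be exchanged.
  have hmeas : ∀ (i j : Site L) (q : ℚ), Measurable fun ω =>
      ‖numOp i * windowProp (M.H L ω) (Set.Icc M.Θ₀ Θ₂) q * numOp j‖ₑ := fun i j q =>
    (((stronglyMeasurable_const (b := numOp i)).mul (stronglyMeasurable_windowProp L _ _ _)).mul
      stronglyMeasurable_const).enorm
  have hbase : ∀ i j : Site L, ∫⁻ ω, ⨆ q : ℚ,
      ‖numOp i * windowProp (M.H L ω) (Set.Icc M.Θ₀ Θ₂) q * numOp j‖ₑ ∂M.law ≤
      ENNReal.ofReal (C * Real.exp (-m * |((i : ℤ) : ℝ) - ((j : ℤ) : ℝ)|)) := by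
    intro i j
    refine (lintegral_mono fun ω => iSup_le fun q => ?_).trans (hDL L i j)
    have hH : (M.H L ω).IsHermitian := hamiltonian_isHermitian _ _ _ _ _
    refine le_trans ?_ (le_iSup₂ (windowPhase (Set.Icc M.Θ₀ Θ₂) q)
      (windowPhase_mem_G measurableSet_Icc (Set.Icc_subset_Icc_right hΘ) q))
    rw [funCalc_eq hH, ← windowProp_eq hH, ← ofReal_norm]
    exact ENNReal.ofReal_le_ofReal (norm_le_traceNorm _)
  calc _ ≤ ∫⁻ ω, ∑ i : Site L, ∑ j : Site L, (if (i : ℤ) ≤ x ∧ y ≤ (j : ℤ) then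
          ⨆ q : ℚ, ‖numOp i * windowProp (M.H L ω) (Set.Icc M.Θ₀ Θ₂) q * numOp j‖ₑ else 0)
          ∂M.law := by
        refine lintegral_mono fun ω => iSup_le fun q => (enorm_occ_mul_mul_occ_le x y _).trans ?_
        refine Finset.sum_le_sum fun i _ => Finset.sum_le_sum fun j _ => ?_
        split_ifs
        · exact le_iSup (fun q : ℚ =>
            ‖numOp i * windowProp (M.H L ω) (Set.Icc M.Θ₀ Θ₂) q * numOp j‖ₑ) q
        · exact le_rfl
    _ = ∑ i : Site L, ∑ j : Site L, (if (i : ℤ) ≤ x ∧ y ≤ (j : ℤ) then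
          ∫⁻ ω, ⨆ q : ℚ, ‖numOp i * windowProp (M.H L ω) (Set.Icc M.Θ₀ Θ₂) q * numOp j‖ₑ ∂M.law
          else 0) := by
        have hm' : ∀ i j : Site L, Measurable fun ω => (if (i : ℤ) ≤ x ∧ y ≤ (j : ℤ) then
            ⨆ q : ℚ, ‖numOp i * windowProp (M.H L ω) (Set.Icc M.Θ₀ Θ₂) q * numOp j‖ₑ else 0) := by
          intro i j
          split_ifs
          · exact Measurable.iSup fun q => hmeas i j q
          · exact measurable_const
        rw [lintegral_finsetSum _ fun i _ => Finset.measurable_sum _ fun j _ => hm' i j]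
        refine Finset.sum_congr rfl fun i _ => ?_
        rw [lintegral_finsetSum _ fun j _ => hm' i j]
        refine Finset.sum_congr rfl fun j _ => ?_
        split_ifs
        · rfl
        · simp
    _ ≤ ∑ i : Site L, ∑ j : Site L, ENNReal.ofReal (if (i : ℤ) ≤ x ∧ y ≤ (j : ℤ) then
          C * Real.exp (-m * |((i : ℤ) : ℝ) - ((j : ℤ) : ℝ)|) else 0) := by
        refine Finset.sum_le_sum fun i _ => Finset.sum_le_sum fun j _ => ?_
        split_ifs
        · exact hbase i j
        · simp
    _ = ENNReal.ofReal (C * ∑ i : Site L, ∑ j : Site L, if (i : ℤ) ≤ x ∧ y ≤ (j : ℤ) then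
          Real.exp (-m * |((i : ℤ) : ℝ) - ((j : ℤ) : ℝ)|) else 0) := by
        simp only [Finset.mul_sum, mul_ite, mul_zero]
        have hnn : ∀ i j : Site L, 0 ≤ if (i : ℤ) ≤ x ∧ y ≤ (j : ℤ) then
            C * Real.exp (-m * |((i : ℤ) : ℝ) - ((j : ℤ) : ℝ)|) else 0 := by
          intro i j
          split_ifs <;> positivity
        rw [ENNReal.ofReal_sum_of_nonneg fun i _ => Finset.sum_nonneg fun j _ => hnn i j]
        exact Finset.sum_congr rfl fun i _ =>
          (ENNReal.ofReal_sum_of_nonneg fun j _ => hnn i j).symm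
    _ ≤ _ := by
        refine ENNReal.ofReal_le_ofReal ?_
        rw [mul_assoc]
        exact mul_le_mul_of_nonneg_left (sum_sum_exp_le hm hxy) hC

end XXZ

/-! ### The clustering estimates in expectation -/

namespace XXZ

theorem enorm_le_iSup_rat {E : Type*} [NormedAddCommGroup E] {f : ℝ → E} (hf : Continuous f)
    (t : ℝ) : ‖f t‖ₑ ≤ ⨆ q : ℚ, ‖f q‖ₑ := by
  have hcl : IsClosed {t | ‖f t‖ₑ ≤ ⨆ q : ℚ, ‖f q‖ₑ} := isClosed_le hf.enorm continuous_const
  have hsub : Set.range ((↑) : ℚ → ℝ) ⊆ {t | ‖f t‖ₑ ≤ ⨆ q : ℚ, ‖f q‖ₑ} := by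
    rintro _ ⟨q, rfl⟩
    exact le_iSup (fun q : ℚ => ‖f q‖ₑ) q
  exact hcl.closure_subset_iff.2 hsub (Rat.denseRange_cast t)

namespace DisorderedChain

variable (M : DisorderedChain)

instance : IsProbabilityMeasure M.law := M.isProbabilityMeasure

theorem Θ₀_pos : 0 < M.Θ₀ := by
  have := M.one_lt_Δ
  rw [Θ₀, sub_pos, div_lt_one (by linarith)]
  exact this

theorem zero_notMem_window (b : ℝ) : (0 : ℝ) ∉ Set.Icc M.Θ₀ b := fun h => by
  linarith [h.1, M.Θ₀_pos]

/-- The random variables `ωᵢ` are identically distributed. -/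
theorem map_eval (k : ℤ) : (M.law.map fun ω => ω k) = M.law.map fun ω => ω 0 := by
  have hshift : ∀ k : ℤ, (M.law.map fun ω => ω (k + 1)) = M.law.map fun ω => ω k := by
    intro k
    have h := M.ergodic.toMeasurePreserving
    conv_rhs => rw [← h.map_eq]
    rw [Measure.map_map (measurable_pi_apply k) h.measurable]
    rfl
  induction k using Int.induction_on with
  | zero => rfl
  | succ k ih => rw [hshift, ih]
  | pred k ih => rw [← ih, ← hshift (-(k : ℤ) - 1), sub_add_cancel]

theorem ae_nonneg : ∀ᵐ ω ∂M.law, ∀ i, 0 ≤ ω i := by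
  rw [ae_all_iff]
  intro i
  have h1 : ∀ᵐ x ∂(M.law.map fun ω => ω i), x ∈ Set.Icc (0 : ℝ) 1 := by
    rw [map_eval]
    exact Filter.mem_of_superset Measure.support_mem_ae M.support_subset
  exact (ae_of_ae_map (measurable_pi_apply i).aemeasurable h1).mono fun ω h => h.1

theorem H_isHermitian (L : ℕ) (ω : ℤ → ℝ) : (M.H L ω).IsHermitian :=
  hamiltonian_isHermitian _ _ _ _ _

theorem groundProj_H {L : ℕ} {ω : ℤ → ℝ} (hω : ∀ i, 0 ≤ ω i) : groundProj (M.H L ω) = vac L :=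
  groundProj_hamiltonian M.one_lt_Δ M.lam_pos M.le_β hω

end DisorderedChain

/-- A linearized square root: the two-particle weight is controlled through its square, and a free
parameter `s` replaces an application of Jensen's inequality. -/
theorem le_mul_sq_add_inv {s u : ℝ} (hs : 0 < s) (hu : 0 ≤ u) : u ≤ s * u ^ 2 + s⁻¹ := by
  have h1 : 0 ≤ s⁻¹ * ((s * u - 1) ^ 2 + s * u) := by positivity
  have h2 : s⁻¹ * ((s * u - 1) ^ 2 + s * u) = s * u ^ 2 + s⁻¹ - u := by
    field_simp
    ring
  linarith

/-- Two-particle weights from the localization bound. -/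
theorem lintegral_enorm_specProj_mul_occ_le {M : DisorderedChain} {D m b : ℝ} (hD : 0 ≤ D)
    (L : ℕ) {x y : ℤ} (hxy : x ≤ y)
    (h : ∫⁻ ω, ⨆ q : ℚ, ‖occ L (Set.Iic x) * windowProp (M.H L ω) (Set.Icc M.Θ₀ b) q *
      occ L (Set.Ici y)‖ₑ ∂M.law ≤ ENNReal.ofReal (D * Real.exp (-m * ((y : ℝ) - x)))) :
    ∫⁻ ω, ‖specProj (M.H L ω) (Set.Icc M.Θ₀ b) * (occ L (Set.Iic x) * occ L (Set.Ici y))‖ₑ ∂M.law ≤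
      ENNReal.ofReal ((D + 1) * Real.exp (-(m / 2) * ((y : ℝ) - x))) := by
  -- This `s` balances `s * e^{-m (y - x)}` against `s⁻¹`; half of the decay rate is lost.
  set s := Real.exp (m / 2 * ((y : ℝ) - x)) with hs
  have hs0 : 0 < s := Real.exp_pos _
  have hxy' : (0 : ℝ) ≤ (y : ℝ) - x := by
    rw [sub_nonneg]
    exact_mod_cast hxy
  have hpt : ∀ ω, ‖specProj (M.H L ω) (Set.Icc M.Θ₀ b) * (occ L (Set.Iic x) * occ L (Set.Ici y))‖ₑ ≤
      ENNReal.ofReal s * (⨆ q : ℚ, ‖occ L (Set.Iic x) *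
        windowProp (M.H L ω) (Set.Icc M.Θ₀ b) q * occ L (Set.Ici y)‖ₑ) + ENNReal.ofReal s⁻¹ := by
    intro ω
    have h1 := norm_specProj_mul_occ_mul_occ_sq_le (M.H_isHermitian L ω) (Set.Icc M.Θ₀ b)
      (Set.Iic x) (Set.Ici y)
    set u := ‖specProj (M.H L ω) (Set.Icc M.Θ₀ b) * (occ L (Set.Iic x) * occ L (Set.Ici y))‖ with hu
    have h2 : u ≤ s * ‖occ L (Set.Iic x) * specProj (M.H L ω) (Set.Icc M.Θ₀ b) *
        occ L (Set.Ici y)‖ + s⁻¹ := by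
      have h3 : u ≤ s * u ^ 2 + s⁻¹ := le_mul_sq_add_inv hs0 (norm_nonneg _)
      exact h3.trans (add_le_add_left (mul_le_mul_of_nonneg_left h1 hs0.le) _)
    have h6 : ‖occ L (Set.Iic x) * specProj (M.H L ω) (Set.Icc M.Θ₀ b) * occ L (Set.Ici y)‖ₑ ≤
        ⨆ q : ℚ, ‖occ L (Set.Iic x) * windowProp (M.H L ω) (Set.Icc M.Θ₀ b) q *
          occ L (Set.Ici y)‖ₑ := by
      refine le_trans (le_of_eq ?_) (le_iSup (fun q : ℚ => ‖occ L (Set.Iic x) *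
        windowProp (M.H L ω) (Set.Icc M.Θ₀ b) q * occ L (Set.Ici y)‖ₑ) 0)
      rw [Rat.cast_zero, windowProp_zero]
    calc _ = ENNReal.ofReal u := (ofReal_norm _).symm
      _ ≤ ENNReal.ofReal (s * ‖occ L (Set.Iic x) * specProj (M.H L ω) (Set.Icc M.Θ₀ b) *
        occ L (Set.Ici y)‖ + s⁻¹) := ENNReal.ofReal_le_ofReal h2
      _ = ENNReal.ofReal s * ‖occ L (Set.Iic x) * specProj (M.H L ω) (Set.Icc M.Θ₀ b) *
        occ L (Set.Ici y)‖ₑ + ENNReal.ofReal s⁻¹ := by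
          rw [ENNReal.ofReal_add (mul_nonneg hs0.le (norm_nonneg _)) (inv_nonneg.2 hs0.le),
            ENNReal.ofReal_mul hs0.le, ofReal_norm]
      _ ≤ _ := by gcongr
  refine (lintegral_mono hpt).trans ?_
  rw [lintegral_add_right _ measurable_const, lintegral_const_mul' _ _ ENNReal.ofReal_ne_top,
    lintegral_const, measure_univ, mul_one]
  refine (add_le_add_left (mul_le_mul_right h _) _).trans ?_
  rw [← ENNReal.ofReal_mul hs0.le, ← ENNReal.ofReal_add (by positivity) (by positivity)]
  refine ENNReal.ofReal_le_ofReal (le_of_eq ?_)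
  have e1 : s * Real.exp (-m * ((y : ℝ) - x)) = Real.exp (-(m / 2) * ((y : ℝ) - x)) := by
    rw [hs, ← Real.exp_add]
    congr 1
    ring
  have e2 : s⁻¹ = Real.exp (-(m / 2) * ((y : ℝ) - x)) := by
    rw [hs, ← Real.exp_neg]
    congr 1
    ring
  rw [e2]
  linear_combination D * e1

namespace LocalObservable

variable {L : ℕ}

theorem dist_nonneg (X Y : LocalObservable L) : 0 ≤ X.dist Y :=
  Real.iInf_nonneg fun _ => abs_nonneg _

theorem dist_le (X Y : LocalObservable L) {i j : ℤ} (hi : i ∈ X.supp) (hj : j ∈ Y.supp) :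
    X.dist Y ≤ |(i : ℝ) - j| :=
  ciInf_le ⟨0, by rintro _ ⟨p, rfl⟩; exact abs_nonneg _⟩
    ((⟨i, hi⟩, ⟨j, hj⟩) : {i : ℤ // i ∈ X.supp} × {j : ℤ // j ∈ Y.supp})

theorem s_mem_supp (X : LocalObservable L) : X.s ∈ X.supp :=
  Finset.mem_Icc.2 ⟨le_rfl, X.nonempty⟩

theorem r_mem_supp (X : LocalObservable L) : X.r ∈ X.supp :=
  Finset.mem_Icc.2 ⟨X.nonempty, le_rfl⟩

theorem one_le_card_supp (X : LocalObservable L) : (1 : ℝ) ≤ X.supp.card := by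
  exact_mod_cast Finset.card_pos.2 ⟨_, X.s_mem_supp⟩

end LocalObservable

/-- The supports are nonempty, so the logarithm is nonnegative and its factor may be dropped. -/
theorem le_clusterBound {L : ℕ} {C m α d : ℝ} (hC : 0 ≤ C) (hm : 0 ≤ m) (X Y : LocalObservable L)
    (hd : X.dist Y ^ α ≤ d) : C * ‖X.op‖ * ‖Y.op‖ * Real.exp (-m * d) ≤ clusterBound C m α X Y := by
  have hlog : 0 ≤ Real.log (min (X.supp.card : ℝ) (Y.supp.card : ℝ)) :=
    Real.log_nonneg (le_min X.one_le_card_supp Y.one_le_card_supp)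
  have hexp : Real.exp (-m * d) ≤ Real.exp (-m * X.dist Y ^ α) :=
    Real.exp_le_exp.2 (by nlinarith)
  have hX := norm_nonneg X.op
  have hY := norm_nonneg Y.op
  rw [clusterBound]
  generalize ‖X.op‖ = u at hX ⊢
  generalize ‖Y.op‖ = v at hY ⊢
  refine mul_le_mul ?_ hexp (Real.exp_pos _).le (by positivity)
  refine mul_le_mul_of_nonneg_right (mul_le_mul_of_nonneg_right ?_ hX) hY
  nlinarith

theorem clusterBound_comm {L : ℕ} (C m α : ℝ) (X Y : LocalObservable L) :
    clusterBound C m α X Y = clusterBound C m α Y X := by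
  have hdist : X.dist Y = Y.dist X := by
    rw [LocalObservable.dist, LocalObservable.dist]
    refine Equiv.iInf_congr (Equiv.prodComm _ _) fun p => ?_
    exact abs_sub_comm _ _
  rw [clusterBound, clusterBound, hdist, min_comm]
  ring

/-- Bounds in expectation for separated supports. -/
theorem expect_cluster_le {M : DisorderedChain} {D m b : ℝ} (hD : 0 ≤ D) (hm : 0 < m)
    (hloc : ∀ (L : ℕ) (x y : ℤ), x ≤ y → ∫⁻ ω, ⨆ q : ℚ, ‖occ L (Set.Iic x) *
      windowProp (M.H L ω) (Set.Icc M.Θ₀ b) q * occ L (Set.Ici y)‖ₑ ∂M.law ≤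
        ENNReal.ofReal (D * Real.exp (-m * ((y : ℝ) - x))))
    {L : ℕ} (X Y : LocalObservable L) (hXY : X.r < Y.s) {F : (ℤ → ℝ) → ℝ≥0∞}
    (hF : ∀ ω, (∀ i, 0 ≤ ω i) → ∀ (x y : ℤ) (S : ℝ), X.r ≤ x → x < y → y ≤ Y.s →
      (∀ t, ‖occ L (Set.Iic x) * windowProp (M.H L ω) (Set.Icc M.Θ₀ b) t *
        occ L (Set.Ici y)‖ ≤ S) → F ω ≤ ENNReal.ofReal (40 * ‖X.op‖ * ‖Y.op‖ *
          clusterError (M.H L ω) (Set.Icc M.Θ₀ b) X.r Y.s x y S))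
    {α : ℝ} (hα : α ∈ Set.Ioo (0 : ℝ) 1) {C : ℝ} (hC : 160 * (D + 1) ≤ C) :
    ∫⁻ ω, F ω ∂M.law ≤ ENNReal.ofReal (clusterBound C (m / 6) α X Y) := by
  -- The gap is cut into thirds. With `l` rounded down, the separations `l + 1`, `d - 2 l`, `l + 1`
  -- and `d` are all at least `d / 3`; with rate `m / 2` on each, this gives `m / 6`.
  set d : ℤ := Y.s - X.r with hd
  set l : ℤ := d / 3 with hl
  set K := Set.Icc M.Θ₀ b
  set x : ℤ := X.r + l with hx
  set y : ℤ := Y.s - l with hy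
  have hx' : X.r ≤ x := by omega
  have hxy : x < y := by omega
  have hy' : y ≤ Y.s := by omega
  set T : (ℤ → ℝ) → ℝ≥0∞ := fun ω => ⨆ q : ℚ, ‖occ L (Set.Iic x) *
    windowProp (M.H L ω) K q * occ L (Set.Ici y)‖ₑ with hT
  set N : ℤ → ℤ → (ℤ → ℝ) → ℝ≥0∞ := fun i j ω =>
    ‖specProj (M.H L ω) K * (occ L (Set.Iic i) * occ L (Set.Ici j))‖ₑ with hN
  set κ := D + 1
  have hNmeas : ∀ i j, Measurable (N i j) := fun i j =>
    ((stronglyMeasurable_specProj L _ _).mul stronglyMeasurable_const).enorm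
  have hd1 : (1 : ℝ) ≤ d := by exact_mod_cast (show (1 : ℤ) ≤ d by omega)
  have hexp : ∀ i j : ℤ, d ≤ 3 * (j - i) → κ * Real.exp (-(m / 2) * ((j : ℝ) - i)) ≤
      κ * Real.exp (-(m / 6) * d) := by
    intro i j hij
    have h1 : (d : ℝ) ≤ 3 * ((j : ℝ) - i) := by exact_mod_cast hij
    refine mul_le_mul_of_nonneg_left (Real.exp_le_exp.2 ?_) (by positivity)
    nlinarith
  have hNint : ∀ i j : ℤ, d ≤ 3 * (j - i) → ∫⁻ ω, N i j ω ∂M.law ≤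
      ENNReal.ofReal (κ * Real.exp (-(m / 6) * d)) := fun i j hij =>
    (lintegral_enorm_specProj_mul_occ_le hD L (by omega)
      (hloc L i j (by omega))).trans (ENNReal.ofReal_le_ofReal (hexp i j hij))
  have hTint : ∫⁻ ω, T ω ∂M.law ≤ ENNReal.ofReal (κ * Real.exp (-(m / 6) * d)) := by
    refine (hloc L x y hxy.le).trans (ENNReal.ofReal_le_ofReal
      (le_trans ?_ (hexp x y (by omega))))
    have h1 : (0 : ℝ) ≤ (y : ℝ) - x := by
      rw [sub_nonneg]
      exact_mod_cast hxy.le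
    refine mul_le_mul (by linarith) (Real.exp_le_exp.2 (by nlinarith)) (Real.exp_pos _).le
      (by positivity)
  have hpt : ∀ᵐ ω ∂M.law, F ω ≤ ENNReal.ofReal (40 * ‖X.op‖ * ‖Y.op‖) *
      (N X.r Y.s ω + N X.r (x + 1) ω + N (y - 1) Y.s ω + T ω) := by
    filter_upwards [M.ae_nonneg] with ω hω
    have hcont : Continuous fun t : ℝ => occ L (Set.Iic x) * windowProp (M.H L ω) K t *
        occ L (Set.Ici y) :=
      (continuous_const.mul (continuous_windowProp _ _)).mul continuous_const
    have hle := enorm_le_iSup_rat hcont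
    -- Finiteness is needed for `(T ω).toReal` to serve as the bound `S`.
    have hTfin : T ω ≠ ∞ := by
      refine ne_top_of_le_ne_top ENNReal.one_ne_top (iSup_le fun q => ?_)
      rw [← ofReal_norm, ← ENNReal.ofReal_one]
      refine ENNReal.ofReal_le_ofReal ?_
      have := norm_mul_le_of_le (norm_mul_le_of_le (norm_occ_le (L := L) (Set.Iic x))
        (norm_windowProp_le (M.H_isHermitian L ω) K q)) (norm_occ_le (L := L) (Set.Ici y))
      simpa using this
    refine (hF ω hω x y (T ω).toReal hx' hxy hy' fun t => ?_).trans (le_of_eq ?_)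
    · rw [← ENNReal.ofReal_le_iff_le_toReal hTfin, ofReal_norm]
      exact hle t
    · have hXn := norm_nonneg X.op
      have hYn := norm_nonneg Y.op
      rw [ENNReal.ofReal_mul (mul_nonneg (mul_nonneg (by norm_num) hXn) hYn), clusterError,
        ENNReal.ofReal_add (add_nonneg (add_nonneg (norm_nonneg _) (norm_nonneg _))
          (norm_nonneg _)) ENNReal.toReal_nonneg,
        ENNReal.ofReal_add (add_nonneg (norm_nonneg _) (norm_nonneg _)) (norm_nonneg _),
        ENNReal.ofReal_add (norm_nonneg _) (norm_nonneg _),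
        ofReal_norm, ofReal_norm, ofReal_norm, ENNReal.ofReal_toReal hTfin]
  have hXn := norm_nonneg X.op
  have hYn := norm_nonneg Y.op
  refine (lintegral_mono_ae hpt).trans ?_
  have hN2 : Measurable fun ω => N X.r Y.s ω + N X.r (x + 1) ω := (hNmeas _ _).add (hNmeas _ _)
  have hN3 : Measurable fun ω => N X.r Y.s ω + N X.r (x + 1) ω + N (y - 1) Y.s ω :=
    hN2.add (hNmeas _ _)
  rw [lintegral_const_mul' _ _ ENNReal.ofReal_ne_top, lintegral_add_left hN3,
    lintegral_add_left hN2, lintegral_add_left (hNmeas _ _)]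
  have hsum := add_le_add (add_le_add (add_le_add (hNint X.r Y.s (by omega))
    (hNint X.r (x + 1) (by omega))) (hNint (y - 1) Y.s (by omega))) hTint
  refine (mul_le_mul_right hsum _).trans ?_
  have hκ : 0 ≤ κ * Real.exp (-(m / 6) * d) := by positivity
  rw [← ENNReal.ofReal_add hκ hκ, ← ENNReal.ofReal_add (by positivity) hκ,
    ← ENNReal.ofReal_add (by positivity) hκ,
    ← ENNReal.ofReal_mul (mul_nonneg (mul_nonneg (by norm_num) hXn) hYn)]
  refine ENNReal.ofReal_le_ofReal ?_
  -- Since `d ≥ 1` and `α < 1`, exponential decay in `d` implies the stretched exponential bound.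
  have hdist : X.dist Y ^ α ≤ d := by
    have h1 : X.dist Y ≤ d := by
      refine (X.dist_le Y X.r_mem_supp Y.s_mem_supp).trans (le_of_eq ?_)
      have : (X.r : ℝ) < Y.s := by exact_mod_cast hXY
      rw [abs_of_nonpos (by linarith), hd]
      push_cast
      ring
    calc X.dist Y ^ α ≤ (d : ℝ) ^ α := Real.rpow_le_rpow (X.dist_nonneg Y) h1 hα.1.le
      _ ≤ (d : ℝ) ^ (1 : ℝ) := Real.rpow_le_rpow_of_exponent_le hd1 hα.2.le
      _ = d := Real.rpow_one _
  refine le_trans ?_ (le_clusterBound (by linarith) (by positivity) X Y hdist)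
  calc _ = 160 * κ * (‖X.op‖ * ‖Y.op‖ * Real.exp (-(m / 6) * d)) := by ring
    _ ≤ C * (‖X.op‖ * ‖Y.op‖ * Real.exp (-(m / 6) * d)) :=
      mul_le_mul_of_nonneg_right hC
        (mul_nonneg (mul_nonneg hXn hYn) (Real.exp_pos _).le)
    _ = _ := by ring

/-- Bounds in expectation for overlapping supports. -/
theorem expect_overlap_le {M : DisorderedChain} {L : ℕ} (X Y : LocalObservable L)
    (h1 : Y.s ≤ X.r) (h2 : X.s ≤ Y.r) {F : (ℤ → ℝ) → ℝ≥0∞}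
    (hF : ∀ ω, F ω ≤ ENNReal.ofReal (8 * ‖X.op‖ * ‖Y.op‖)) {α : ℝ} (hα : 0 < α) {C m : ℝ}
    (hC : 8 ≤ C) (hm : 0 ≤ m) : ∫⁻ ω, F ω ∂M.law ≤ ENNReal.ofReal (clusterBound C m α X Y) := by
  have hd : X.dist Y = 0 := by
    refine le_antisymm ?_ (X.dist_nonneg Y)
    have hX : max X.s Y.s ∈ X.supp := Finset.mem_Icc.2 ⟨le_max_left _ _, max_le X.nonempty h1⟩
    have hY : max X.s Y.s ∈ Y.supp := Finset.mem_Icc.2 ⟨le_max_right _ _, max_le h2 Y.nonempty⟩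
    simpa using X.dist_le Y hX hY
  refine (lintegral_mono hF).trans ?_
  rw [lintegral_const, measure_univ, mul_one]
  refine ENNReal.ofReal_le_ofReal (le_trans ?_ (le_clusterBound (d := 0) (by linarith) hm X Y
    (by rw [hd, Real.zero_rpow hα.ne'])))
  rw [mul_zero, Real.exp_zero, mul_one]
  exact mul_le_mul_of_nonneg_right (mul_le_mul_of_nonneg_right hC (norm_nonneg _)) (norm_nonneg _)

theorem iSup_enorm_le {E : Type*} [NormedAddCommGroup E] {f : ℝ → E} {c : ℝ} (h : ∀ t, ‖f t‖ ≤ c) :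
    ⨆ t, ‖f t‖ₑ ≤ ENNReal.ofReal c :=
  iSup_le fun t => by
    rw [← ofReal_norm]
    exact ENNReal.ofReal_le_ofReal (h t)

/-- General dynamical clustering. -/
theorem exists_cluster_bounds (M : DisorderedChain) {Θ₁ Θ₂ : ℝ} (hDL : M.PropertyDL Θ₁)
    (hΘ₂ : Θ₂ ≤ Θ₁) {α : ℝ} (hα : α ∈ Set.Ioo (0 : ℝ) 1) :
    ∃ m : ℝ, 0 < m ∧ ∃ C : ℝ, ∀ (L : ℕ) (X Y : LocalObservable L),
      M.expect (fun ω => ⨆ t : ℝ, ‖corr (M.H L ω) (Set.Icc M.Θ₀ Θ₂)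
          (evol (M.H L ω) (Set.Icc M.Θ₀ Θ₂) t X.op) Y.op
            - counterterm (M.H L ω) (Set.Icc M.Θ₀ Θ₂) t X.op Y.op‖ₑ)
        ≤ ENNReal.ofReal (clusterBound C m α X Y) ∧
      M.expect (fun ω => ⨆ t : ℝ, ‖window (M.H L ω) (Set.Icc M.Θ₀ Θ₂)
            (correctedComm (M.H L ω) (Set.Icc M.Θ₀ Θ₂) t X.op Y.op)‖ₑ)
        ≤ ENNReal.ofReal (clusterBound C m α X Y) := by
  obtain ⟨-, C₀, m, hm, hloc⟩ := hDL
  -- Property DL does not say that its constant is nonnegative, hence the maximum.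
  have hloc' := lintegral_iSup_enorm_occ_le (M := M) (C := max C₀ 0) (le_max_right _ _) hm hΘ₂
    fun L i j => (hloc L i j).trans (ENNReal.ofReal_le_ofReal
      (mul_le_mul_of_nonneg_right (le_max_left _ _) (Real.exp_pos _).le))
  set D := max C₀ 0 * ((1 - Real.exp (-m))⁻¹ * (1 - Real.exp (-m))⁻¹) with hDdef
  have hD : 0 ≤ D := mul_nonneg (le_max_right _ _) (mul_self_nonneg _)
  refine ⟨m / 6, by positivity, 160 * (D + 1) + 8, fun L X Y => ?_⟩
  have h0 := M.zero_notMem_window Θ₂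
  simp only [DisorderedChain.expect]
  rcases lt_or_ge X.r Y.s with h | h
  · refine ⟨expect_cluster_le hD hm (fun L x y hxy => hloc' L hxy) X Y h
      (fun ω hω x y S hx hxy hy hS => iSup_enorm_le fun t => ?_) hα (by linarith),
      expect_cluster_le hD hm (fun L x y hxy => hloc' L hxy) X Y h
      (fun ω hω x y S hx hxy hy hS => iSup_enorm_le fun t => ?_) hα (by linarith)⟩
    · exact (norm_cluster_le (M.H_isHermitian L ω) h0 (M.groundProj_H hω) X Y hx hxy hy hS t).1
    · exact (norm_cluster_le (M.H_isHermitian L ω) h0 (M.groundProj_H hω) X Y hx hxy hy hS t).2.1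
  · rcases lt_or_ge Y.r X.s with h' | h'
    · rw [clusterBound_comm]
      refine ⟨expect_cluster_le hD hm (fun L x y hxy => hloc' L hxy) Y X h'
        (fun ω hω x y S hx hxy hy hS => iSup_enorm_le fun t => ?_) hα (by linarith),
        expect_cluster_le hD hm (fun L x y hxy => hloc' L hxy) Y X h'
        (fun ω hω x y S hx hxy hy hS => iSup_enorm_le fun t => ?_) hα (by linarith)⟩
      · exact (norm_cluster_le (M.H_isHermitian L ω) h0 (M.groundProj_H hω) Y X hx hxy hy hS
          t).2.2.1
      · exact (norm_cluster_le (M.H_isHermitian L ω) h0 (M.groundProj_H hω) Y X hx hxy hy hS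
          t).2.2.2
    · refine ⟨expect_overlap_le X Y h h' (fun ω => iSup_enorm_le fun t => ?_) hα.1
        (by linarith) (by positivity), expect_overlap_le X Y h h' (fun ω => iSup_enorm_le fun t =>
          ?_) hα.1 (by linarith) (by positivity)⟩
      · exact (norm_cluster_le_of_overlap (M.H_isHermitian L ω) h0 X.op Y.op t).1
      · exact (norm_cluster_le_of_overlap (M.H_isHermitian L ω) h0 X.op Y.op t).2

end XXZ

/-! ### Matrix units of one spin -/

namespace XXZ

variable {L : ℕ}

namespace LocalObservable

/-- The one-site observable `|a⟩⟨b|` at the site `k`. -/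
noncomputable def siteUnit (k : Site L) (a b : Fin 2) : LocalObservable L where
  s := k
  r := k
  left_le := (Finset.mem_Icc.1 k.2).1
  nonempty := le_rfl
  le_right := (Finset.mem_Icc.1 k.2).2
  core := Matrix.of fun σ τ => if (∀ j, σ j = a) ∧ ∀ j, τ j = b then 1 else 0

theorem siteUnit_op_apply (k : Site L) (a b : Fin 2) (σ τ : Config L) :
    (siteUnit k a b).op σ τ =
      if (∀ j, j ≠ k → σ j = τ j) ∧ σ k = a ∧ τ k = b then 1 else 0 := by
  have h1 : (∀ j : Site L, (j : ℤ) ∉ (siteUnit k a b).supp → σ j = τ j) ↔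
      ∀ j, j ≠ k → σ j = τ j := by
    refine forall_congr' fun j => imp_congr (not_congr ?_) Iff.rfl
    rw [supp, Finset.mem_Icc]
    exact ⟨fun h => Subtype.ext (le_antisymm h.2 h.1), by rintro rfl; exact ⟨le_rfl, le_rfl⟩⟩
  have h2 : ∀ (ρ : Config L) (c : Fin 2),
      (∀ j, (siteUnit k a b).restrict ρ j = c) ↔ ρ k = c := by
    intro ρ c
    constructor
    · intro h
      exact h ⟨k, Finset.mem_Icc.2 ⟨le_rfl, le_rfl⟩⟩
    · rintro h ⟨j, hj⟩
      have hjk : j = k := by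
        have := Finset.mem_Icc.1 hj
        exact le_antisymm this.2 this.1
      subst hjk
      exact h
  rw [op_apply]
  simp only [h1]
  by_cases h : ∀ j, j ≠ k → σ j = τ j
  · rw [if_pos h]
    simp only [siteUnit, Matrix.of_apply]
    refine if_congr ?_ rfl rfl
    exact ⟨fun g => ⟨h, (h2 σ a).1 g.1, (h2 τ b).1 g.2⟩,
      fun g => ⟨(h2 σ a).2 g.2.1, (h2 τ b).2 g.2.2⟩⟩
  · rw [if_neg h, if_neg fun g => h g.1]

/-- A matrix unit is a partial isometry: `TᴴT` is the projection onto spin `b` at `k`. -/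
theorem norm_siteUnit_op_le (k : Site L) (a b : Fin 2) : ‖(siteUnit k a b).op‖ ≤ 1 := by
  have h : (siteUnit k a b).opᴴ * (siteUnit k a b).op = diagProj fun τ => τ k = b := by
    ext σ τ
    rw [Matrix.mul_apply, Finset.sum_eq_single (Function.update σ k a)]
    · simp only [Matrix.conjTranspose_apply, siteUnit_op_apply, diagProj, Matrix.diagonal_apply,
        Function.update_self]
      by_cases hb : σ k = b
      · by_cases hστ : σ = τ
        · subst hστ
          have : ∀ j, j ≠ k → Function.update σ k a j = σ j := fun j hj =>
            Function.update_of_ne hj _ _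
          rw [if_pos ⟨this, trivial, hb⟩, if_pos rfl, if_pos hb, star_one, one_mul]
        · have : ¬ ((∀ j, j ≠ k → Function.update σ k a j = τ j) ∧ True ∧ τ k = b) := by
            rintro ⟨g1, -, g2⟩
            refine hστ (funext fun j => ?_)
            by_cases hj : j = k
            · rw [hj, hb, g2]
            · simpa [hj] using g1 j hj
          rw [if_neg this, if_neg hστ, mul_zero]
      · simp [hb]
    · intro ρ _ hρ
      simp only [Matrix.conjTranspose_apply, siteUnit_op_apply]
      rw [if_neg, star_zero, zero_mul]
      rintro ⟨g1, g2, -⟩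
      refine hρ (funext fun j => ?_)
      by_cases hj : j = k
      · rw [hj, g2, Function.update_self]
      · rw [g1 j hj, Function.update_of_ne hj]
    · exact fun h => absurd (Finset.mem_univ _) h
  have h1 := norm_diagProj_le fun τ : Config L => τ k = b
  rw [← h, Matrix.l2_opNorm_conjTranspose_mul_self] at h1
  exact (mul_self_le_mul_self_iff (norm_nonneg _) zero_le_one).2 (by rwa [mul_one])

theorem le_dist_siteUnit (k k' : Site L) (a b c d : Fin 2) :
    |((k : ℤ) : ℝ) - ((k' : ℤ) : ℝ)| ≤ (siteUnit k a b).dist (siteUnit k' c d) := by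
  have : Nonempty ({i : ℤ // i ∈ (siteUnit k a b).supp} × {j : ℤ // j ∈ (siteUnit k' c d).supp}) :=
    ⟨⟨_, s_mem_supp _⟩, ⟨_, s_mem_supp _⟩⟩
  refine le_ciInf fun p => le_of_eq ?_
  have h1 := Finset.mem_Icc.1 p.1.2
  have h2 := Finset.mem_Icc.1 p.2.2
  have e1 : (p.1 : ℤ) = k := le_antisymm h1.2 h1.1
  have e2 : (p.2 : ℤ) = k' := le_antisymm h2.2 h2.1
  rw [e1, e2]

end LocalObservable

open LocalObservable

theorem clusterBound_siteUnit_le {C m α : ℝ} (hm : 0 ≤ m) (hα : 0 ≤ α) (k k' : Site L)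
    (a b c d : Fin 2) : clusterBound C m α (siteUnit k a b) (siteUnit k' c d) ≤
      max C 0 * Real.exp (-m * |((k : ℤ) : ℝ) - ((k' : ℤ) : ℝ)| ^ α) := by
  have hcard : ∀ (j : Site L) (e f : Fin 2), ((siteUnit j e f).supp.card : ℝ) = 1 := by
    intro j e f
    simp [supp, siteUnit]
  have hexp : Real.exp (-m * (siteUnit k a b).dist (siteUnit k' c d) ^ α) ≤
      Real.exp (-m * |((k : ℤ) : ℝ) - ((k' : ℤ) : ℝ)| ^ α) := by
    rw [Real.exp_le_exp, neg_mul, neg_mul, neg_le_neg_iff]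
    exact mul_le_mul_of_nonneg_left
      (Real.rpow_le_rpow (abs_nonneg _) (le_dist_siteUnit _ _ _ _ _ _) hα) hm
  rw [clusterBound, hcard, hcard, min_self, Real.log_one, add_zero, mul_one]
  have h1 := norm_siteUnit_op_le k a b
  have h2 := norm_siteUnit_op_le k' c d
  have h3 := norm_nonneg (siteUnit k a b).op
  have h4 := norm_nonneg (siteUnit k' c d).op
  generalize ‖(siteUnit k a b).op‖ = u at *
  generalize ‖(siteUnit k' c d).op‖ = v at *
  have h5 : C * u * v ≤ max C 0 := by
    calc C * u * v ≤ max C 0 * (u * v) := by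
          rw [mul_assoc]
          exact mul_le_mul_of_nonneg_right (le_max_left _ _) (mul_nonneg h3 h4)
      _ ≤ max C 0 * 1 := mul_le_mul_of_nonneg_left (mul_le_one₀ h1 h4 h2) (le_max_right _ _)
      _ = _ := mul_one _
  exact mul_le_mul h5 hexp (Real.exp_pos _).le (le_max_right _ _)

/-- Through the vacuum, creation at `k` after annihilation at `k'` has rank one, which makes the
counterterm explicit. -/
theorem siteUnit_mul_vac_mul_siteUnit (k k' : Site L) :
    (siteUnit k 1 0).op * vac L * (siteUnit k' 0 1).op =
      Matrix.single (particle k) (particle k') 1 := by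
  ext σ τ
  have h1 : (siteUnit k 1 0).op σ 0 = if particle k = σ then 1 else 0 := by
    rw [siteUnit_op_apply]
    refine if_congr ⟨fun h => funext fun j => ?_, ?_⟩ rfl rfl
    · rw [particle_apply]
      split_ifs with hj
      · rw [hj, h.2.1]
      · exact (h.1 j hj).symm
    · rintro rfl
      refine ⟨fun j hj => ?_, ?_, rfl⟩
      · rw [particle_apply, if_neg hj]; rfl
      · rw [particle_apply, if_pos rfl]
  have h2 : (siteUnit k' 0 1).op 0 τ = if particle k' = τ then 1 else 0 := by
    rw [siteUnit_op_apply]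
    refine if_congr ⟨fun h => funext fun j => ?_, ?_⟩ rfl rfl
    · rw [particle_apply]
      split_ifs with hj
      · rw [hj, h.2.2]
      · exact h.1 j hj
    · rintro rfl
      refine ⟨fun j hj => ?_, rfl, ?_⟩
      · rw [particle_apply, if_neg hj]; rfl
      · rw [particle_apply, if_pos rfl]
  rw [Matrix.mul_apply, Finset.sum_eq_single 0]
  · rw [vac, mul_diagProj_apply, if_pos rfl, h1, h2, Matrix.single_apply]
    by_cases a : particle k = σ <;> by_cases b : particle k' = τ <;> simp [a, b]
  · intro ρ _ hρ
    rw [vac, mul_diagProj_apply, if_neg hρ, zero_mul]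
  · exact fun h => absurd (Finset.mem_univ _) h

theorem siteUnit_zero_one_mul_vac (k : Site L) : (siteUnit k 0 1).op * vac L = 0 := by
  ext σ τ
  rw [vac, mul_diagProj_apply, Matrix.zero_apply, siteUnit_op_apply]
  split_ifs with h1 h2
  · subst h1
    exact absurd h2.2.2 (by simp)
  · rfl
  · rfl

theorem mul_single_mul_apply (A B : Op L) (ρ ρ' σ τ : Config L) :
    (A * (Matrix.single ρ ρ' 1 : Op L) * B) σ τ = A σ ρ * B ρ' τ := by
  rw [Matrix.mul_apply, Finset.sum_eq_single ρ']
  · simp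
  · intro κ _ hκ
    rw [Matrix.mul_single_apply_of_ne _ _ _ _ _ hκ, zero_mul]
  · exact fun h => absurd (Finset.mem_univ _) h

/-! ### The counterterms do not decay -/

section Counterterm

variable {H : Op L}

theorem evol_zero (H : Op L) (B : Set ℝ) (X : Op L) : evol H B 0 X = X := by
  simp [evol]

/-- At time zero the counterterm is `P |k⟩⟨k'| P`, the other summand vanishing because annihilation
kills the vacuum. Its entry at the two particles is the product of the weights. -/
theorem weight_mul_weight_le_corr (hH : H.IsHermitian) (B : Set ℝ) (hvac : groundProj H = vac L)
    (k k' : Site L) :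
    (specProj H B (particle k) (particle k)).re * (specProj H B (particle k') (particle k')).re ≤
      ‖corr H B (evol H B 0 (siteUnit k 1 0).op) (siteUnit k' 0 1).op‖ +
      ‖corr H B (evol H B 0 (siteUnit k 1 0).op) (siteUnit k' 0 1).op -
        counterterm H B 0 (siteUnit k 1 0).op (siteUnit k' 0 1).op‖ := by
  have h1 : counterterm H B 0 (siteUnit k 1 0).op (siteUnit k' 0 1).op =
      specProj H B * Matrix.single (particle k) (particle k') 1 * specProj H B := by
    rw [counterterm, window, evol_zero, evol_zero, hvac, siteUnit_mul_vac_mul_siteUnit,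
      siteUnit_zero_one_mul_vac, zero_mul, add_zero]
  have h2 := mul_single_mul_apply (specProj H B) (specProj H B) (particle k) (particle k')
    (particle k) (particle k')
  rw [← h1] at h2
  have h3 := Matrix.norm_apply_le_l2_opNorm
    (counterterm H B 0 (siteUnit k 1 0).op (siteUnit k' 0 1).op) (particle k) (particle k')
  rw [h2, (specProj_apply_self_nonneg hH B (particle k)).2,
    (specProj_apply_self_nonneg hH B (particle k')).2, ← Complex.ofReal_mul] at h3
  refine (le_abs_self _).trans (le_trans (le_of_eq ?_) (h3.trans ?_))
  · exact (Complex.norm_real _).symm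
  · exact norm_le_norm_add_norm_sub _ _

/-- At time zero the subtracted and added counterterms cancel. At `t = π / (2b)` the phases
`e^{-itE}` of the window fill part of a quadrant. The product of two averages of such phases has
real part at most `cos² (ta)` times the product of the weights, which leaves `sin² (ta)`. -/
theorem weight_mul_weight_le_comm (hH : H.IsHermitian) {a b : ℝ} (ha : 0 < a) (hab : a < b)
    (hvac : groundProj H = vac L) (k k' : Site L) :
    Real.sin (Real.pi / (2 * b) * a) ^ 2 *
      ((specProj H (Set.Icc a b) (particle k) (particle k)).re *
        (specProj H (Set.Icc a b) (particle k') (particle k')).re) ≤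
      ‖window H (Set.Icc a b) (comm (evol H (Set.Icc a b) (Real.pi / (2 * b)) (siteUnit k 1 0).op)
        (siteUnit k' 0 1).op)‖ +
      ‖window H (Set.Icc a b) (correctedComm H (Set.Icc a b) (Real.pi / (2 * b))
        (siteUnit k 1 0).op (siteUnit k' 0 1).op)‖ := by
  have hb : 0 < b := ha.trans hab
  have hpi := Real.pi_pos
  set t := Real.pi / (2 * b) with ht
  have ht0 : 0 ≤ t := by positivity
  have htb : t * b ≤ Real.pi / 2 := le_of_eq (by rw [ht]; field_simp)
  set B := Set.Icc a b with hB
  have h0 : (0 : ℝ) ∉ B := fun h => absurd h.1 (not_le.2 ha)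
  have hd : Disjoint B {0} := Set.disjoint_singleton_right.2 h0
  have hz := windowProp_apply_self hH ht0 ha.le htb (particle k)
  have hz' := windowProp_apply_self hH ht0 ha.le htb (particle k')
  have hp := specProj_apply_self_nonneg hH B (particle k)
  have hp' := specProj_apply_self_nonneg hH B (particle k')
  have hcU := (commute_specProj_propagator hH B B t).eq
  have hcV := (commute_specProj_propagator hH B B (-t)).eq
  have hVU : propagator H B (-t) * propagator H B t = 1 := by
    simpa using propagator_mul_neg hH B (-t)
  have hVP : propagator H B (-t) * vac L = vac L := by
    rw [← hvac]
    exact propagator_mul_specProj_of_disjoint hH hd _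
  have hPU : vac L * propagator H B t = vac L := by
    rw [← hvac, groundProj, (commute_specProj_propagator hH _ _ _).eq]
    exact propagator_mul_specProj_of_disjoint hH hd _
  have hS := siteUnit_mul_vac_mul_siteUnit k k'
  have hS0 := siteUnit_zero_one_mul_vac k'
  set X := (siteUnit k 1 0).op
  set Y := (siteUnit k' 0 1).op
  set P := specProj H B
  have hZ : windowProp H B (-t) = P * propagator H B (-t) := rfl
  set S := Matrix.single (particle k) (particle k') (1 : ℂ)
  -- Up to a unitary factor the counterterms are `P S P - Z S Z` with `Z = P e^{-itH}`.
  have hW : propagator H B (-t) *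
      (window H B (comm (evol H B t X) Y) - window H B (correctedComm H B t X Y)) =
      P * S * P - windowProp H B (-t) * S * windowProp H B (-t) := by
    simp only [correctedComm, window, evol_eq, hvac, hZ]
    change propagator H B (-t) * (P * _ * P - P * _ * P) = _
    set U := propagator H B t
    set V := propagator H B (-t)
    set P₀ := vac L
    calc _ = V * (P * (U * X * (V * P₀) * Y + U * (Y * (V * P₀)) * X) * P
        - P * (Y * P₀ * (U * X * V) + X * (P₀ * U) * Y * V) * P) := by noncomm_ring
      _ = V * (P * U * (X * P₀ * Y) * P) - V * P * (X * P₀ * Y) * (V * P) := by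
        rw [hVP, hPU, hS0]
        noncomm_ring
      _ = (V * U) * P * S * P - P * V * S * (P * V) := by
        rw [hS, hcU, ← hcV]
        noncomm_ring
      _ = _ := by rw [hVU, one_mul]
  have hentry := Matrix.norm_apply_le_l2_opNorm (P * S * P - windowProp H B (-t) * S *
    windowProp H B (-t)) (particle k) (particle k')
  rw [Matrix.sub_apply, mul_single_mul_apply, mul_single_mul_apply, ← hW] at hentry
  have hnorm : ‖propagator H B (-t) *
      (window H B (comm (evol H B t X) Y) - window H B (correctedComm H B t X Y))‖ ≤
      ‖window H B (comm (evol H B t X) Y)‖ + ‖window H B (correctedComm H B t X Y)‖ := by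
    refine (norm_mul_le_of_le (norm_propagator_le hH B (-t)) (norm_sub_le _ _)).trans (le_of_eq ?_)
    rw [one_mul]
  refine le_trans ?_ (((Complex.re_le_norm _).trans hentry).trans hnorm)
  have him : (P (particle k) (particle k)).im = 0 := by rw [hp.2, Complex.ofReal_im]
  rw [Complex.sub_re, Complex.mul_re, Complex.mul_re, him, zero_mul, sub_zero]
  rw [← hB] at hz hz'
  obtain ⟨hz1, hz2, hz3⟩ := hz
  obtain ⟨hz1', hz2', hz3'⟩ := hz'
  -- Both imaginary parts are nonpositive, so their product only lowers the real part of the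
  -- product.
  have h5 := mul_le_mul hz2 hz2' hz1' (hz1.trans hz2)
  have h6 := mul_nonneg_of_nonpos_of_nonpos hz3 hz3'
  have h7 := Real.sin_sq_add_cos_sq (t * a)
  have h8 : Real.sin (t * a) ^ 2 = 1 - Real.cos (t * a) ^ 2 := by linarith
  rw [h8]
  linarith

end Counterterm

end XXZ

/-! ### Expected one-particle weights at distant sites of a random chain -/

namespace XXZ

open LocalObservable

namespace DisorderedChain

variable (M : DisorderedChain)

/-- The weight of the particle at the site `k` in the energy window `[Θ₀, b]`. -/
noncomputable def weight (b : ℝ) {L : ℕ} (k : Site L) (ω : ℤ → ℝ) : ℝ :=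
  (specProj (M.H L ω) (Set.Icc M.Θ₀ b) (particle k) (particle k)).re

theorem weight_nonneg (b : ℝ) {L : ℕ} (k : Site L) (ω : ℤ → ℝ) : 0 ≤ M.weight b k ω :=
  (specProj_apply_self_nonneg (M.H_isHermitian L ω) _ _).1

theorem measurable_weight (b : ℝ) {L : ℕ} (k : Site L) : Measurable (M.weight b k) := by
  have h : Continuous fun A : Op L => (A (particle k) (particle k)).re :=
    Complex.continuous_re.comp (continuous_id.matrix_elem _ _)
  exact (h.comp_stronglyMeasurable (stronglyMeasurable_specProj L M.Θ₀ b)).measurable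

/-- The expected product of two weights is controlled by the two clustering estimates. -/
theorem lintegral_weight_mul_weight_le {b c m₁ m₂ C₁ C₂ α : ℝ} (hm₁ : 0 ≤ m₁) (hm₂ : 0 ≤ m₂)
    (hα : 0 ≤ α) {L : ℕ} {k k' : Site L} {f g : ℝ → (ℤ → ℝ) → Op L} (t : ℝ)
    (hf : StronglyMeasurable (f t))
    (h : ∀ᵐ ω ∂M.law, c * (M.weight b k ω * M.weight b k' ω) ≤ ‖f t ω‖ + ‖g t ω‖)
    (h₁ : M.expect (fun ω => ⨆ t, ‖f t ω‖ₑ) ≤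
      ENNReal.ofReal (clusterBound C₁ m₁ α (siteUnit k 1 0) (siteUnit k' 0 1)))
    (h₂ : M.expect (fun ω => ⨆ t, ‖g t ω‖ₑ) ≤
      ENNReal.ofReal (clusterBound C₂ m₂ α (siteUnit k 1 0) (siteUnit k' 0 1))) :
    ∫⁻ ω, ENNReal.ofReal (c * (M.weight b k ω * M.weight b k' ω)) ∂M.law ≤
      ENNReal.ofReal ((max C₁ 0 + max C₂ 0) *
        Real.exp (-min m₁ m₂ * |((k : ℤ) : ℝ) - ((k' : ℤ) : ℝ)| ^ α)) := by
  have hstep : ∫⁻ ω, ENNReal.ofReal (c * (M.weight b k ω * M.weight b k' ω)) ∂M.law ≤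
      ∫⁻ ω, (‖f t ω‖ₑ + ‖g t ω‖ₑ) ∂M.law := by
    refine lintegral_mono_ae (h.mono fun ω hω => ?_)
    rw [← ofReal_norm, ← ofReal_norm, ← ENNReal.ofReal_add (norm_nonneg _) (norm_nonneg _)]
    exact ENNReal.ofReal_le_ofReal hω
  rw [lintegral_add_left hf.enorm] at hstep
  have hexp : ∀ (C m : ℝ), 0 ≤ m → min m₁ m₂ ≤ m →
      clusterBound C m α (siteUnit k 1 0) (siteUnit k' 0 1) ≤ max C 0 *
        Real.exp (-min m₁ m₂ * |((k : ℤ) : ℝ) - ((k' : ℤ) : ℝ)| ^ α) := by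
    intro C m hm hmin
    refine (clusterBound_siteUnit_le hm hα k k' 1 0 0 1).trans
      (mul_le_mul_of_nonneg_left (Real.exp_le_exp.2 ?_) (le_max_right _ _))
    exact mul_le_mul_of_nonneg_right (neg_le_neg hmin) (Real.rpow_nonneg (abs_nonneg _) _)
  have h₁' : ∫⁻ ω, ‖f t ω‖ₑ ∂M.law ≤ _ :=
    (lintegral_mono fun ω => le_iSup (fun t => ‖f t ω‖ₑ) t).trans
      (h₁.trans (ENNReal.ofReal_le_ofReal (hexp C₁ m₁ hm₁ (min_le_left _ _))))
  have h₂' : ∫⁻ ω, ‖g t ω‖ₑ ∂M.law ≤ _ :=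
    (lintegral_mono fun ω => le_iSup (fun t => ‖g t ω‖ₑ) t).trans
      (h₂.trans (ENNReal.ofReal_le_ofReal (hexp C₂ m₂ hm₂ (min_le_right _ _))))
  refine (hstep.trans (add_le_add h₁' h₂')).trans (le_of_eq ?_)
  rw [← ENNReal.ofReal_add (mul_nonneg (le_max_right _ _) (Real.exp_pos _).le)
    (mul_nonneg (le_max_right _ _) (Real.exp_pos _).le), add_mul]

theorem map_Iic_pos {ε : ℝ} (hε : 0 < ε) : 0 < (M.law.map fun ω => ω 0) (Set.Iic ε) :=
  (Measure.mem_support_iff_forall _).1 (M.subset_support (by simp)) _ (Iic_mem_nhds hε)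

/-- Independence and equal distribution make the lower bound depend only on the number of sites, not
on their positions. -/
theorem pow_card_le_measure (hR : M.IsRandom) (ε : ℝ) (S : Finset ℤ) :
    (M.law.map fun ω => ω 0) (Set.Iic ε) ^ S.card ≤ M.law {ω | ∀ i ∈ S, ω i ≤ ε} := by
  have h1 := iIndepFun.measure_inter_preimage_eq_mul (S := S) (sets := fun _ => Set.Iic ε) hR
    fun _ _ => measurableSet_Iic
  have h2 : {ω : ℤ → ℝ | ∀ i ∈ S, ω i ≤ ε} = ⋂ i ∈ S, (fun ω : ℤ → ℝ => ω i) ⁻¹' Set.Iic ε := by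
    ext ω
    simp
  rw [h2, h1, ← Finset.prod_const]
  refine le_of_eq (Finset.prod_congr rfl fun i _ => ?_)
  rw [← M.map_eval i, Measure.map_apply (measurable_pi_apply i) measurableSet_Iic]

/-- In a random chain the weights at distant sites are not small in expectation. -/
theorem not_forall_lintegral_weight_le (hR : M.IsRandom) {b : ℝ} (hb : M.Θ₀ < b) {c : ℝ}
    (hc : 0 < c) {C m α : ℝ} (hC : 0 ≤ C) (hm : 0 < m) (hα : 0 < α) :
    ¬ ∀ (L : ℕ) (k k' : Site L),
      ∫⁻ ω, ENNReal.ofReal (c * (M.weight b k ω * M.weight b k' ω)) ∂M.law ≤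
        ENNReal.ofReal (C * Real.exp (-m * |((k : ℤ) : ℝ) - ((k' : ℤ) : ℝ)| ^ α)) := by
  intro hbound
  have hlam := M.lam_pos
  have hδ : 0 < (b - M.Θ₀) / 4 := by linarith
  -- The threshold `ε` and the length `n` give the disorder and the ends of a stretch a quarter of
  -- the window width each.
  set ε := (b - M.Θ₀) / 4 / M.lam with hε
  have hε0 : 0 < ε := div_pos hδ hlam
  have hlamε : M.lam * ε ≤ (b - M.Θ₀) / 4 := le_of_eq (by rw [hε]; field_simp)
  obtain ⟨n, hn⟩ := exists_nat_ge (1 / M.Δ / ((b - M.Θ₀) / 4))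
  have hn' : 1 / M.Δ ≤ ((n : ℝ) + 1) * ((b - M.Θ₀) / 4) := by
    rw [div_le_iff₀ hδ] at hn
    linarith
  set q := (M.law.map fun ω => ω 0) (Set.Iic ε) with hq
  have hq0 : 0 < q := M.map_Iic_pos hε0
  have hq1 : q ≤ 1 := by
    have : IsProbabilityMeasure (M.law.map fun ω => ω 0) :=
      Measure.isProbabilityMeasure_map (measurable_pi_apply 0).aemeasurable
    exact prob_le_one
  have key : ∀ j : ℕ, ENNReal.ofReal (c / 4) * q ^ (2 * (n + 1)) ≤
      ENNReal.ofReal ((n + 1) * (n + 1) * (C * Real.exp (-m * (j : ℝ) ^ α))) := by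
    intro j
    -- The stretches `[0, n]` and `[D, D + n]` are at distance `j`, and `L` is large enough to keep
    -- both off the ends of the chain.
    set D : ℤ := j + n with hD
    set L : ℕ := j + 2 * n + 1 with hL
    have hsite : ∀ i : ℤ, 0 ≤ i → i ≤ D + n → i ∈ Finset.Icc (-(L : ℤ)) (L : ℤ) := fun i h1 h2 => by
      rw [Finset.mem_Icc]
      omega
    let f : Fin (n + 1) → Site L := fun i => ⟨0 + (i : ℕ), hsite _ (by omega) (by omega)⟩
    let f' : Fin (n + 1) → Site L := fun i => ⟨D + (i : ℕ), hsite _ (by omega) (by omega)⟩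
    set S : Finset ℤ := (Finset.univ.image fun i => (f i : ℤ)) ∪ Finset.univ.image fun i => (f' i : ℤ)
      with hS
    have hcard : S.card ≤ 2 * (n + 1) := by
      have h1 := Finset.card_union_le (Finset.univ.image fun i => (f i : ℤ))
        (Finset.univ.image fun i => (f' i : ℤ))
      have h2 := Finset.card_image_le (s := Finset.univ) (f := fun i => (f i : ℤ))
      have h3 := Finset.card_image_le (s := Finset.univ) (f := fun i => (f' i : ℤ))
      simp only [Finset.card_univ, Fintype.card_fin] at h2 h3
      exact h1.trans (by omega)
    set E : Set (ℤ → ℝ) := {ω | ∀ i ∈ S, ω i ≤ ε} with hE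
    have hEmeas : MeasurableSet E := by
      have : E = ⋂ i ∈ S, (fun ω : ℤ → ℝ => ω i) ⁻¹' Set.Iic ε := by
        ext ω
        simp [hE]
      rw [this]
      exact S.measurableSet_biInter fun i _ => measurable_pi_apply i measurableSet_Iic
    have hEprob : q ^ (2 * (n + 1)) ≤ M.law E :=
      (pow_le_pow_right_of_le_one' hq1 hcard).trans (M.pow_card_le_measure hR ε S)
    -- When both stretches have low disorder, each has total weight at least `1 / 2`, so the double
    -- sum is at least `c / 4`.
    have hweights : ∀ᵐ ω ∂M.law, E.indicator (fun _ => ENNReal.ofReal (c / 4)) ω ≤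
        ∑ i, ∑ i', ENNReal.ofReal (c * (M.weight b (f i) ω * M.weight b (f' i') ω)) := by
      filter_upwards [M.ae_nonneg] with ω hω
      by_cases hωE : ω ∈ E
      · rw [Set.indicator_of_mem hωE]
        have h1 : 1 / 2 ≤ ∑ i, M.weight b (f i) ω :=
          half_le_sum_specProj M.one_lt_Δ hlam M.le_β hω hb hlamε hn' f (fun i => rfl)
            (by omega) (by omega) fun i => hωE _ (Finset.mem_union_left _
              (Finset.mem_image_of_mem _ (Finset.mem_univ i)))
        have h2 : 1 / 2 ≤ ∑ i, M.weight b (f' i) ω :=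
          half_le_sum_specProj M.one_lt_Δ hlam M.le_β hω hb hlamε hn' f' (fun i => rfl)
            (by omega) (by omega) fun i => hωE _ (Finset.mem_union_right _
              (Finset.mem_image_of_mem _ (Finset.mem_univ i)))
        have hnn : ∀ i i', 0 ≤ c * (M.weight b (f i) ω * M.weight b (f' i') ω) := fun i i' =>
          mul_nonneg hc.le (mul_nonneg (M.weight_nonneg _ _ _) (M.weight_nonneg _ _ _))
        calc ENNReal.ofReal (c / 4)
            ≤ ENNReal.ofReal (∑ i, ∑ i', c * (M.weight b (f i) ω * M.weight b (f' i') ω)) := by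
              refine ENNReal.ofReal_le_ofReal ?_
              simp only [← Finset.mul_sum]
              rw [← Finset.sum_mul]
              nlinarith [mul_le_mul h1 h2 (by norm_num) (le_trans (by norm_num) h1)]
          _ = _ := by
              rw [ENNReal.ofReal_sum_of_nonneg fun i _ => Finset.sum_nonneg fun i' _ => hnn i i']
              exact Finset.sum_congr rfl fun i _ =>
                ENNReal.ofReal_sum_of_nonneg fun i' _ => hnn i i'
      · rw [Set.indicator_of_notMem hωE]
        exact zero_le
    have hmeas : ∀ i i', Measurable fun ω =>
        ENNReal.ofReal (c * (M.weight b (f i) ω * M.weight b (f' i') ω)) := fun i i' =>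
      (((M.measurable_weight b _).mul (M.measurable_weight b _)).const_mul c).ennreal_ofReal
    calc ENNReal.ofReal (c / 4) * q ^ (2 * (n + 1)) ≤ ENNReal.ofReal (c / 4) * M.law E := by gcongr
      _ = ∫⁻ ω, E.indicator (fun _ => ENNReal.ofReal (c / 4)) ω ∂M.law := by
        rw [lintegral_indicator_const hEmeas]
      _ ≤ ∫⁻ ω, ∑ i, ∑ i', ENNReal.ofReal (c * (M.weight b (f i) ω * M.weight b (f' i') ω))
          ∂M.law := lintegral_mono_ae hweights
      _ = ∑ i, ∑ i', ∫⁻ ω, ENNReal.ofReal (c * (M.weight b (f i) ω * M.weight b (f' i') ω))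
          ∂M.law := by
        rw [lintegral_finsetSum _ fun i _ => Finset.measurable_fun_sum _ fun i' _ => hmeas i i']
        exact Finset.sum_congr rfl fun i _ => lintegral_finsetSum _ fun i' _ => hmeas i i'
      _ ≤ ∑ _i : Fin (n + 1), ∑ _i' : Fin (n + 1),
          ENNReal.ofReal (C * Real.exp (-m * (j : ℝ) ^ α)) := by
        refine Finset.sum_le_sum fun i _ => Finset.sum_le_sum fun i' _ =>
          (hbound L (f i) (f' i')).trans (ENNReal.ofReal_le_ofReal
            (mul_le_mul_of_nonneg_left (Real.exp_le_exp.2 ?_) hC))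
        have hj : (j : ℝ) ≤ |((f i : ℤ) : ℝ) - ((f' i' : ℤ) : ℝ)| := by
          have h1 : (j : ℤ) ≤ |(f i : ℤ) - (f' i' : ℤ)| := by
            have h2 : (j : ℤ) ≤ -((f i : ℤ) - (f' i' : ℤ)) := by
              change (j : ℤ) ≤ -((0 + (i : ℕ) : ℤ) - (D + (i' : ℕ)))
              omega
            exact h2.trans (neg_le_abs _)
          exact_mod_cast h1
        rw [neg_mul, neg_mul, neg_le_neg_iff]
        exact mul_le_mul_of_nonneg_left (Real.rpow_le_rpow (Nat.cast_nonneg _) hj hα.le) hm.le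
      _ = _ := by
        rw [Finset.sum_const, Finset.sum_const, Finset.card_univ, Fintype.card_fin, nsmul_eq_mul,
          nsmul_eq_mul, ← mul_assoc, ENNReal.ofReal_mul (by positivity : (0 : ℝ) ≤ (n + 1) * (n + 1)),
          ENNReal.ofReal_mul (by positivity : (0 : ℝ) ≤ n + 1)]
        congr 2 <;> rw [← Nat.cast_add_one, ENNReal.ofReal_natCast]
  have hlim : Filter.Tendsto (fun j : ℕ =>
      ENNReal.ofReal ((n + 1) * (n + 1) * (C * Real.exp (-m * (j : ℝ) ^ α)))) Filter.atTop
      (nhds (ENNReal.ofReal ((n + 1) * (n + 1) * (C * 0)))) := by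
    refine ENNReal.tendsto_ofReal (Filter.Tendsto.const_mul _ (Filter.Tendsto.const_mul _ ?_))
    refine Real.tendsto_exp_atBot.comp ?_
    simp only [neg_mul]
    refine Filter.tendsto_neg_atTop_atBot.comp (Filter.Tendsto.const_mul_atTop hm ?_)
    exact (tendsto_rpow_atTop hα).comp tendsto_natCast_atTop_atTop
  -- The lower bound does not depend on `j`, whereas the upper bound tends to zero.
  have h0 := ge_of_tendsto' hlim key
  rw [mul_zero, mul_zero, ENNReal.ofReal_zero, nonpos_iff_eq_zero, mul_eq_zero] at h0
  rcases h0 with h0 | h0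
  · rw [ENNReal.ofReal_eq_zero] at h0
    linarith
  · exact pow_ne_zero _ hq0.ne' h0

theorem stronglyMeasurable_evol {L : ℕ} (b t : ℝ) (X : Op L) :
    StronglyMeasurable fun ω => evol (M.H L ω) (Set.Icc M.Θ₀ b) t X := by
  simp only [evol_eq]
  exact ((stronglyMeasurable_propagator L _ _ t).mul stronglyMeasurable_const).mul
    (stronglyMeasurable_propagator L _ _ (-t))

theorem stronglyMeasurable_corr {L : ℕ} (b t : ℝ) (X Y : Op L) :
    StronglyMeasurable fun ω => corr (M.H L ω) (Set.Icc M.Θ₀ b)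
      (evol (M.H L ω) (Set.Icc M.Θ₀ b) t X) Y := by
  have hP : StronglyMeasurable fun ω => specProj (M.H L ω) (Set.Icc M.Θ₀ b) :=
    stronglyMeasurable_specProj L _ _
  exact (((hP.mul (M.stronglyMeasurable_evol b t X)).mul (stronglyMeasurable_const.sub hP)).mul
    stronglyMeasurable_const).mul hP

theorem stronglyMeasurable_window_comm {L : ℕ} (b t : ℝ) (X Y : Op L) :
    StronglyMeasurable fun ω => window (M.H L ω) (Set.Icc M.Θ₀ b)
      (comm (evol (M.H L ω) (Set.Icc M.Θ₀ b) t X) Y) := by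
  have hP : StronglyMeasurable fun ω => specProj (M.H L ω) (Set.Icc M.Θ₀ b) :=
    stronglyMeasurable_specProj L _ _
  have hX := M.stronglyMeasurable_evol b t X
  exact (hP.mul ((hX.mul stronglyMeasurable_const).sub (stronglyMeasurable_const.mul hX))).mul hP

end DisorderedChain

end XXZ

theorem theorem2p3 (M : XXZ.DisorderedChain) (Θ₁ : ℝ) (hDL : M.PropertyDL Θ₁)
    (Θ₂ : ℝ) (hΘ₀₂ : M.Θ₀ < Θ₂) (hΘ₂ : Θ₂ < min (2 * M.Θ₀) Θ₁)
    (α : ℝ) (hα : α ∈ Set.Ioo (0 : ℝ) 1) :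
    (∃ m : ℝ, 0 < m ∧ ∃ C : ℝ, ∀ (L : ℕ) (X Y : XXZ.LocalObservable L),
      M.expect (fun ω => ⨆ t : ℝ,
          ‖XXZ.corr (M.H L ω) (Set.Icc M.Θ₀ Θ₂)
              (XXZ.evol (M.H L ω) (Set.Icc M.Θ₀ Θ₂) t X.op) Y.op
            - XXZ.counterterm (M.H L ω) (Set.Icc M.Θ₀ Θ₂) t X.op Y.op‖ₑ)
        ≤ ENNReal.ofReal (XXZ.clusterBound C m α X Y) ∧
      M.expect (fun ω => ⨆ t : ℝ,
          ‖XXZ.window (M.H L ω) (Set.Icc M.Θ₀ Θ₂)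
            (XXZ.correctedComm (M.H L ω) (Set.Icc M.Θ₀ Θ₂) t X.op Y.op)‖ₑ)
        ≤ ENNReal.ofReal (XXZ.clusterBound C m α X Y)) ∧
    (M.IsRandom →
      (¬ ∃ m : ℝ, 0 < m ∧ ∃ C : ℝ, ∀ (L : ℕ) (X Y : XXZ.LocalObservable L),
        M.expect (fun ω => ⨆ t : ℝ,
            ‖XXZ.corr (M.H L ω) (Set.Icc M.Θ₀ Θ₂)
              (XXZ.evol (M.H L ω) (Set.Icc M.Θ₀ Θ₂) t X.op) Y.op‖ₑ)
          ≤ ENNReal.ofReal (XXZ.clusterBound C m α X Y)) ∧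
      (¬ ∃ m : ℝ, 0 < m ∧ ∃ C : ℝ, ∀ (L : ℕ) (X Y : XXZ.LocalObservable L),
        M.expect (fun ω => ⨆ t : ℝ,
            ‖XXZ.window (M.H L ω) (Set.Icc M.Θ₀ Θ₂)
              (XXZ.comm (XXZ.evol (M.H L ω) (Set.Icc M.Θ₀ Θ₂) t X.op) Y.op)‖ₑ)
          ≤ ENNReal.ofReal (XXZ.clusterBound C m α X Y))) := by
  have hpos := XXZ.exists_cluster_bounds M hDL (hΘ₂.le.trans (min_le_right _ _)) hα
  refine ⟨hpos, fun hR => ?_⟩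
  obtain ⟨m₁, hm₁, C₁, h₁⟩ := hpos
  refine ⟨?_, ?_⟩
  · rintro ⟨m₂, hm₂, C₂, h₂⟩
    refine M.not_forall_lintegral_weight_le hR hΘ₀₂ one_pos
      (add_nonneg (le_max_right C₂ 0) (le_max_right C₁ 0)) (lt_min hm₂ hm₁) hα.1 fun L k k' => ?_
    refine M.lintegral_weight_mul_weight_le hm₂.le hm₁.le hα.1.le 0
      (M.stronglyMeasurable_corr Θ₂ 0 _ _) ?_ (h₂ L _ _) (h₁ L _ _).1
    filter_upwards [M.ae_nonneg] with ω hω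
    rw [one_mul]
    exact XXZ.weight_mul_weight_le_corr (M.H_isHermitian L ω) _ (M.groundProj_H hω) k k'
  · rintro ⟨m₂, hm₂, C₂, h₂⟩
    have hΘ₀ := M.Θ₀_pos
    have hb : 0 < Θ₂ := hΘ₀.trans hΘ₀₂
    have hpi := Real.pi_pos
    -- The angle is `π / 2` times `Θ₀ / Θ₂`, hence strictly between `0` and `π`.
    have hsin : 0 < Real.sin (Real.pi / (2 * Θ₂) * M.Θ₀) ^ 2 := by
      refine pow_pos (Real.sin_pos_of_pos_of_lt_pi (by positivity) ?_) 2
      rw [div_mul_eq_mul_div, div_lt_iff₀ (by positivity)]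
      nlinarith
    refine M.not_forall_lintegral_weight_le hR hΘ₀₂ hsin
      (add_nonneg (le_max_right C₂ 0) (le_max_right C₁ 0)) (lt_min hm₂ hm₁) hα.1 fun L k k' => ?_
    refine M.lintegral_weight_mul_weight_le hm₂.le hm₁.le hα.1.le (Real.pi / (2 * Θ₂))
      (M.stronglyMeasurable_window_comm Θ₂ _ _ _) ?_ (h₂ L _ _) (h₁ L _ _).2
    filter_upwards [M.ae_nonneg] with ω hω
    exact XXZ.weight_mul_weight_le_comm (M.H_isHermitian L ω) hΘ₀ hΘ₀₂ (M.groundProj_H hω) k k'
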